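/- Let $p$ be a prime and $P$ a nonidentity finite $p$-group. For subgroups $H,K\le P$ put $N_P(H,K)=\{g\in P\mid g^{-1}Hg\le K\}$. Let $\mathcal F_P$, $\widetilde{\mathcal F}_P$ and $\mathcal O_P$ be the categories whose objects are the subgroups of $P$, whose morphism sets are $$\mathcal F_P(H,K)=C_P(H)\backslash N_P(H,K),\qquad \widetilde{\mathcal F}_P(H,K)=C_P(H)\backslash N_P(H,K)/K,\qquad \mathcal O_P(H,K)=N_P(H,K)/K,$$ and whose composition is induced by multiplication in $P$ (the class of $x\in N_P(H,K)$ followed by the class of $y\in N_P(K,L)$ is the class of $xy$). Let $\mathcal S_P^{(1,P)}$ be the poset of nonidentity proper subgroups of $P$ ordered by inclusion, regarded as a category; let $\mathcal F_P^{(1,P)}$ and $\widetilde{\mathcal F}_P^{(1,P)}$ be the full subcategories of $\mathcal F_P$ and $\widetilde{\mathcal F}_P$ on the nonidentity proper subgroups; and let $\mathcal O_P^{[1,P)}$ be the full subcategory of $\mathcal O_P$ on all proper subgroups. The Euler characteristic of a finite category $\mathcal C$ is defined if there are functions $k^\bullet,k_\bullet\colon \mathrm{Ob}(\mathcal C)\to\mathbb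 Q$ with $\sum_b|\mathcal C(a,b)|k^b=1$ for all objects $a$ and $\sum_a k_a|\mathcal C(a,b)|=1$ for all objects $b$; it is then $\chi(\mathcal C)=\sum_a k^a=\sum_b k_b$, and the reduced Euler characteristic is $\widetilde\chi(\mathcal C)=\chi(\mathcal C)-1$. A category is contractible if its classifying space (the geometric realization of its nerve) is contractible; in particular the empty category is not contractible. A functor is a homotopy equivalence if the induced map of classifying spaces is a homotopy equivalence, and $\mathcal C$ is homotopy equivalent to $\mathcal D$ if there is a functor $\mathcal C\to\mathcal D$ which is a homotopy equivalence. Let $\mu(P)=\mu(1,P)$, where $\mu$ is the Möbius function of the poset of all subgroups of $P$; let $Z(P)$ be the center and $\Phi(P)$ the Frattini subgroup of $P$. Then: (a) The Euler characteristics of $\mathcal S_P^{(1,P)}$, $\widetilde{\mathcal F}_P^{(1,P)}$, $\mathcal F_P^{(1,P)}$ and $\mathcal O_P^{[1,P)}$ are defined, and $$\widetilde\chi(\mathcal S_P^{(1,P)})=\mu(P),\qquad \widetilde\chi(\widetilde{\mathcal F}_P^{(1,P)})=\mu(P)\,|P:Z(P)|^{-1}=\widetilde\chi(\mathcal F_P^{(1,P)}),$$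 while $\chi(\mathcal O_P^{[1,P)})=p^{-1}$ if $P$ is cyclic and $\chi(\mathcal O_P^{[1,P)})=1$ if $P$ is noncyclic. (b) $\mathcal S_P^{(1,P)}$ is noncontractible if and only if $P$ is elementary abelian. (c) $\mathcal O_P^{[1,P)}$ is homotopy equivalent to $\mathcal O_V^{[1,V)}$, where $V=P/\Phi(P)$. (d) $\widetilde{\mathcal F}_P^{(1,P)}$ is noncontractible if and only if $P$ is elementary abelian. -/

import Mathlib

open CategoryTheory

noncomputable section

universe u v

namespace SubgroupCat

/-! ### Categories of subgroups of a group

Maps act from the right and composition is written in diagrammatic order, as `≫` does.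
All subgroups of a `p`-group are `p`-subgroups, so for a `p`-group `G` the objects of the
categories below are exactly the `p`-subgroups of `G`. -/

section Categories

variable {G : Type u} [Group G]

/-- The transporter set `N_G(H, K) = {g ∈ G | H ^ g ≤ K}`, where `H ^ g = g⁻¹ H g`. -/
def transporter (H K : Subgroup G) : Set G :=
  {g | ∀ h ∈ H, g⁻¹ * h * g ∈ K}

theorem one_mem_transporter (H : Subgroup G) : (1 : G) ∈ transporter H H := by
  intro h hh
  simpa using hh

theorem mul_mem_transporter {H K L : Subgroup G} {x y : G} (hx : x ∈ transporter H K)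
    (hy : y ∈ transporter K L) : x * y ∈ transporter H L := by
  intro h hh
  have := hy _ (hx h hh)
  simpa [mul_assoc] using this

theorem conj_mem_of_transporter {H K : Subgroup G} {y k : G} (hy : y ∈ transporter H K)
    (hk : k ∈ H) : ∃ l ∈ K, k * y = y * l :=
  ⟨y⁻¹ * k * y, hy k hk, by group⟩

theorem centralizer_conj_of_transporter {H K : Subgroup G} {x c : G} (hx : x ∈ transporter H K)
    (hc : c ∈ Subgroup.centralizer (K : Set G)) :
    x * c * x⁻¹ ∈ Subgroup.centralizer (H : Set G) := by
  rw [Subgroup.mem_centralizer_iff] at hc ⊢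
  intro h hh
  have h1 := hc _ (hx h hh)
  have h2 : h * x * c = x * c * x⁻¹ * h * x := by
    calc h * x * c = x * (x⁻¹ * h * x * c) := by group
      _ = x * (c * (x⁻¹ * h * x)) := by rw [h1]
      _ = x * c * x⁻¹ * h * x := by group
  calc h * (x * c * x⁻¹) = h * x * c * x⁻¹ := by group
    _ = x * c * x⁻¹ * h * x * x⁻¹ := by rw [h2]
    _ = x * c * x⁻¹ * h := by group

/-- `O_G(H, K) = N_G(H, K) / K`. -/
def OrbitHom (H K : Subgroup G) : Type u :=
  Quotient ((QuotientGroup.leftRel K).comap (Subtype.val : transporter H K → G))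

/-- `F_G(H, K) = C_G(H) \ N_G(H, K)`. -/
def FusionHom (H K : Subgroup G) : Type u :=
  Quotient ((QuotientGroup.rightRel (Subgroup.centralizer (H : Set G))).comap
    (Subtype.val : transporter H K → G))

/-- `F̃_G(H, K) = C_G(H) \ N_G(H, K) / K`. -/
def ExteriorHom (H K : Subgroup G) : Type u :=
  Quotient ((DoubleCoset.setoid (Subgroup.centralizer (H : Set G) : Set G) (K : Set G)).comap
    (Subtype.val : transporter H K → G))

variable (G)

/-- The objects of the orbit category `O_G`. -/
@[ext] structure OrbitCat : Type u where
  toSubgroup : Subgroup G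

/-- The objects of the fusion (Frobenius) category `F_G`. -/
@[ext] structure FusionCat : Type u where
  toSubgroup : Subgroup G

/-- The objects of the exterior quotient `F̃_G` of the fusion category. -/
@[ext] structure ExteriorCat : Type u where
  toSubgroup : Subgroup G

variable {G}

/-- Composition in `O_G`, `F_G` and `F̃_G` is induced by multiplication in `G`:
the class of `x` followed by the class of `y` is the class of `x * y`. -/
def OrbitHom.comp {H K L : Subgroup G} : OrbitHom H K → OrbitHom K L → OrbitHom H L :=
  Quotient.map₂ (fun x y => ⟨x.1 * y.1, mul_mem_transporter x.2 y.2⟩) (by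
    rintro ⟨x, hx⟩ ⟨x', hx'⟩ hxx ⟨y, hy⟩ ⟨y', hy'⟩ hyy
    change QuotientGroup.leftRel K x x' at hxx
    change QuotientGroup.leftRel L y y' at hyy
    change QuotientGroup.leftRel L (x * y) (x' * y')
    rw [QuotientGroup.leftRel_apply] at *
    have h := L.mul_mem (hy _ hxx) hyy
    convert h using 1
    group)

/-- Composition in `F_G`. -/
def FusionHom.comp {H K L : Subgroup G} : FusionHom H K → FusionHom K L → FusionHom H L :=
  Quotient.map₂ (fun x y => ⟨x.1 * y.1, mul_mem_transporter x.2 y.2⟩) (by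
    rintro ⟨x, hx⟩ ⟨x', hx'⟩ hxx ⟨y, hy⟩ ⟨y', hy'⟩ hyy
    change QuotientGroup.rightRel (Subgroup.centralizer (H : Set G)) x x' at hxx
    change QuotientGroup.rightRel (Subgroup.centralizer (K : Set G)) y y' at hyy
    change QuotientGroup.rightRel (Subgroup.centralizer (H : Set G)) (x * y) (x' * y')
    rw [QuotientGroup.rightRel_apply] at *
    have h := Subgroup.mul_mem _ (centralizer_conj_of_transporter hx' hyy) hxx
    convert h using 1
    group)

/-- Composition in `F̃_G`. -/
def ExteriorHom.comp {H K L : Subgroup G} :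
    ExteriorHom H K → ExteriorHom K L → ExteriorHom H L :=
  Quotient.map₂ (fun x y => ⟨x.1 * y.1, mul_mem_transporter x.2 y.2⟩) (by
    rintro ⟨x, hx⟩ ⟨x', hx'⟩ hxx ⟨y, hy⟩ ⟨y', hy'⟩ hyy
    change DoubleCoset.setoid (Subgroup.centralizer (H : Set G) : Set G) (K : Set G) x x' at hxx
    change DoubleCoset.setoid (Subgroup.centralizer (K : Set G) : Set G) (L : Set G) y y' at hyy
    change DoubleCoset.setoid (Subgroup.centralizer (H : Set G) : Set G) (L : Set G)
      (x * y) (x' * y')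
    rw [DoubleCoset.rel_iff] at *
    obtain ⟨c, hc, k, hk, rfl⟩ := hxx
    obtain ⟨d, hd, l, hl, rfl⟩ := hyy
    obtain ⟨m, hm, hkm⟩ := conj_mem_of_transporter hy hk
    have hdk : k * d = d * k := Subgroup.mem_centralizer_iff.mp hd k hk
    refine ⟨c * (x * d * x⁻¹), Subgroup.mul_mem _ hc (centralizer_conj_of_transporter hx hd),
      m * l, L.mul_mem hm hl, ?_⟩
    calc c * x * k * (d * y * l) = c * x * (k * d) * y * l := by group
      _ = c * x * d * (k * y) * l := by rw [hdk]; group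
      _ = c * (x * d * x⁻¹) * (x * y) * (m * l) := by rw [hkm]; group)

instance : Category.{u} (OrbitCat G) where
  Hom H K := OrbitHom H.toSubgroup K.toSubgroup
  id H := Quotient.mk _ ⟨1, one_mem_transporter H.toSubgroup⟩
  comp := OrbitHom.comp
  id_comp := by
    rintro H K ⟨x, hx⟩
    exact congrArg (Quotient.mk _) (Subtype.ext (one_mul x))
  comp_id := by
    rintro H K ⟨x, hx⟩
    exact congrArg (Quotient.mk _) (Subtype.ext (mul_one x))
  assoc := by
    rintro H K L M ⟨x, hx⟩ ⟨y, hy⟩ ⟨z, hz⟩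
    exact congrArg (Quotient.mk _) (Subtype.ext (mul_assoc x y z))

instance : Category.{u} (FusionCat G) where
  Hom H K := FusionHom H.toSubgroup K.toSubgroup
  id H := Quotient.mk _ ⟨1, one_mem_transporter H.toSubgroup⟩
  comp := FusionHom.comp
  id_comp := by
    rintro H K ⟨x, hx⟩
    exact congrArg (Quotient.mk _) (Subtype.ext (one_mul x))
  comp_id := by
    rintro H K ⟨x, hx⟩
    exact congrArg (Quotient.mk _) (Subtype.ext (mul_one x))
  assoc := by
    rintro H K L M ⟨x, hx⟩ ⟨y, hy⟩ ⟨z, hz⟩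
    exact congrArg (Quotient.mk _) (Subtype.ext (mul_assoc x y z))

instance : Category.{u} (ExteriorCat G) where
  Hom H K := ExteriorHom H.toSubgroup K.toSubgroup
  id H := Quotient.mk _ ⟨1, one_mem_transporter H.toSubgroup⟩
  comp := ExteriorHom.comp
  id_comp := by
    rintro H K ⟨x, hx⟩
    exact congrArg (Quotient.mk _) (Subtype.ext (one_mul x))
  comp_id := by
    rintro H K ⟨x, hx⟩
    exact congrArg (Quotient.mk _) (Subtype.ext (mul_one x))
  assoc := by
    rintro H K L M ⟨x, hx⟩ ⟨y, hy⟩ ⟨z, hz⟩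
    exact congrArg (Quotient.mk _) (Subtype.ext (mul_assoc x y z))

end Categories

section Intervals

variable (P : Type u) [Group P]

/-- The poset `S_P^{(1,P)}` of nonidentity proper subgroups of `P`, ordered by inclusion and
regarded as a category. -/
abbrev PosetOpen : Type u := Set.Ioo (⊥ : Subgroup P) ⊤

/-- `O_P^{[1,P)}`: the full subcategory of `O_P` on all proper subgroups of `P`. -/
abbrev OrbitProper : Type u :=
  ObjectProperty.FullSubcategory
    (fun H : OrbitCat P => H.toSubgroup ∈ Set.Ico (⊥ : Subgroup P) ⊤)

/-- `F_P^{(1,P)}`: the full subcategory of `F_P` on all nonidentity proper subgroups of `P`. -/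
abbrev FusionOpen : Type u :=
  ObjectProperty.FullSubcategory
    (fun H : FusionCat P => H.toSubgroup ∈ Set.Ioo (⊥ : Subgroup P) ⊤)

/-- `F̃_P^{(1,P)}`: the full subcategory of `F̃_P` on all nonidentity proper subgroups of `P`. -/
abbrev ExteriorOpen : Type u :=
  ObjectProperty.FullSubcategory
    (fun H : ExteriorCat P => H.toSubgroup ∈ Set.Ioo (⊥ : Subgroup P) ⊤)

/-- `μ(P) = μ(1, P)`, where `μ` is the Möbius function of the poset of all subgroups of the finite
group `P`. -/
def subgroupMoebius [Finite P] : ℤ := by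
  classical
  letI : Fintype (Subgroup P) := Fintype.ofFinite _
  letI : LocallyFiniteOrder (Subgroup P) := Fintype.toLocallyFiniteOrder
  exact IncidenceAlgebra.mu ℤ (α := Subgroup P) ⊥ ⊤

/-- `P` is an elementary abelian `p`-group: abelian, with `x ^ p = 1` for all `x`. -/
def IsElementaryAbelian (p : ℕ) : Prop :=
  (∀ x y : P, x * y = y * x) ∧ ∀ x : P, x ^ p = 1

end Intervals

/-! ### Euler characteristic of a finite category -/

section Euler

variable (C : Type u) [Category.{v} C]

/-- `k` is a weighting: `∑ b, |C(a, b)| k b = 1` for all objects `a` (the sums over objects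
are over a finite type wherever this is used). -/
def IsWeighting (k : C → ℚ) : Prop :=
  ∀ a : C, ∑ᶠ b : C, (Nat.card (a ⟶ b) : ℚ) * k b = 1

/-- `k` is a coweighting: `∑ a, k a |C(a, b)| = 1` for all objects `b`. -/
def IsCoweighting (k : C → ℚ) : Prop :=
  ∀ b : C, ∑ᶠ a : C, k a * (Nat.card (a ⟶ b) : ℚ) = 1

/-- `C` is a finite category which has a weighting and a coweighting, and its Euler
characteristic is the rational number `χ`. -/
structure HasEulerChar (χ : ℚ) : Prop where
  finite_obj : Finite C
  finite_hom : ∀ a b : C, Finite (a ⟶ b)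
  exists_weighting : ∃ k : C → ℚ, IsWeighting C k ∧ ∑ᶠ a : C, k a = χ
  exists_coweighting : ∃ k : C → ℚ, IsCoweighting C k ∧ ∑ᶠ a : C, k a = χ

/-- `C` has an Euler characteristic, and its reduced Euler characteristic `χ(C) - 1` is `e`. -/
def HasReducedEulerChar (e : ℚ) : Prop :=
  ∃ χ : ℚ, HasEulerChar C χ ∧ χ - 1 = e

variable {C}

/-- All weightings and all coweightings have the same sum. -/
theorem IsWeighting.sum_eq [Finite C] {k l : C → ℚ} (hk : IsWeighting C k)
    (hl : IsCoweighting C l) : ∑ᶠ a : C, k a = ∑ᶠ a : C, l a := by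
  classical
  have : Fintype C := Fintype.ofFinite C
  simp only [IsWeighting, IsCoweighting, finsum_eq_sum_of_fintype] at *
  calc ∑ b, k b = ∑ b, (∑ a, l a * (Nat.card (a ⟶ b) : ℚ)) * k b := by simp [hl]
    _ = ∑ b, ∑ a, l a * ((Nat.card (a ⟶ b) : ℚ) * k b) := by
        simp only [Finset.sum_mul, mul_assoc]
    _ = ∑ a, ∑ b, l a * ((Nat.card (a ⟶ b) : ℚ) * k b) := Finset.sum_comm
    _ = ∑ a, l a := by simp only [← Finset.mul_sum, hk, mul_one]

/-- The Euler characteristic is unique. -/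
theorem HasEulerChar.unique {χ χ' : ℚ} (h : HasEulerChar C χ) (h' : HasEulerChar C χ') :
    χ = χ' := by
  have := h.finite_obj
  obtain ⟨k, hk, rfl⟩ := h.exists_weighting
  obtain ⟨l, hl, rfl⟩ := h'.exists_coweighting
  exact hk.sum_eq hl

end Euler

/-! ### Classifying spaces -/

section Classifying

/-- The classifying space `BC`: the geometric realization of the nerve of `C`. -/
def classifyingSpace (C : Type u) [Category.{v} C] : TopCat.{max u v} :=
  SSet.toTop.obj (nerve C)

/-- The map of classifying spaces induced by a functor. -/
def classifyingMap {C D : Type u} [Category.{v} C] [Category.{v} D] (F : C ⥤ D) :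
    C(classifyingSpace C, classifyingSpace D) :=
  (SSet.toTop.map (nerveMap F)).hom

/-- A category is contractible if its classifying space is (in particular, the empty category is
not contractible). -/
def IsContractible (C : Type u) [Category.{v} C] : Prop :=
  ContractibleSpace (classifyingSpace C)

/-- A functor is a homotopy equivalence if the induced map of classifying spaces is a homotopy
equivalence of topological spaces. -/
def IsHomotopyEquivalence {C D : Type u} [Category.{v} C] [Category.{v} D] (F : C ⥤ D) : Prop :=
  ∃ e : ContinuousMap.HomotopyEquiv (classifyingSpace C) (classifyingSpace D),
    e.toFun = classifyingMap F

/-- Two categories are homotopy equivalent if there is a functor from the first to the second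
which is a homotopy equivalence. -/
def HomotopyEquivalent (C D : Type u) [Category.{v} C] [Category.{v} D] : Prop :=
  ∃ F : C ⥤ D, IsHomotopyEquivalence F

end Classifying

end SubgroupCat

end

/-!
The four parts of the theorem rest on two independent circles of ideas.

*Euler characteristics.* In each of the four categories an explicit weighting or coweighting is
given by the Möbius function `μ` of the lattice of subgroups of `P`. The orbit counting theorem
(`card_doubleCoset`) turns the sizes of the morphism sets into numbers of group elements `x`, or
pairs of group elements, such that `H` lies in a subgroup `S x` (or contains it), for example the
number of `x` with `H ≤ x K x⁻¹`. By Möbius inversion the sum over all `H` of `μ(1, H)` times the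
number of `x` with `H ≤ S x` is the number of `x` with `S x = 1`, and dually; this is what
`finsum_moebius_bot_mul_card` and `finsum_moebius_top_mul_card` say. The nontriviality of centers
of `p`-groups makes this number zero wherever it has to be. All weightings and coweightings have
the same sum, so that of the other kind only existence is needed, which is a general fact about
finite categories in which morphisms do not decrease a rank and are invertible if they preserve it
(`exists_isWeighting_and_isCoweighting`).

*Contractibility.* Natural transformations induce homotopies (`classifyingMap_homotopic`). If `P`
is not elementary abelian, then the normal subgroup `Φ(P)` is nontrivial and meets the center in a
subgroup `Z ≠ 1` of nongenerators, and `H ≤ HZ ≥ Z` is a natural zigzag between the identity and a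
constant functor, on the poset of subgroups as well as on the exterior quotient. In the same way
`H ↦ HΦ(P)/Φ(P)` and the functor of preimages are inverse to each other up to natural
transformations on orbit categories (`homotopyEquivalent_orbitProper`). For abelian `P` the exterior
quotient is the poset of subgroups.

The remaining point is that the poset of proper nontrivial subgroups of an elementary abelian group
is not contractible (`not_isContractible_posetOpen`). Choose a basis. The subspaces spanned by
proper nonempty subsets of the basis form a copy of the poset of faces of the boundary of a simplex,
and sending a subspace to its set of pivots is a monotone retraction onto this copy. So a
contraction would contract a sphere. That this is impossible follows from a theorem of Brouwer type:
a continuous map `ℝᵐ → ℝᵐ` which is the identity outside a bounded set has a zero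
(`exists_eq_zero_of_eq_self`). It is deduced from a combinatorial lemma (`exists_cube`), whose proof
computes modulo `2` with cup products on a discrete torus: the product of the cocycles of the
coordinate hyperplanes is nonzero, and it does not change if each cocycle is replaced by a
cohomologous one, supported where a coordinate of the given map changes its sign.
-/

noncomputable section

universe u v w

namespace SubgroupCat

/-! ### Points of geometric realizations -/

section Points

open Simplicial Opposite

variable {X Y : SSet.{w}}

/-- The point of the geometric realization `|X|` with barycentric coordinates `t` in the
simplex `s`. -/
def simplexPoint {n : ℕ} (s : X _⦋n⦌) (t : stdSimplex ℝ (Fin (n + 1))) : SSet.toTop.obj X :=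
  SSet.toTop.map (SSet.yonedaEquiv.symm s) ((SimplexCategory.toTopHomeo ⦋n⦌).symm t)

theorem continuous_simplexPoint {n : ℕ} (s : X _⦋n⦌) : Continuous (simplexPoint s) :=
  (SSet.toTop.map (SSet.yonedaEquiv.symm s)).hom.continuous.comp
    (SimplexCategory.toTopHomeo ⦋n⦌).symm.continuous

/-- The face and degeneracy relations between the points of a geometric realization. -/
theorem simplexPoint_map {n m : ℕ} (θ : ⦋n⦌ ⟶ ⦋m⦌) (s : X _⦋m⦌)
    (t : stdSimplex ℝ (Fin (n + 1))) :
    simplexPoint (X.map θ.op s) t = simplexPoint s (stdSimplex.map θ t) := by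
  unfold simplexPoint
  have h1 : SSet.yonedaEquiv.symm (X.map θ.op s) =
      SSet.stdSimplex.map θ ≫ SSet.yonedaEquiv.symm s := by
    apply SSet.yonedaEquiv.injective
    rw [Equiv.apply_symm_apply, ← SSet.yonedaEquiv_naturality, Equiv.apply_symm_apply]
  rw [h1, Functor.map_comp]
  erw [SimplexCategory.toTopHomeo_symm_naturality_apply]
  rfl

theorem toTop_map_simplexPoint {n : ℕ} (f : X ⟶ Y) (s : X _⦋n⦌)
    (t : stdSimplex ℝ (Fin (n + 1))) :
    SSet.toTop.map f (simplexPoint s t) = simplexPoint (f.app _ s) t := by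
  unfold simplexPoint
  have h1 : SSet.yonedaEquiv.symm (f.app _ s) = SSet.yonedaEquiv.symm s ≫ f := by
    apply SSet.yonedaEquiv.injective
    simp
  rw [h1, Functor.map_comp]
  rfl

theorem homEquiv_apply {Z : TopCat.{w}} (f : SSet.toTop.obj X ⟶ Z) {n : ℕ} (s : X _⦋n⦌)
    (t : stdSimplex ℝ (Fin (n + 1))) :
    Z.toSSetObjEquiv _ ((sSetTopAdj.homEquiv X Z f).app (op ⦋n⦌) s) t = f (simplexPoint s t) := by
  rw [Adjunction.homEquiv_unit]
  have := sSetTopAdj_unit_app_app_down X (op ⦋n⦌) s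
  change ((((sSetTopAdj.unit.app X).app (op ⦋n⦌) s).down) ≫ f) (ULift.up t) = _
  rw [this]
  rfl

/-- A continuous map out of a geometric realization is determined by its values on all simplices. -/
theorem toTop_hom_ext {Z : Type w} [TopologicalSpace Z] {f g : C(SSet.toTop.obj X, Z)}
    (h : ∀ (n : ℕ) (s : X _⦋n⦌) (t : stdSimplex ℝ (Fin (n + 1))),
      f (simplexPoint s t) = g (simplexPoint s t)) : f = g := by
  have : (TopCat.ofHom f : SSet.toTop.obj X ⟶ TopCat.of Z) = TopCat.ofHom g := by
    apply (sSetTopAdj.homEquiv X (TopCat.of Z)).injective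
    ext ⟨⟨n⟩⟩ s
    apply ((TopCat.of Z).toSSetObjEquiv _).injective
    ext t
    exact (homEquiv_apply _ s t).trans ((h n s t).trans (homEquiv_apply _ s t).symm)
  exact congrArg TopCat.Hom.hom this

/-- Compatible continuous maps on all simplices glue to a continuous map on the geometric
realization, by the adjunction with the singular complex. -/
theorem exists_toTop_desc {Z : Type w} [TopologicalSpace Z]
    (h : ∀ n : ℕ, X _⦋n⦌ → C(stdSimplex ℝ (Fin (n + 1)), Z))
    (hh : ∀ (n m : ℕ) (θ : ⦋n⦌ ⟶ ⦋m⦌) (s : X _⦋m⦌) (t : stdSimplex ℝ (Fin (n + 1))),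
      h n (X.map θ.op s) t = h m s (stdSimplex.map θ t)) :
    ∃ f : C(SSet.toTop.obj X, Z), ∀ (n : ℕ) (s : X _⦋n⦌) (t : stdSimplex ℝ (Fin (n + 1))),
      f (simplexPoint s t) = h n s t := by
  let g : X ⟶ TopCat.toSSet.obj (TopCat.of Z) :=
    { app := fun n => ↾fun s => ((TopCat.of Z).toSSetObjEquiv n).symm (h n.unop.len s)
      naturality := by
        rintro ⟨⟨n⟩⟩ ⟨⟨m⟩⟩ θ
        ext s
        apply ((TopCat.of Z).toSSetObjEquiv _).injective
        ext t
        exact hh _ _ θ.unop s t }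
  refine ⟨((sSetTopAdj.homEquiv X (TopCat.of Z)).symm g).hom, fun n s t => ?_⟩
  have := homEquiv_apply ((sSetTopAdj.homEquiv X (TopCat.of Z)).symm g) s t
  rw [Equiv.apply_symm_apply] at this
  exact this.symm

end Points

/-! ### The order complex of a finite poset -/

section Chains

variable {Q Q' : Type*} [PartialOrder Q] [PartialOrder Q'] {D : Type u} [Category.{v} D]

/-- The point of `|N D|` with barycentric coordinates `t` in the simplex which is the image under
`E` of the chain `π`. -/
def chainPoint (E : Q ⥤ D) {k : ℕ} (π : Fin (k + 1) →o Q) (t : stdSimplex ℝ (Fin (k + 1))) :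
    classifyingSpace D :=
  simplexPoint (X := nerve D) (n := k) (π.monotone.functor ⋙ E) t

theorem continuous_chainPoint (E : Q ⥤ D) {k : ℕ} (π : Fin (k + 1) →o Q) :
    Continuous (chainPoint E π) :=
  continuous_simplexPoint _

theorem chainPoint_comp (E : Q ⥤ D) {k l : ℕ} (π : Fin (k + 1) →o Q)
    (θ : Fin (l + 1) →o Fin (k + 1)) (t : stdSimplex ℝ (Fin (l + 1))) :
    chainPoint E (π.comp θ) t = chainPoint E π (stdSimplex.map θ t) :=
  simplexPoint_map (X := nerve D) (SimplexCategory.mkHom θ) (π.monotone.functor ⋙ E) t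

theorem chainPoint_functor_comp (A : Q' →o Q) (E : Q ⥤ D) {k : ℕ} (π : Fin (k + 1) →o Q')
    (t : stdSimplex ℝ (Fin (k + 1))) :
    chainPoint (A.monotone.functor ⋙ E) π t = chainPoint E (A.comp π) t := rfl

/-- Every point of a simplex lies in the interior of a face. -/
theorem exists_positive_simplex {k : ℕ} (t : stdSimplex ℝ (Fin (k + 1))) :
    ∃ (r : ℕ) (θ : Fin (r + 1) →o Fin (k + 1)) (t' : stdSimplex ℝ (Fin (r + 1))),
      stdSimplex.map θ t' = t ∧ ∀ i, t' i ≠ 0 := by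
  classical
  let S : Finset (Fin (k + 1)) := Finset.univ.filter fun i => t i ≠ 0
  have hsum := stdSimplex.sum_eq_one t
  have hS : S.Nonempty := by
    by_contra h
    rw [Finset.not_nonempty_iff_eq_empty] at h
    have h0 : ∀ i, t i = 0 := fun i => by
      by_contra hi
      have : i ∈ S := by simp [S, hi]
      simp [h] at this
    simp [h0] at hsum
  obtain ⟨r, hr⟩ : ∃ r, S.card = r + 1 := ⟨S.card - 1, by have := hS.card_pos; omega⟩
  let θ := S.orderEmbOfFin hr
  have hθ : ∀ i, t (θ i) ≠ 0 := fun i => by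
    exact (Finset.mem_filter.mp (S.orderEmbOfFin_mem hr i)).2
  have hsurj : ∀ j, t j ≠ 0 → ∃ i, θ i = j := fun j hj => by
    have h1 : j ∈ (S : Set (Fin (k + 1))) := by simp [S, hj]
    rw [← S.range_orderEmbOfFin hr] at h1
    exact h1
  have hpush : ∀ j, ∑ i with θ i = j, t (θ i) = t j := by
    intro j
    by_cases hj : t j = 0
    · rw [hj]
      apply Finset.sum_eq_zero
      intro i hi
      rw [(Finset.mem_filter.mp hi).2, hj]
    · obtain ⟨i, rfl⟩ := hsurj j hj
      rw [Finset.sum_eq_single i]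
      · intro b hb hbi
        exact absurd (θ.injective (Finset.mem_filter.mp hb).2) hbi
      · simp
  refine ⟨r, θ.toOrderHom, ⟨fun i => t (θ i), fun i => t.2.1 _, ?_⟩, ?_, hθ⟩
  · rw [← hsum, ← Finset.sum_fiberwise Finset.univ θ]
    exact Finset.sum_congr rfl fun j _ => hpush j
  · ext j
    rw [stdSimplex.map_coe, FunOnFinite.linearMap_apply_apply]
    exact hpush j

/-- Two points of chains of `Q` agree if they have the same barycentric coordinates as functions
on `Q`. -/
theorem chainPoint_eq [Fintype Q] (E : Q ⥤ D) {k l : ℕ} (π : Fin (k + 1) →o Q)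
    (π' : Fin (l + 1) →o Q) (t : stdSimplex ℝ (Fin (k + 1))) (t' : stdSimplex ℝ (Fin (l + 1)))
    (h : stdSimplex.map π t = stdSimplex.map π' t') : chainPoint E π t = chainPoint E π' t' := by
  classical
  obtain ⟨r, θ, t, rfl, ht⟩ := exists_positive_simplex t
  rw [← chainPoint_comp]
  rw [stdSimplex.map_comp_apply] at h
  set ρ := π.comp θ with hρ
  change stdSimplex.map ρ t = _ at h
  have hmem : ∀ i, ∃ j, π' j = ρ i := by
    intro i
    by_contra hj
    push Not at hj
    have h1 : stdSimplex.map ρ t (ρ i) = 0 := by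
      rw [h, stdSimplex.map_coe, FunOnFinite.linearMap_apply_apply]
      apply Finset.sum_eq_zero
      intro j hj'
      exact absurd (Finset.mem_filter.mp hj').2 (hj j)
    rw [stdSimplex.map_coe, FunOnFinite.linearMap_apply_apply] at h1
    exact ht i ((Finset.sum_eq_zero_iff_of_nonneg (fun _ _ => t.2.1 _)).mp h1 i (by simp))
  let g : Q → Fin (l + 1) := fun q => if h : ∃ j, π' j = q then h.choose else 0
  have hg : ∀ q, (∃ j, π' j = q) → π' (g q) = q := fun q hq => by
    simp only [g, dif_pos hq]
    exact hq.choose_spec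
  have key : ∀ {m : ℕ} (σ : Fin (m + 1) →o Q), (∀ i, ∃ j, π' j = σ i) → Monotone (g ∘ σ) := by
    intro m σ hσ i j hij
    rcases (σ.monotone hij).eq_or_lt with he | hlt
    · simp [he]
    · by_contra hc
      have := π'.monotone (not_le.mp hc).le
      simp only [Function.comp, hg _ (hσ _)] at this
      exact absurd hlt (not_lt_of_ge this)
  have e1 : chainPoint E ρ t = chainPoint E π' (stdSimplex.map (g ∘ ρ) t) := by
    have := chainPoint_comp E π' ⟨g ∘ ρ, key ρ hmem⟩ t
    have h2 : π'.comp ⟨g ∘ ρ, key ρ hmem⟩ = ρ := by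
      ext i
      exact hg _ (hmem i)
    rw [h2] at this
    exact this
  have e2 : chainPoint E π' t' = chainPoint E π' (stdSimplex.map (g ∘ π') t') := by
    have := chainPoint_comp E π' ⟨g ∘ π', key π' fun i => ⟨i, rfl⟩⟩ t'
    have h2 : π'.comp ⟨g ∘ π', key π' fun i => ⟨i, rfl⟩⟩ = π' := by
      ext i
      exact hg _ ⟨i, rfl⟩
    rw [h2] at this
    exact this
  rw [e1, e2]
  congr 1
  have a1 := stdSimplex.map_comp_apply (S := ℝ) ρ g t
  have a2 := stdSimplex.map_comp_apply (S := ℝ) π' g t'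
  rw [h] at a1
  exact a1.symm.trans a2

variable (Q) in
/-- The order complex of a finite poset `Q`: the functions `w : Q → ℝ` with nonnegative values
and sum `1` whose support is a chain. -/
abbrev ChainMeasure [Fintype Q] : Type _ :=
  {w : stdSimplex ℝ Q // IsChain (· ≤ ·) {q | w q ≠ 0}}

variable [Fintype Q] [Fintype Q']

theorem isChain_support_map {k : ℕ} (π : Fin (k + 1) →o Q) (t : stdSimplex ℝ (Fin (k + 1))) :
    IsChain (· ≤ ·) {q | stdSimplex.map π t q ≠ 0} := by
  classical
  have key : ∀ q, stdSimplex.map π t q ≠ 0 → ∃ i, π i = q := by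
    intro q hq
    rw [stdSimplex.map_coe, FunOnFinite.linearMap_apply_apply] at hq
    obtain ⟨i, hi, -⟩ := Finset.exists_ne_zero_of_sum_ne_zero hq
    exact ⟨i, (Finset.mem_filter.mp hi).2⟩
  intro a ha b hb _
  obtain ⟨i, rfl⟩ := key a ha
  obtain ⟨j, rfl⟩ := key b hb
  rcases le_total i j with h | h
  · exact Or.inl (π.monotone h)
  · exact Or.inr (π.monotone h)

/-- Every point of the order complex lies on a chain. -/
theorem exists_chain_rep (w : ChainMeasure Q) :
    ∃ (k : Fin (Fintype.card Q + 1)) (π : Fin (k.1 + 1) →o Q) (t : stdSimplex ℝ (Fin (k.1 + 1))),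
      stdSimplex.map π t = w.1 := by
  classical
  obtain ⟨w, hw⟩ := w
  let S := {q : Q // w q ≠ 0}
  have hsum := stdSimplex.sum_eq_one w
  have hne : Nonempty S := by
    by_contra h
    rw [not_nonempty_iff] at h
    have h0 : ∀ q, w q = 0 := fun q => by
      by_contra hq
      exact h.elim ⟨q, hq⟩
    simp [h0] at hsum
  let _ : LinearOrder S :=
    { (inferInstance : PartialOrder S) with
      le_total := fun a b => by
        by_cases hab : a = b
        · exact Or.inl hab.le
        · exact hw a.2 b.2 (fun h => hab (Subtype.ext h))
      toDecidableLE := Classical.decRel _ }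
  obtain ⟨r, hr⟩ : ∃ r, Fintype.card S = r + 1 :=
    ⟨Fintype.card S - 1, by have := Fintype.card_pos (α := S); omega⟩
  have hle : Fintype.card S ≤ Fintype.card Q := Fintype.card_subtype_le _
  let e : Fin (r + 1) ≃o S := Fintype.orderIsoFinOfCardEq S hr
  have hpush : ∀ q, ∑ i with (e i : Q) = q, w (e i) = w q := by
    intro q
    by_cases hq : w q = 0
    · rw [hq]
      apply Finset.sum_eq_zero
      intro i hi
      rw [(Finset.mem_filter.mp hi).2, hq]
    · rw [Finset.sum_eq_single (e.symm ⟨q, hq⟩)]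
      · simp
      · intro b hb hbi
        refine absurd ?_ hbi
        rw [OrderIso.eq_symm_apply]
        exact Subtype.ext (Finset.mem_filter.mp hb).2
      · simp
  refine ⟨⟨r, by omega⟩, ⟨fun i => (e i : Q), fun i j hij => e.monotone hij⟩,
    ⟨fun i => w (e i), fun i => w.2.1 _, ?_⟩, ?_⟩
  · rw [← hsum, ← Finset.sum_fiberwise Finset.univ (fun i => (e i : Q))]
    exact Finset.sum_congr rfl fun j _ => hpush j
  · ext j
    rw [stdSimplex.map_coe, FunOnFinite.linearMap_apply_apply]
    exact hpush j

/-- The continuous map from the order complex of `Q` to `|N D|` induced by a functor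
`E : Q ⥤ D`. -/
def ofChainMeasure (E : Q ⥤ D) (w : ChainMeasure Q) : classifyingSpace D :=
  chainPoint E (exists_chain_rep w).choose_spec.choose
    (exists_chain_rep w).choose_spec.choose_spec.choose

theorem ofChainMeasure_eq (E : Q ⥤ D) (w : ChainMeasure Q) {k : ℕ} (π : Fin (k + 1) →o Q)
    (t : stdSimplex ℝ (Fin (k + 1))) (h : stdSimplex.map π t = w.1) :
    ofChainMeasure E w = chainPoint E π t :=
  chainPoint_eq E _ _ _ _
    ((exists_chain_rep w).choose_spec.choose_spec.choose_spec.trans h.symm)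

/-- The point of the order complex with barycentric coordinates `t` in the chain `π`. -/
def chainMeasure {k : ℕ} (π : Fin (k + 1) →o Q) (t : stdSimplex ℝ (Fin (k + 1))) :
    ChainMeasure Q :=
  ⟨stdSimplex.map π t, isChain_support_map π t⟩

theorem continuous_chainMeasure {k : ℕ} (π : Fin (k + 1) →o Q) :
    Continuous (chainMeasure π) :=
  (stdSimplex.continuous_map _).subtype_mk _

/-- The order complex is the quotient of the disjoint union of the simplices of all chains, because
a continuous surjection from a compact space to a Hausdorff space is a quotient map. -/
theorem isQuotientMap_chains :
    Topology.IsQuotientMap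
      (fun x : Σ i : (Σ k : Fin (Fintype.card Q + 1), (Fin (k.1 + 1) →o Q)),
          stdSimplex ℝ (Fin (i.1.1 + 1)) =>
        chainMeasure x.1.2 x.2) := by
  have h1 (k : ℕ) : Finite (Fin (k + 1) →o Q) :=
    Finite.of_injective (fun f => (f : Fin (k + 1) → Q)) DFunLike.coe_injective
  have h2 : Finite (Σ k : Fin (Fintype.card Q + 1), (Fin (k.1 + 1) →o Q)) := inferInstance
  have hcomp : CompactSpace (Σ i : (Σ k : Fin (Fintype.card Q + 1), (Fin (k.1 + 1) →o Q)),
      stdSimplex ℝ (Fin (i.1.1 + 1))) := inferInstance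
  have ht2 : T2Space (ChainMeasure Q) := inferInstance
  refine Topology.IsQuotientMap.of_surjective_continuous ?_ ?_
  · intro w
    obtain ⟨k, π, t, h⟩ := exists_chain_rep w
    exact ⟨⟨⟨k, π⟩, t⟩, Subtype.ext h⟩
  · exact continuous_sigma fun i => continuous_chainMeasure i.2

/-- The map is continuous on each of the finitely many simplices of which the order complex is a
quotient. -/
theorem continuous_ofChainMeasure (E : Q ⥤ D) : Continuous (ofChainMeasure E) := by
  rw [isQuotientMap_chains.continuous_iff]
  refine continuous_sigma fun i => ?_
  refine (continuous_chainPoint E i.2).congr fun t => ?_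
  exact (ofChainMeasure_eq E _ i.2 t rfl).symm

theorem ofChainMeasure_comp (A : Q' →o Q) (E : Q ⥤ D) (w : ChainMeasure Q') (w' : ChainMeasure Q)
    (h : stdSimplex.map A w.1 = w'.1) :
    ofChainMeasure (A.monotone.functor ⋙ E) w = ofChainMeasure E w' := by
  obtain ⟨k, π, t, hw⟩ := exists_chain_rep w
  rw [ofChainMeasure_eq _ _ _ _ hw, chainPoint_functor_comp]
  refine (ofChainMeasure_eq _ _ _ _ ?_).symm
  rw [← h, ← hw, stdSimplex.map_comp_apply]
  rfl

end Chains

/-! ### Prisms -/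

section Prism

variable {n m : ℕ}

/-- The coordinate at `(j, 0)` of the point `(t, s)` of the prism: the length of the part below `s`
of the `j`-th interval, when `[0, 1]` is cut into intervals of lengths `t 0, t 1, …`. -/
def prismCoord (t : stdSimplex ℝ (Fin (n + 1))) (s : unitInterval) (j : Fin (n + 1)) : ℝ :=
  min (∑ i with i ≤ j, t i) s - min (∑ i with i < j, t i) s

theorem sum_le_eq (t : stdSimplex ℝ (Fin (n + 1))) (j : Fin (n + 1)) :
    ∑ i with i ≤ j, t i = t j + ∑ i with i < j, t i := by
  have : (Finset.univ.filter fun i => i ≤ j) = insert j (Finset.univ.filter fun i => i < j) := by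
    ext i
    simp [le_iff_eq_or_lt]
  rw [this, Finset.sum_insert (by simp)]

theorem prismCoord_nonneg (t : stdSimplex ℝ (Fin (n + 1))) (s : unitInterval) (j : Fin (n + 1)) :
    0 ≤ prismCoord t s j := by
  have h := sum_le_eq t j
  have h0 := t.2.1 j
  have : ∑ i with i < j, t i ≤ ∑ i with i ≤ j, t i := by
    rw [h]
    exact le_add_of_nonneg_left h0
  exact sub_nonneg.mpr (min_le_min_right _ this)

theorem prismCoord_le (t : stdSimplex ℝ (Fin (n + 1))) (s : unitInterval) (j : Fin (n + 1)) :
    prismCoord t s j ≤ t j := by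
  have h := sum_le_eq t j
  have h0 : 0 ≤ t j := t.2.1 j
  unfold prismCoord
  rw [h]
  rcases le_total (∑ i with i < j, t i) (s : ℝ) with h1 | h1
  · rw [min_eq_left h1]
    linarith [min_le_left (t j + ∑ i with i < j, t i) (s : ℝ)]
  · rw [min_eq_right h1]
    linarith [min_le_right (t j + ∑ i with i < j, t i) (s : ℝ)]

/-- The coordinates of a point of the prism telescope over initial segments. -/
theorem sum_prismCoord (t : stdSimplex ℝ (Fin (n + 1))) (s : unitInterval)
    (A : Finset (Fin (n + 1))) (hA : ∀ i ∈ A, ∀ j ≤ i, j ∈ A) :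
    ∑ i ∈ A, prismCoord t s i = min (∑ i ∈ A, t i) s := by
  induction A using Finset.induction_on_max with
  | empty => simp [s.2.1]
  | insert a A hlt ih =>
    have haA : a ∉ A := fun h => lt_irrefl _ (hlt a h)
    have hAeq : A = Finset.univ.filter fun i => i < a := by
      ext i
      simp only [Finset.mem_filter, Finset.mem_univ, true_and]
      refine ⟨hlt i, fun h => ?_⟩
      rcases Finset.mem_insert.mp (hA a (by simp) i h.le) with h' | h'
      · exact absurd h' h.ne
      · exact h'
    rw [Finset.sum_insert haA, Finset.sum_insert haA, ih, hAeq, ← sum_le_eq]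
    · unfold prismCoord
      ring
    · intro i hi j hj
      rw [hAeq] at hi ⊢
      simp only [Finset.mem_filter, Finset.mem_univ, true_and] at hi ⊢
      exact hj.trans_lt hi

/-- The point `(t, s)` of the prism `Δ[n] × [0, 1]` as a point of the order complex of
`Fin (n + 1) × Fin 2`; the face over `s = 1` is `Fin (n + 1) × {0}`. -/
def prism (t : stdSimplex ℝ (Fin (n + 1))) (s : unitInterval) :
    ChainMeasure (Fin (n + 1) × Fin 2) :=
  ⟨⟨fun q => if q.2 = 0 then prismCoord t s q.1 else t q.1 - prismCoord t s q.1, by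
      intro q
      dsimp only
      split_ifs
      · exact prismCoord_nonneg _ _ _
      · exact sub_nonneg.mpr (prismCoord_le _ _ _), by
      rw [Fintype.sum_prod_type]
      simp [Fin.sum_univ_two]⟩, by
    have key : ∀ i j : Fin (n + 1), prismCoord t s i ≠ 0 → t j - prismCoord t s j ≠ 0 → i ≤ j := by
      intro i j hi hj
      by_contra hij
      have h1 : ∑ k with k < i, t k < s := by
        by_contra h
        push Not at h
        apply hi
        unfold prismCoord
        rw [min_eq_right h, min_eq_right, sub_self]
        rw [sum_le_eq]
        have := t.2.1 i
        change 0 ≤ t i at this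
        linarith
      have h2 : (s : ℝ) < ∑ k with k ≤ j, t k := by
        by_contra h
        push Not at h
        apply hj
        unfold prismCoord
        have h3 : ∑ k with k < j, t k ≤ s := by
          have := sum_le_eq t j
          have := t.2.1 j
          change 0 ≤ t j at this
          linarith
        rw [min_eq_left h, min_eq_left h3, sum_le_eq]
        ring
      have h3 : ∑ k with k ≤ j, t k ≤ ∑ k with k < i, t k := by
        apply Finset.sum_le_sum_of_subset_of_nonneg
        · intro k hk
          simp only [Finset.mem_filter, Finset.mem_univ, true_and] at hk ⊢
          exact hk.trans_lt (not_le.mp hij)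
        · exact fun k _ _ => t.2.1 k
      linarith
    rintro ⟨i, a⟩ hi ⟨j, b⟩ hj -
    change (if a = 0 then prismCoord t s i else t i - prismCoord t s i) ≠ 0 at hi
    change (if b = 0 then prismCoord t s j else t j - prismCoord t s j) ≠ 0 at hj
    have h2 : ∀ c : Fin 2, c = 0 ∨ c = 1 := by decide
    rcases h2 a with rfl | rfl <;> rcases h2 b with rfl | rfl
    · rcases le_total i j with h | h
      · exact Or.inl ⟨h, le_rfl⟩
      · exact Or.inr ⟨h, le_rfl⟩
    · exact Or.inl ⟨key i j (by simpa using hi) (by simpa using hj), by simp⟩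
    · exact Or.inr ⟨key j i (by simpa using hj) (by simpa using hi), by simp⟩
    · rcases le_total i j with h | h
      · exact Or.inl ⟨h, le_rfl⟩
      · exact Or.inr ⟨h, le_rfl⟩⟩

theorem prism_apply (t : stdSimplex ℝ (Fin (n + 1))) (s : unitInterval) (q : Fin (n + 1) × Fin 2) :
    (prism t s).1 q = if q.2 = 0 then prismCoord t s q.1 else t q.1 - prismCoord t s q.1 := rfl

theorem continuous_prism :
    Continuous fun p : stdSimplex ℝ (Fin (n + 1)) × unitInterval => prism p.1 p.2 := by
  refine Continuous.subtype_mk (Continuous.subtype_mk (continuous_pi fun q => ?_) _) _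
  have hc : ∀ i, Continuous fun p : stdSimplex ℝ (Fin (n + 1)) × unitInterval => p.1 i :=
    fun i => (continuous_apply i).comp (continuous_subtype_val.comp continuous_fst)
  have h : Continuous fun p : stdSimplex ℝ (Fin (n + 1)) × unitInterval =>
      prismCoord p.1 p.2 q.1 := by
    unfold prismCoord
    have h2 : Continuous fun p : stdSimplex ℝ (Fin (n + 1)) × unitInterval => (p.2 : ℝ) :=
      continuous_subtype_val.comp continuous_snd
    exact ((continuous_finsetSum _ fun i _ => hc i).min h2).sub
      ((continuous_finsetSum _ fun i _ => hc i).min h2)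
  by_cases hq : q.2 = 0
  · simpa [hq] using h
  · simp only [hq, if_false]
    exact (hc q.1).sub h

/-- Points of prisms are natural in the simplex: a monotone map merges consecutive intervals, and
the part below `s` of a union of consecutive intervals is the union of the parts below `s`. -/
theorem map_prism (θ : Fin (n + 1) →o Fin (m + 1)) (t : stdSimplex ℝ (Fin (n + 1)))
    (s : unitInterval) :
    stdSimplex.map (Prod.map θ id : Fin (n + 1) × Fin 2 → Fin (m + 1) × Fin 2) (prism t s).1 =
      (prism (stdSimplex.map θ t) s).1 := by
  have hpush : ∀ j, stdSimplex.map θ t j = ∑ i with θ i = j, t i := fun j => by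
    rw [stdSimplex.map_coe, FunOnFinite.linearMap_apply_apply]
  have hle : ∀ j, ∑ k with k ≤ j, stdSimplex.map θ t k = ∑ i with θ i ≤ j, t i := by
    intro j
    simp only [hpush]
    rw [← Finset.sum_fiberwise_of_maps_to (s := Finset.univ.filter fun i => θ i ≤ j)
      (t := Finset.univ.filter fun k => k ≤ j) (g := θ) (by simp)]
    refine Finset.sum_congr rfl fun k hk => Finset.sum_congr ?_ fun _ _ => rfl
    ext i
    simp only [Finset.mem_filter, Finset.mem_univ, true_and] at hk ⊢
    constructor
    · rintro rfl; exact ⟨hk, rfl⟩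
    · exact fun h => h.2
  have hlt : ∀ j, ∑ k with k < j, stdSimplex.map θ t k = ∑ i with θ i < j, t i := by
    intro j
    simp only [hpush]
    rw [← Finset.sum_fiberwise_of_maps_to (s := Finset.univ.filter fun i => θ i < j)
      (t := Finset.univ.filter fun k => k < j) (g := θ) (by simp)]
    refine Finset.sum_congr rfl fun k hk => Finset.sum_congr ?_ fun _ _ => rfl
    ext i
    simp only [Finset.mem_filter, Finset.mem_univ, true_and] at hk ⊢
    constructor
    · rintro rfl; exact ⟨hk, rfl⟩
    · exact fun h => h.2
  have hcoord : ∀ j, ∑ i with θ i = j, prismCoord t s i = prismCoord (stdSimplex.map θ t) s j := by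
    intro j
    have h1 := sum_prismCoord t s (Finset.univ.filter fun i => θ i ≤ j) (by
      intro i hi k hk
      simp only [Finset.mem_filter, Finset.mem_univ, true_and] at hi ⊢
      exact (θ.monotone hk).trans hi)
    have h2 := sum_prismCoord t s (Finset.univ.filter fun i => θ i < j) (by
      intro i hi k hk
      simp only [Finset.mem_filter, Finset.mem_univ, true_and] at hi ⊢
      exact (θ.monotone hk).trans_lt hi)
    have h3 : ∑ i with θ i ≤ j, prismCoord t s i =
        ∑ i with θ i = j, prismCoord t s i + ∑ i with θ i < j, prismCoord t s i := by
      rw [← Finset.sum_union]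
      · refine Finset.sum_congr ?_ fun _ _ => rfl
        ext i
        simp [le_iff_eq_or_lt]
      · rw [Finset.disjoint_filter]
        intro i _ h h'
        exact absurd h' (by rw [h]; exact lt_irrefl _)
    change _ = min (∑ k with k ≤ j, stdSimplex.map θ t k) (s : ℝ) -
      min (∑ k with k < j, stdSimplex.map θ t k) (s : ℝ)
    rw [hle, hlt, ← h1, ← h2, h3, add_sub_cancel_right]
  ext ⟨j, b⟩
  have h1 : (Finset.univ.filter fun q : Fin (n + 1) × Fin 2 =>
      (Prod.map θ id q : Fin (m + 1) × Fin 2) = (j, b)) =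
      (Finset.univ.filter fun i => θ i = j) ×ˢ {b} := by
    ext ⟨i, c⟩
    simp [eq_comm]
  rw [stdSimplex.map_coe, FunOnFinite.linearMap_apply_apply, h1, Finset.sum_product, prism_apply]
  simp only [Finset.sum_singleton, prism_apply]
  split_ifs with hb
  · exact hcoord j
  · rw [Finset.sum_sub_distrib, hcoord, ← hpush]

theorem prism_zero (t : stdSimplex ℝ (Fin (n + 1))) :
    stdSimplex.map (fun j => (j, (1 : Fin 2))) t = (prism t 0).1 := by
  have h0 : ∀ j, prismCoord t 0 j = 0 := fun j => by
    unfold prismCoord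
    have h : ∀ A : Finset (Fin (n + 1)), 0 ≤ ∑ i ∈ A, t i :=
      fun A => Finset.sum_nonneg fun i _ => t.2.1 i
    simp [h]
  ext ⟨j, b⟩
  rw [stdSimplex.map_coe, FunOnFinite.linearMap_apply_apply, prism_apply]
  simp only [h0, Prod.mk.injEq, sub_zero]
  have h2 : ∀ c : Fin 2, c = 0 ∨ c = 1 := by decide
  rcases h2 b with rfl | rfl <;> simp [Finset.filter_eq']

theorem prism_one (t : stdSimplex ℝ (Fin (n + 1))) :
    stdSimplex.map (fun j => (j, (0 : Fin 2))) t = (prism t 1).1 := by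
  have h0 : ∀ j, prismCoord t 1 j = t j := fun j => by
    have h : ∀ A : Finset (Fin (n + 1)), ∑ i ∈ A, t i ≤ 1 := fun A => by
      rw [← stdSimplex.sum_eq_one t]
      exact Finset.sum_le_sum_of_subset_of_nonneg (Finset.subset_univ _) fun i _ _ => t.2.1 i
    unfold prismCoord
    change min _ (1 : ℝ) - min _ (1 : ℝ) = _
    rw [min_eq_left (h _), min_eq_left (h _), sum_le_eq]
    ring
  ext ⟨j, b⟩
  rw [stdSimplex.map_coe, FunOnFinite.linearMap_apply_apply, prism_apply]
  simp only [h0, Prod.mk.injEq, sub_self]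
  have h2 : ∀ c : Fin 2, c = 0 ∨ c = 1 := by decide
  rcases h2 b with rfl | rfl <;> simp [Finset.filter_eq']

end Prism

/-! ### Natural transformations induce homotopies -/

section Homotopy

open Simplicial

variable {C D : Type u} [Category.{v} C] [Category.{v} D] {F G : C ⥤ D}

/-- The functor `Fin (n + 1) × Fin 2 ⥤ D` given by a natural transformation `F ⟶ G` and a chain of
morphisms of `C`: it is `F` on the chain over `0` and `G` on the chain over `1`. -/
def prismFunctor (α : F ⟶ G) {n : ℕ} (c : ComposableArrows C n) :
    @Functor (Fin (n + 1) × Fin 2) (Preorder.smallCategory _) D _ :=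
  letI : Category (Fin (n + 1) × Fin 2) := Preorder.smallCategory _
  { obj q := ((ComposableArrows.mk₁ α).obj q.2).obj (c.obj q.1)
    map f := ((ComposableArrows.mk₁ α).map (homOfLE (leOfHom f).2)).app _ ≫
      ((ComposableArrows.mk₁ α).obj _).map (c.map (homOfLE (leOfHom f).1))
    map_id q := by
      have h1 (h : q.1 ≤ q.1) : homOfLE h = 𝟙 q.1 := rfl
      have h2 (h : q.2 ≤ q.2) : homOfLE h = 𝟙 q.2 := rfl
      rw [h1, h2, CategoryTheory.Functor.map_id, CategoryTheory.Functor.map_id,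
        CategoryTheory.Functor.map_id]
      exact Category.id_comp _
    map_comp {q q' q''} f g := by
      rw [← homOfLE_comp (leOfHom f).1 (leOfHom g).1, ← homOfLE_comp (leOfHom f).2 (leOfHom g).2,
        Functor.map_comp, Functor.map_comp, Functor.map_comp, NatTrans.comp_app]
      simp only [Category.assoc, NatTrans.naturality_assoc] }

theorem ofChainMeasure_prism_zero (α : F ⟶ G) {n : ℕ} (c : ComposableArrows C n)
    (t : stdSimplex ℝ (Fin (n + 1))) :
    ofChainMeasure (prismFunctor α c) (prism t 0) =
      classifyingMap G (simplexPoint (X := nerve C) (n := n) c t) := by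
  let π : Fin (n + 1) →o Fin (n + 1) × Fin 2 := ⟨fun j => (j, 1), fun i j h => ⟨h, le_rfl⟩⟩
  rw [ofChainMeasure_eq _ _ π t (prism_zero t)]
  refine Eq.trans ?_ (toTop_map_simplexPoint (nerveMap G) (n := n) c t).symm
  have : @Functor.comp _ _ _ (Preorder.smallCategory _) _ _ π.monotone.functor
      (prismFunctor α c) = c ⋙ G := by
    refine CategoryTheory.Functor.ext (fun _ => rfl) fun i j f => ?_
    change ((ComposableArrows.mk₁ α).map (𝟙 1)).app _ ≫ G.map (c.map f) =
      𝟙 _ ≫ G.map (c.map f) ≫ 𝟙 _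
    rw [CategoryTheory.Functor.map_id, Category.comp_id]
    rfl
  exact congrArg (fun c' => simplexPoint (X := nerve D) (n := n) c' t) this

theorem ofChainMeasure_prism_one (α : F ⟶ G) {n : ℕ} (c : ComposableArrows C n)
    (t : stdSimplex ℝ (Fin (n + 1))) :
    ofChainMeasure (prismFunctor α c) (prism t 1) =
      classifyingMap F (simplexPoint (X := nerve C) (n := n) c t) := by
  let π : Fin (n + 1) →o Fin (n + 1) × Fin 2 := ⟨fun j => (j, 0), fun i j h => ⟨h, le_rfl⟩⟩
  rw [ofChainMeasure_eq _ _ π t (prism_one t)]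
  refine Eq.trans ?_ (toTop_map_simplexPoint (nerveMap F) (n := n) c t).symm
  have : @Functor.comp _ _ _ (Preorder.smallCategory _) _ _ π.monotone.functor
      (prismFunctor α c) = c ⋙ F := by
    refine CategoryTheory.Functor.ext (fun _ => rfl) fun i j f => ?_
    change ((ComposableArrows.mk₁ α).map (𝟙 0)).app _ ≫ F.map (c.map f) =
      𝟙 _ ≫ F.map (c.map f) ≫ 𝟙 _
    rw [CategoryTheory.Functor.map_id, Category.comp_id]
    rfl
  exact congrArg (fun c' => simplexPoint (X := nerve D) (n := n) c' t) this

/-- The realization of the nerve turns natural transformations into homotopies. -/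
theorem classifyingMap_homotopic (α : F ⟶ G) :
    (classifyingMap F).Homotopic (classifyingMap G) := by
  have H := exists_toTop_desc (X := nerve C) (Z := C(unitInterval, classifyingSpace D))
    (fun n c => ContinuousMap.curry
      ⟨fun p : stdSimplex ℝ (Fin (n + 1)) × unitInterval =>
        ofChainMeasure (prismFunctor α (n := n) c) (prism p.1 p.2),
        (continuous_ofChainMeasure _).comp continuous_prism⟩) (by
    intro n m θ c t
    ext s
    let A : Fin (n + 1) × Fin 2 →o Fin (m + 1) × Fin 2 :=
      ⟨Prod.map (SimplexCategory.Hom.toOrderHom θ) id,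
        fun a b h => ⟨(SimplexCategory.Hom.toOrderHom θ).monotone h.1, h.2⟩⟩
    exact ofChainMeasure_comp A (prismFunctor α (n := m) c) (prism t s)
      (prism (stdSimplex.map (SimplexCategory.Hom.toOrderHom θ) t) s)
      (map_prism (SimplexCategory.Hom.toOrderHom θ) t s))
  obtain ⟨f, hf⟩ := H
  have h0 : (⟨fun g => g 0, continuous_eval_const _⟩ :
      C(C(unitInterval, classifyingSpace D), classifyingSpace D)).comp f = classifyingMap G := by
    refine toTop_hom_ext (X := nerve C) fun n s t => ?_
    refine Eq.trans ?_ (ofChainMeasure_prism_zero α (n := n) s t)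
    exact congrArg (fun g : C(unitInterval, classifyingSpace D) => g 0) (hf n s t)
  have h1 : (⟨fun g => g 1, continuous_eval_const _⟩ :
      C(C(unitInterval, classifyingSpace D), classifyingSpace D)).comp f = classifyingMap F := by
    refine toTop_hom_ext (X := nerve C) fun n s t => ?_
    refine Eq.trans ?_ (ofChainMeasure_prism_one α (n := n) s t)
    exact congrArg (fun g : C(unitInterval, classifyingSpace D) => g 1) (hf n s t)
  let g : C(classifyingSpace C, C(unitInterval, classifyingSpace D)) := f
  refine ContinuousMap.Homotopic.symm ⟨⟨⟨fun p => g p.2 p.1, by fun_prop⟩, ?_, ?_⟩⟩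
  · exact fun x => DFunLike.congr_fun h0 x
  · exact fun x => DFunLike.congr_fun h1 x

end Homotopy

/-! ### Cup products on a discrete torus modulo 2 -/

section Torus

variable {T ι : Type*} [AddCommGroup T] (e : ι → T)

/-- The coboundary of a function on the vertices of the graph with vertex set `T` and an edge from
`x` to `x + e k` for all `x` and `k`. -/
def cobound (h : T → ZMod 2) : T → ι → ZMod 2 := fun x k => h (x + e k) + h x

/-- The condition on a function on edges to be a cocycle: its sums along the two paths from `x` to
`x + e k + e l` agree. -/
def IsClosedCochain (a : T → ι → ZMod 2) : Prop :=
  ∀ x k l, a x k + a (x + e k) l = a x l + a (x + e l) k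

theorem isClosedCochain_cobound (h : T → ZMod 2) : IsClosedCochain e (cobound e h) := by
  intro x k l
  simp only [cobound]
  rw [add_right_comm x (e k) (e l)]
  have h2 : ∀ a : ZMod 2, a + a = 0 := by decide
  linear_combination h2 (h (x + e k)) - h2 (h (x + e l))

theorem IsClosedCochain.add {a b : T → ι → ZMod 2} (ha : IsClosedCochain e a)
    (hb : IsClosedCochain e b) : IsClosedCochain e (a + b) := by
  intro x k l
  have h1 := ha x k l
  have h2 := hb x k l
  simp only [Pi.add_apply]
  linear_combination h1 + h2

variable [Fintype ι] [DecidableEq ι]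

/-- One step in a direction `k` not used before, weighted by the cochain `a`, as an operator on
functions of the position `x` and of the set `S` of directions already used. -/
def step (a : T → ι → ZMod 2) : Module.End (ZMod 2) (T → Finset ι → ZMod 2) where
  toFun φ x S := ∑ k ∈ Sᶜ, a x k * φ (x + e k) (insert k S)
  map_add' φ ψ := by
    ext x S
    simp [mul_add, Finset.sum_add_distrib]
  map_smul' c φ := by
    ext x S
    simp [Finset.mul_sum, mul_left_comm]

/-- Multiplication by a function of the position. -/
def mulBy (ι : Type*) (h : T → ZMod 2) : Module.End (ZMod 2) (T → Finset ι → ZMod 2) where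
  toFun φ x S := h x * φ x S
  map_add' φ ψ := by
    ext x S
    simp [mul_add]
  map_smul' c φ := by
    ext x S
    simp [mul_left_comm]

/-- Marking the direction `k` as used. -/
def mark (T : Type*) (k : ι) : Module.End (ZMod 2) (T → Finset ι → ZMod 2) where
  toFun φ x S := if k ∈ S then 0 else φ x (insert k S)
  map_add' φ ψ := by
    ext x S
    by_cases h : k ∈ S <;> simp [h]
  map_smul' c φ := by
    ext x S
    by_cases h : k ∈ S <;> simp [h]

theorem step_apply (a : T → ι → ZMod 2) (φ : T → Finset ι → ZMod 2) (x : T) (S : Finset ι) :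
    step e a φ x S = ∑ k ∈ Sᶜ, a x k * φ (x + e k) (insert k S) := rfl

theorem step_add (a b : T → ι → ZMod 2) : step e (a + b) = step e a + step e b := by
  ext φ x S
  simp [step_apply, add_mul, Finset.sum_add_distrib]

/-- The Leibniz rule: the coboundary of `h` is the commutator of `h` with the free step, up to
signs, which do not matter modulo `2`. -/
theorem step_cobound (h : T → ZMod 2) :
    step e (cobound e h) = step e 1 * mulBy ι h + mulBy ι h * step e 1 := by
  refine LinearMap.ext fun φ => funext fun x => funext fun S => ?_
  simp only [step_apply, LinearMap.add_apply, Module.End.mul_apply, Pi.add_apply, cobound, mulBy,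
    LinearMap.coe_mk, AddHom.coe_mk, Pi.one_apply, one_mul, add_mul, Finset.sum_add_distrib,
    Finset.mul_sum]

/-- A closed cochain commutes with the cochain `1`: the two orders of a pair of steps cancel
modulo `2`. -/
theorem step_one_mul_step {a : T → ι → ZMod 2} (ha : IsClosedCochain e a) :
    step e 1 * step e a = step e a * step e 1 := by
  refine LinearMap.ext fun φ => funext fun x => funext fun S => ?_
  have h2 : ∀ a : ZMod 2, a + a = 0 := by decide
  have hsub : ∀ a b : ZMod 2, a + b = 0 → a = b := by decide
  apply hsub
  simp only [Module.End.mul_apply, step_apply, Pi.one_apply, one_mul, Finset.mul_sum]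
  rw [← Finset.sum_add_distrib]
  simp_rw [← Finset.sum_add_distrib]
  rw [Finset.sum_sigma']
  refine Finset.sum_involution (fun p _ => ⟨p.2, p.1⟩) ?_ ?_ ?_ ?_
  · rintro ⟨k, l⟩ hp
    simp only
    rw [Finset.insert_comm l k, add_right_comm x (e l) (e k)]
    have := ha x k l
    have h3 := h2 (a (x + e l) k * φ (x + e k + e l) (insert l (insert k S)))
    have h4 := h2 (a x l * φ (x + e k + e l) (insert l (insert k S)))
    rw [Finset.insert_comm l k] at h3 h4
    linear_combination (φ (x + e k + e l) (insert k (insert l S))) * this + h3 + h4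
  · rintro ⟨k, l⟩ hp - heq
    simp only [Finset.mem_sigma, Finset.mem_compl, Finset.mem_insert, not_or] at hp
    exact hp.2.1 (congrArg Sigma.fst heq)
  · rintro ⟨k, l⟩ hp
    simp only [Finset.mem_sigma, Finset.mem_compl, Finset.mem_insert, not_or] at hp ⊢
    exact ⟨hp.2.2, fun h => hp.2.1 h.symm, hp.1⟩
  · rintro ⟨k, l⟩ hp
    rfl

/-- Marking a direction in advance is the same as forbidding it and marking it later. -/
theorem commute_mark_step (a : T → ι → ZMod 2) (k : ι) : Commute (mark T k) (step e a) := by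
  refine LinearMap.ext fun φ => funext fun x => funext fun S => ?_
  simp only [Module.End.mul_apply, step_apply, mark, LinearMap.coe_mk, AddHom.coe_mk]
  by_cases hk : k ∈ S
  · simp [hk]
  · rw [if_neg hk]
    have : Sᶜ = insert k (insert k S)ᶜ := by
      ext l
      by_cases hl : l = k <;> simp [hl, hk]
    rw [this, Finset.sum_insert (by simp)]
    simp only [Finset.mem_insert_self, if_true, mul_zero, zero_add]
    refine Finset.sum_congr rfl fun l hl => ?_
    simp only [Finset.mem_compl, Finset.mem_insert, not_or] at hl
    rw [if_neg (by simp [hk, Ne.symm hl.1]), Finset.insert_comm]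

set_option linter.unusedSectionVars false in
theorem commute_mark_mulBy (h : T → ZMod 2) (k : ι) : Commute (mark T k) (mulBy ι h) := by
  refine LinearMap.ext fun φ => funext fun x => funext fun S => ?_
  simp only [Module.End.mul_apply, mulBy, mark, LinearMap.coe_mk, AddHom.coe_mk]
  by_cases hk : k ∈ S <;> simp [hk]

/-- A nonzero path sum is witnessed by a cube on which no factor vanishes. -/
theorem exists_ne_zero_of_prod_step (as : List (T → ι → ZMod 2)) (φ : T → Finset ι → ZMod 2)
    (x : T) (S : Finset ι) (h : (as.map (step e)).prod φ x S ≠ 0) :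
    ∀ a ∈ as, ∃ (U : Finset ι) (k : ι), S ⊆ U ∧ k ∉ U ∧ a (x + ∑ i ∈ U \ S, e i) k ≠ 0 := by
  induction as generalizing x S with
  | nil => simp
  | cons b as ih =>
    simp only [List.map_cons, List.prod_cons, Module.End.mul_apply, step_apply] at h
    obtain ⟨k, hk, hk0⟩ := Finset.exists_ne_zero_of_sum_ne_zero h
    rw [Finset.mem_compl] at hk
    intro a ha
    rcases List.mem_cons.mp ha with rfl | ha
    · exact ⟨S, k, subset_rfl, hk, by simpa using left_ne_zero_of_mul hk0⟩
    · obtain ⟨U, l, hU, hl, hne⟩ := ih _ _ (right_ne_zero_of_mul hk0) a ha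
      have hkU : k ∈ U := hU (Finset.mem_insert_self _ _)
      refine ⟨U, l, (Finset.subset_insert _ _).trans hU, hl, ?_⟩
      have h1 : U \ S = insert k (U \ insert k S) := by
        ext i
        by_cases hi : i = k <;> simp [hi, hkU, hk]
      rw [h1, Finset.sum_insert (by simp), ← add_assoc]
      exact hne

variable [Fintype T]

/-- The sum over all positions of the weights of the paths which use every direction once. -/
def pathSum (W : Module.End (ZMod 2) (T → Finset ι → ZMod 2)) : ZMod 2 :=
  ∑ x, W (fun _ S => if S = Finset.univ then 1 else 0) x ∅

set_option linter.unusedSectionVars false in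
theorem pathSum_add (V W : Module.End (ZMod 2) (T → Finset ι → ZMod 2)) :
    pathSum (V + W) = pathSum V + pathSum W := by
  simp [pathSum, Finset.sum_add_distrib]

/-- A free step can be moved from the beginning of a path to its end. -/
theorem pathSum_step_one_mul (W : Module.End (ZMod 2) (T → Finset ι → ZMod 2))
    (hW : ∀ k, Commute (mark T k) W) : pathSum (step e 1 * W) = pathSum (W * step e 1) := by
  set u : T → Finset ι → ZMod 2 := fun _ S => if S = Finset.univ then 1 else 0 with hu
  have h1 : ∑ k, mark T k u = step e 1 u := by
    ext x S
    rw [step_apply, Finset.sum_apply, Finset.sum_apply]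
    rw [← Finset.sum_subset (Finset.subset_univ Sᶜ)]
    · refine Finset.sum_congr rfl fun k hk => ?_
      simp only [mark, LinearMap.coe_mk, AddHom.coe_mk, Pi.one_apply, one_mul, hu]
      rw [if_neg (by simpa using hk)]
    · intro k _ hk
      simp only [mark, LinearMap.coe_mk, AddHom.coe_mk]
      rw [if_pos (by simpa using hk)]
  have h2 : pathSum (W * step e 1) = ∑ k, ∑ x, W (mark T k u) x ∅ := by
    unfold pathSum
    rw [Finset.sum_comm]
    simp only [Module.End.mul_apply]
    rw [← hu, ← h1, map_sum]
    simp
  rw [h2]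
  unfold pathSum
  simp only [Module.End.mul_apply, step_apply, Finset.compl_empty, Pi.one_apply, one_mul]
  rw [Finset.sum_comm]
  refine Finset.sum_congr rfl fun k _ => ?_
  rw [← hu]
  refine (Equiv.sum_comp (Equiv.addRight (e k)) (fun x => W u x (insert k ∅))).trans ?_
  refine Finset.sum_congr rfl fun x _ => ?_
  have h3 : mark T k (W u) = W (mark T k u) := LinearMap.congr_fun (hW k).eq u
  rw [← h3]
  simp [mark]

/-- A product of closed cochains with an exact factor has path sum zero. -/
theorem pathSum_cobound (X Y : Module.End (ZMod 2) (T → Finset ι → ZMod 2)) (h : T → ZMod 2)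
    (hX : Commute (step e 1) X) (hY : Commute (step e 1) Y)
    (hX' : ∀ k, Commute (mark T k) X) (hY' : ∀ k, Commute (mark T k) Y) :
    pathSum (X * step e (cobound e h) * Y) = 0 := by
  have h1 : X * step e (cobound e h) * Y =
      step e 1 * (X * mulBy ι h * Y) + (X * mulBy ι h * Y) * step e 1 := by
    rw [step_cobound, mul_add, add_mul]
    congr 1
    · rw [← mul_assoc X, ← hX.eq]
      simp only [mul_assoc]
    · simp only [mul_assoc]
      rw [hY.eq]
  rw [h1, pathSum_add, pathSum_step_one_mul e _ fun k =>
    ((hX' k).mul_right (commute_mark_mulBy h k)).mul_right (hY' k)]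
  have h2 : ∀ a : ZMod 2, a + a = 0 := by decide
  exact h2 _

/-- The path sum of a product of closed cochains depends only on their cohomology classes. -/
theorem pathSum_congr {as bs : List (T → ι → ZMod 2)}
    (hab : List.Forall₂ (fun a b => IsClosedCochain e b ∧ ∃ h, a = b + cobound e h) as bs) :
    pathSum (as.map (step e)).prod = pathSum (bs.map (step e)).prod := by
  suffices H : ∀ X : Module.End (ZMod 2) (T → Finset ι → ZMod 2), Commute (step e 1) X →
      (∀ k, Commute (mark T k) X) →
      pathSum (X * (as.map (step e)).prod) = pathSum (X * (bs.map (step e)).prod) by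
    simpa using H 1 (Commute.one_right _) (fun _ => Commute.one_right _)
  induction hab with
  | nil => intros; rfl
  | @cons a b as bs hab htl ih =>
    intro X hX hX'
    obtain ⟨hb, h, rfl⟩ := hab
    have htl1 : Commute (step e 1) (as.map (step e)).prod := by
      apply Commute.list_prod_right
      intro y hy
      obtain ⟨c, hc, rfl⟩ := List.mem_map.mp hy
      obtain ⟨d, -, hd, h', rfl⟩ : ∃ d, d ∈ bs ∧ IsClosedCochain e d ∧
          ∃ h, c = d + cobound e h := by
        clear ih hy
        induction htl with
        | nil => simp at hc
        | cons hcd _ ih =>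
          rcases List.mem_cons.mp hc with rfl | hc
          · exact ⟨_, by simp, hcd⟩
          · obtain ⟨d, hd, h⟩ := ih hc
            exact ⟨d, by simp [hd], h⟩
      exact step_one_mul_step e (hd.add e (isClosedCochain_cobound e h'))
    have htl2 : ∀ k, Commute (mark T k) (as.map (step e)).prod := by
      intro k
      apply Commute.list_prod_right
      intro y hy
      obtain ⟨c, hc, rfl⟩ := List.mem_map.mp hy
      exact commute_mark_step e c k
    simp only [List.map_cons, List.prod_cons]
    rw [step_add, add_mul, mul_add, pathSum_add, ← mul_assoc X (step e (cobound e h)),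
      pathSum_cobound e X _ h hX htl1 hX' htl2, add_zero, ← mul_assoc, ← mul_assoc]
    exact ih _ (hX.mul_right (step_one_mul_step e hb))
      fun k => (hX' k).mul_right (commute_mark_step e b k)

end Torus

/-! ### A discrete theorem of Poincaré and Miranda -/

section Grid

variable {m c : ℕ}

/-- The cocycle of the hyperplanes `x i = c` in the discrete torus. -/
def hyperplane (m c : ℕ) (i : Fin m) : (Fin m → ZMod (2 * c + 1)) → Fin m → ZMod 2 :=
  fun x k => if k = i ∧ x i = c then 1 else 0

theorem isClosedCochain_hyperplane (i : Fin m) :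
    IsClosedCochain (fun k => Pi.single k 1) (hyperplane m c i) := by
  intro x k l
  simp only [hyperplane, Pi.add_apply, Pi.single_apply]
  by_cases hk : k = i <;> by_cases hl : l = i
  · simp [hk, hl]
  · simp [hk, hl, Ne.symm hl]
  · simp [hk, hl, Ne.symm hk]
  · simp [hk, hl]

/-- A path in which the steps cross the hyperplanes of the list `l` in this order has to use the
directions of `l` in this order, and starts at a point on all these hyperplanes. -/
theorem prod_step_hyperplane (l : List (Fin m)) (S : Finset (Fin m)) (hl : l.Nodup)
    (hS : ∀ i, i ∈ S ↔ i ∉ l) (x : Fin m → ZMod (2 * c + 1)) :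
    ((l.map (hyperplane m c)).map (step fun k => Pi.single k 1)).prod
      (fun _ S => if S = Finset.univ then 1 else 0) x S = if ∀ i ∈ l, x i = c then 1 else 0 := by
  induction l generalizing S x with
  | nil =>
    have : S = Finset.univ := by
      ext i
      simp [hS]
    simp [this]
  | cons j l ih =>
    obtain ⟨hj, hl⟩ := List.nodup_cons.mp hl
    simp only [List.map_cons, List.prod_cons, Module.End.mul_apply, step_apply]
    rw [Finset.sum_eq_single j]
    · rw [ih _ hl]
      · have h1 : ∀ i ∈ l, (x + (Pi.single j 1 : Fin m → ZMod (2 * c + 1))) i = x i := by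
          intro i hi
          have : i ≠ j := fun h => hj (h ▸ hi)
          simp [this]
        have h2 : (∀ i ∈ l, (x + (Pi.single j 1 : Fin m → ZMod (2 * c + 1))) i = c) ↔
            ∀ i ∈ l, x i = c :=
          forall₂_congr fun i hi => by rw [h1 i hi]
        simp only [h2, hyperplane, List.mem_cons, forall_eq_or_imp, true_and]
        by_cases hxj : x j = c <;> simp [hxj]
      · intro i
        by_cases hi : i = j
        · simp [hi, hj]
        · simp [hi, hS]
    · intro k _ hk
      simp [hyperplane, hk]
    · intro hjS
      exact absurd (by simpa using hjS) ((hS j).not.mpr (by simp))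

/-- The coordinate hyperplanes of the torus meet transversally in one point. -/
theorem pathSum_hyperplane :
    pathSum (((List.finRange m).map (hyperplane m c)).map (step fun k => Pi.single k 1)).prod =
      1 := by
  unfold pathSum
  rw [Finset.sum_eq_single fun _ => (c : ZMod (2 * c + 1))]
  · rw [prod_step_hyperplane _ _ (List.nodup_finRange m) (by simp)]
    simp
  · intro x _ hx
    rw [prod_step_hyperplane _ _ (List.nodup_finRange m) (by simp), if_neg]
    exact fun h => hx (funext fun i => h i (List.mem_finRange i))
  · simp

/-- Discrete form of the theorem of Poincaré and Miranda: labels in `{0, 1}` on a cubical grid,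
equal to the standard labels on the boundary, are simultaneously nonconstant on some cube. -/
theorem exists_cube (f : Fin m → (Fin m → ZMod (2 * c + 1)) → Prop) (hc : 0 < c)
    (hf : ∀ i x, (∃ j, (x j).val = 0 ∨ (x j).val = 2 * c) → (f i x ↔ c < (x i).val)) :
    ∃ x : Fin m → ZMod (2 * c + 1), (∀ j, (x j).val < 2 * c) ∧
      ∀ i, (∃ U : Finset (Fin m), f i (x + ∑ k ∈ U, Pi.single k 1)) ∧
        ∃ U : Finset (Fin m), ¬ f i (x + ∑ k ∈ U, Pi.single k 1) := by
  classical
  let e : Fin m → Fin m → ZMod (2 * c + 1) := fun k => Pi.single k 1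
  let lab : Prop → ZMod 2 := fun p => if p then 1 else 0
  let h : Fin m → (Fin m → ZMod (2 * c + 1)) → ZMod 2 :=
    fun i x => lab (f i x) + lab (c < (x i).val)
  let a : Fin m → (Fin m → ZMod (2 * c + 1)) → Fin m → ZMod 2 :=
    fun i => hyperplane m c i + cobound e (h i)
  have hsum : pathSum (((List.finRange m).map a).map (step e)).prod ≠ 0 := by
    rw [pathSum_congr e (bs := (List.finRange m).map (hyperplane m c))]
    · rw [pathSum_hyperplane]
      exact one_ne_zero
    · rw [List.forall₂_map_left_iff, List.forall₂_map_right_iff, List.forall₂_same]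
      exact fun i _ => ⟨isClosedCochain_hyperplane i, h i, rfl⟩
  obtain ⟨x, -, hx⟩ := Finset.exists_ne_zero_of_sum_ne_zero hsum
  have hx' := exists_ne_zero_of_prod_step e _ _ x ∅ hx
  have hbd : ∀ i x, (∃ j, (x j).val = 0 ∨ (x j).val = 2 * c) → h i x = 0 := by
    intro i x hj
    have h2 : ∀ a : ZMod 2, a + a = 0 := by decide
    change lab (f i x) + lab (c < (x i).val) = 0
    rw [propext (hf i x hj)]
    exact h2 _
  have hval : ((c : ZMod (2 * c + 1))).val = c := ZMod.val_natCast_of_lt (by omega)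
  have hone : (1 : ZMod (2 * c + 1)).val = 1 := by
    have : Fact (1 < 2 * c + 1) := ⟨by omega⟩
    exact ZMod.val_one _
  have hwalk : ∀ (U : Finset (Fin m)) (x : Fin m → ZMod (2 * c + 1)) (j),
      (x + ∑ k ∈ U, e k) j = x j + if j ∈ U then 1 else 0 := by
    intro U x j
    simp only [Pi.add_apply, Finset.sum_apply, e, Pi.single_apply]
    simp
  have hlast : ∀ z : ZMod (2 * c + 1), z.val = 2 * c → (z + 1).val = 0 := by
    intro z hz
    rw [ZMod.val_add, hz, hone]
    simp
  have hnext : ∀ z : ZMod (2 * c + 1), z.val < 2 * c → (z + 1).val = z.val + 1 := by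
    intro z hz
    rw [ZMod.val_add, hone, Nat.mod_eq_of_lt (by omega)]
  have hle : ∀ z : ZMod (2 * c + 1), z.val ≤ 2 * c := fun z => by
    have := z.val_lt
    omega
  -- A cube with a vertex on the last hyperplane lies in the region where the labels are standard.
  have hin : ∀ j, (x j).val < 2 * c := by
    intro j
    by_contra hj
    have hj' : (x j).val = 2 * c := le_antisymm (hle _) (not_lt.mp hj)
    obtain ⟨U, k, -, hk, hne⟩ := hx' (a j) (by simp)
    apply hne
    rw [Finset.sdiff_empty]
    have hU : ∀ U : Finset (Fin m),
        ((x + ∑ k ∈ U, e k) j).val = 0 ∨ ((x + ∑ k ∈ U, e k) j).val = 2 * c := by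
      intro U
      rw [hwalk]
      split_ifs
      · exact Or.inl (hlast _ hj')
      · exact Or.inr (by simpa using hj')
    have h1 := hbd j _ ⟨j, hU U⟩
    have h2 := hbd j _ ⟨j, hU (insert k U)⟩
    rw [Finset.sum_insert hk, add_comm (e k), ← add_assoc] at h2
    have h3 : hyperplane m c j (x + ∑ k ∈ U, e k) k = 0 := by
      simp only [hyperplane]
      rw [if_neg]
      rintro ⟨-, h⟩
      have := hU U
      rw [h, hval] at this
      omega
    simp only [a, Pi.add_apply, cobound, h1, h2, h3, add_zero]
  refine ⟨x, hin, fun i => ?_⟩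
  obtain ⟨U, k, -, hk, hne⟩ := hx' (a i) (by simp)
  rw [Finset.sdiff_empty] at hne
  -- Away from the last hyperplane the cocycle `a i` is the coboundary of the label `f i`.
  have hcob : a i (x + ∑ k ∈ U, e k) k =
      lab (f i (x + ∑ k ∈ U, e k)) + lab (f i (x + ∑ k ∈ insert k U, e k)) := by
    have h2 : ∀ a : ZMod 2, a + a = 0 := by decide
    have h1 : x + ∑ k ∈ U, e k + e k = x + ∑ k ∈ insert k U, e k := by
      rw [Finset.sum_insert hk, add_comm (e k), ← add_assoc]
    have h3 : hyperplane m c i (x + ∑ k ∈ U, e k) k +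
        (lab (c < ((x + ∑ k ∈ U, e k) i).val) +
          lab (c < ((x + ∑ k ∈ insert k U, e k) i).val)) = 0 := by
      by_cases hki : k = i
      · subst hki
        have hiff : x k = (c : ZMod (2 * c + 1)) ↔ (x k).val = c := by
          rw [← (ZMod.val_injective (2 * c + 1)).eq_iff, hval]
        simp only [hwalk, hyperplane, lab, hk, if_false, add_zero, true_and,
          Finset.mem_insert_self, if_true,
          hnext _ (hin k), hiff]
        rcases lt_trichotomy (x k).val c with hlt | heq | hgt
        · rw [if_neg hlt.ne, if_neg (by omega), if_neg (by omega)]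
          rfl
        · rw [if_pos heq, if_neg (by omega), if_pos (by omega)]
          rfl
        · rw [if_neg hgt.ne', if_pos (by omega), if_pos (by omega)]
          rfl
      · have : i ∈ insert k U ↔ i ∈ U := by simp [Ne.symm hki]
        have h4 : (x + ∑ k ∈ insert k U, e k) i = (x + ∑ k ∈ U, e k) i := by
          simp only [hwalk, this]
        rw [h4, hyperplane, if_neg (fun h => hki h.1), zero_add]
        exact h2 _
    change hyperplane m c i (x + ∑ k ∈ U, e k) k + (h i (x + ∑ k ∈ U, e k + e k) +
      h i (x + ∑ k ∈ U, e k)) = _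
    rw [h1]
    simp only [h]
    linear_combination h3
  rw [hcob] at hne
  by_cases h1 : f i (x + ∑ k ∈ U, e k) <;> by_cases h2 : f i (x + ∑ k ∈ insert k U, e k)
  · simp only [lab, h1, h2, if_true] at hne
    exact absurd rfl hne
  · exact ⟨⟨_, h1⟩, ⟨_, h2⟩⟩
  · exact ⟨⟨_, h2⟩, ⟨_, h1⟩⟩
  · simp only [lab, h1, h2, if_false] at hne
    exact absurd rfl hne

end Grid

/-! ### A form of the fixed point theorem of Brouwer -/

section Brouwer

variable {m : ℕ}

/-- A continuous self-map of `ℝᵐ` which is the identity outside a bounded set has a zero. -/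
theorem exists_eq_zero_of_eq_self {F : (Fin m → ℝ) → Fin m → ℝ} (hF : Continuous F) {R : ℝ}
    (hR : ∀ y, R ≤ ‖y‖ → F y = y) : ∃ y, F y = 0 := by
  by_contra hzero
  push Not at hzero
  wlog hR0 : 0 < R generalizing R
  · exact this (R := 1) (fun y hy => hR y (by linarith)) one_pos
  -- `‖F‖` is bounded below by some `ε > 0`.
  obtain ⟨ε, hε, hFε⟩ : ∃ ε > 0, ∀ y, ε ≤ ‖F y‖ := by
    obtain ⟨y₀, -, hy₀⟩ := (isCompact_closedBall (0 : Fin m → ℝ) R).exists_isMinOn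
      ⟨0, by simp [hR0.le]⟩ (hF.norm.continuousOn)
    refine ⟨min R ‖F y₀‖, lt_min hR0 (norm_pos_iff.mpr (hzero _)), fun y => ?_⟩
    rcases le_total ‖y‖ R with h | h
    · exact (min_le_right _ _).trans (hy₀ (by simpa using h))
    · rw [hR y h]
      exact (min_le_left _ _).trans h
  have hunif : UniformContinuous F := by
    have hcs : HasCompactSupport fun y => F y - y := by
      refine HasCompactSupport.intro (isCompact_closedBall (0 : Fin m → ℝ) R) fun y hy => ?_
      have : R < ‖y‖ := by simpa using hy
      rw [hR y this.le, sub_self]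
    have := (hcs.uniformContinuous_of_continuous (hF.sub continuous_id)).add uniformContinuous_id
    simpa using this
  obtain ⟨δ, hδ, hFδ⟩ := Metric.uniformContinuous_iff.mp hunif ε hε
  obtain ⟨c, hc⟩ := exists_nat_gt (R / (δ / 2))
  have hc' : R < c * (δ / 2) := (div_lt_iff₀ (by positivity)).mp hc
  have hc0 : 0 < c := by
    by_contra h
    have : c = 0 := by omega
    rw [this] at hc'
    simp at hc'
    linarith
  let pos : (Fin m → ZMod (2 * c + 1)) → Fin m → ℝ := fun x i => ((x i).val - c) * (δ / 2)
  obtain ⟨x, hx, hxU⟩ := exists_cube (c := c) (fun i x => 0 < F (pos x) i) hc0 (by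
    rintro i x ⟨j, hj⟩
    have hpos : R ≤ |pos x j| := by
      simp only [pos]
      rcases hj with hj | hj
      · rw [hj, abs_of_nonpos] <;> push_cast <;> nlinarith
      · rw [hj, abs_of_nonneg] <;> push_cast <;> nlinarith
    rw [hR _ (hpos.trans (norm_le_pi_norm (pos x) j))]
    simp only [pos]
    rw [mul_pos_iff_of_pos_right (by positivity), sub_pos, Nat.cast_lt])
  refine absurd (hFε (pos x)) (not_le.mpr ((pi_norm_lt_iff hε).mpr fun i => ?_))
  have hnear : ∀ U : Finset (Fin m),
      |F (pos (x + ∑ k ∈ U, Pi.single k 1)) i - F (pos x) i| < ε := by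
    intro U
    rw [← Real.dist_eq]
    refine (dist_le_pi_dist _ _ i).trans_lt (hFδ ?_)
    refine (dist_pi_lt_iff hδ).mpr fun j => ?_
    have hone : (1 : ZMod (2 * c + 1)).val = 1 := by
      have : Fact (1 < 2 * c + 1) := ⟨by omega⟩
      exact ZMod.val_one _
    have h1 : (x + ∑ k ∈ U, (Pi.single k 1 : Fin m → ZMod (2 * c + 1))) j =
        x j + if j ∈ U then 1 else 0 := by
      simp only [Pi.add_apply, Finset.sum_apply, Pi.single_apply]
      simp
    simp only [pos]
    rw [h1, Real.dist_eq]
    split_ifs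
    · rw [ZMod.val_add, hone, Nat.mod_eq_of_lt (by have := hx j; omega)]
      push_cast
      rw [show ((x j).val + 1 - c : ℝ) * (δ / 2) - ((x j).val - c) * (δ / 2) = δ / 2 by ring,
        abs_of_pos (by positivity)]
      linarith
    · simpa using hδ
  obtain ⟨⟨U, hU⟩, ⟨V, hV⟩⟩ := hxU i
  have h1 := abs_lt.mp (hnear U)
  have h2 := abs_lt.mp (hnear V)
  rw [Real.norm_eq_abs, abs_lt]
  constructor <;> linarith

end Brouwer

/-! ### The barycentric subdivision of a sphere -/

section Sphere

variable {m : ℕ}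

/-- The proper nonempty subsets of `{0, …, m}`, i.e. the faces of the boundary of the
`m`-simplex. -/
abbrev ProperFace (m : ℕ) : Type :=
  {A : Finset (Fin (m + 1)) // A.Nonempty ∧ Aᶜ.Nonempty}

/-- The quotient of `ℝ^(m+1)` by the constant vectors, identified with `ℝ^m`. -/
def modConst (x : Fin (m + 1) → ℝ) : Fin m → ℝ := fun i => x i.succ - x 0

theorem modConst_ne_zero {x : Fin (m + 1) → ℝ} {i j : Fin (m + 1)} (h : x i ≠ x j) :
    modConst x ≠ 0 := by
  intro h0
  have key : ∀ i, x i = x 0 := by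
    intro i
    induction i using Fin.cases with
    | zero => rfl
    | succ i => exact sub_eq_zero.mp (congrFun h0 i)
  exact h ((key i).trans (key j).symm)

theorem continuous_modConst : Continuous (modConst (m := m)) :=
  continuous_pi fun _ => (continuous_apply _).sub (continuous_apply _)

/-- The section of `modConst` with vanishing coordinate `0`. -/
def consZero (y : Fin m → ℝ) : Fin (m + 1) → ℝ := Fin.cons 0 y

theorem modConst_consZero (y : Fin m → ℝ) : modConst (consZero y) = y := by
  ext i
  simp [modConst, consZero]

theorem consZero_succ_ne {y : Fin m → ℝ} {i : Fin m} (h : y i ≠ 0) :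
    consZero y i.succ ≠ consZero y 0 := by
  simpa [consZero] using h

theorem modConst_add_smul (a b : ℝ) (x y : Fin (m + 1) → ℝ) :
    modConst (a • x + b • y) = a • modConst x + b • modConst y := by
  ext i
  simp [modConst]
  ring

theorem continuous_consZero : Continuous (consZero (m := m)) := by
  refine continuous_pi fun i => ?_
  induction i using Fin.cases with
  | zero => simpa [consZero] using continuous_const
  | succ i => simpa [consZero] using continuous_apply i

/-- The length of the set of thresholds `s` for which `A = {i | s ≤ x i}`. -/
def gap (A : ProperFace m) (x : Fin (m + 1) → ℝ) : ℝ :=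
  max 0 (A.1.inf' A.2.1 x - A.1ᶜ.sup' A.2.2 x)

theorem gap_nonneg (A : ProperFace m) (x : Fin (m + 1) → ℝ) : 0 ≤ gap A x := le_max_left _ _

theorem continuous_gap (A : ProperFace m) : Continuous (gap A) := by
  refine continuous_const.max (Continuous.sub ?_ ?_)
  · exact Continuous.finset_inf'_apply _ fun i _ => continuous_apply i
  · exact Continuous.finset_sup'_apply _ fun i _ => continuous_apply i

/-- A face has positive weight at `x` precisely if it is a superlevel set of `x`. -/
theorem gap_ne_zero_iff (A : ProperFace m) (x : Fin (m + 1) → ℝ) :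
    gap A x ≠ 0 ↔ ∀ i ∈ A.1, ∀ j ∉ A.1, x j < x i := by
  have h1 : gap A x ≠ 0 ↔ A.1ᶜ.sup' A.2.2 x < A.1.inf' A.2.1 x := by
    rw [(gap_nonneg A x).lt_iff_ne'.symm, gap, lt_max_iff]
    simp
  rw [h1, Finset.lt_inf'_iff]
  simp [Finset.sup'_lt_iff]

/-- The set where a nonconstant `x` is maximal is a proper superlevel set. -/
theorem sum_gap_pos {x : Fin (m + 1) → ℝ} {i j : Fin (m + 1)} (h : x i ≠ x j) :
    0 < ∑ A, gap A x := by
  obtain ⟨k, -, hk⟩ := Finset.exists_max_image Finset.univ x ⟨0, Finset.mem_univ _⟩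
  let A : Finset (Fin (m + 1)) := Finset.univ.filter fun l => x l = x k
  have hA : A.Nonempty ∧ Aᶜ.Nonempty := by
    refine ⟨⟨k, by simp [A]⟩, ?_⟩
    by_contra hc
    have hall : ∀ l, x l = x k := by
      intro l
      by_contra hl
      exact hc ⟨l, by simp [A, hl]⟩
    exact h ((hall i).trans (hall j).symm)
  refine Finset.sum_pos' (fun A _ => gap_nonneg A x) ⟨⟨A, hA⟩, Finset.mem_univ _, ?_⟩
  refine (gap_nonneg _ x).lt_of_ne' ((gap_ne_zero_iff _ _).mpr fun i hi j hj => ?_)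
  simp only [A, Finset.mem_filter, Finset.mem_univ, true_and] at hi hj
  rw [hi]
  exact (hk j (Finset.mem_univ _)).lt_of_ne hj

/-- A nonzero vector of `ℝ^m`, lifted to a nonconstant `x` in `ℝ^(m+1)`, as a point of the
barycentric subdivision of the boundary of the simplex: the measure on the flag of superlevel sets
of `x`. -/
def sphereMeasure (y : {y : Fin m → ℝ // y ≠ 0}) : ChainMeasure (ProperFace m) :=
  ⟨⟨fun A => gap A (consZero y.1) / ∑ B, gap B (consZero y.1),
      fun A => div_nonneg (gap_nonneg _ _) (Finset.sum_nonneg fun B _ => gap_nonneg _ _), by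
      rw [← Finset.sum_div]
      obtain ⟨i, hi⟩ := Function.ne_iff.mp y.2
      refine div_self (sum_gap_pos (consZero_succ_ne hi)).ne'⟩, by
    have key : ∀ A : ProperFace m, gap A (consZero y.1) / ∑ B, gap B (consZero y.1) ≠ 0 →
        ∀ i ∈ A.1, ∀ j ∉ A.1, consZero y.1 j < consZero y.1 i :=
      fun A hA => (gap_ne_zero_iff A _).mp (left_ne_zero_of_mul hA)
    intro A hA B hB _
    by_contra hc
    rw [not_or] at hc
    obtain ⟨i, hiA, hiB⟩ := Finset.not_subset.mp hc.1
    obtain ⟨j, hjB, hjA⟩ := Finset.not_subset.mp hc.2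
    exact lt_asymm (key A hA i hiA j hjA) (key B hB j hjB i hiB)⟩

theorem lt_of_sphereMeasure_ne_zero (y : {y : Fin m → ℝ // y ≠ 0}) {A : ProperFace m}
    (hA : (sphereMeasure y).1 A ≠ 0) :
    ∀ i ∈ A.1, ∀ j ∉ A.1, consZero y.1 j < consZero y.1 i :=
  (gap_ne_zero_iff A _).mp (left_ne_zero_of_mul hA)

theorem continuous_sphereMeasure : Continuous (sphereMeasure (m := m)) := by
  refine Continuous.subtype_mk (Continuous.subtype_mk (continuous_pi fun A => ?_) _) _
  have hg : ∀ A : ProperFace m,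
      Continuous fun y : {y : Fin m → ℝ // y ≠ 0} => gap A (consZero y.1) :=
    fun A => (continuous_gap A).comp (continuous_consZero.comp continuous_subtype_val)
  refine (hg A).div (continuous_finsetSum _ fun B _ => hg B) fun y => ?_
  obtain ⟨i, hi⟩ := Function.ne_iff.mp y.2
  exact (sum_gap_pos (consZero_succ_ne hi)).ne'

/-- The indicator vector of a face. -/
def faceVec (A : Finset (Fin (m + 1))) : Fin (m + 1) → ℝ := fun i => if i ∈ A then 1 else 0

/-- The map from the barycentric subdivision back to `ℝ^m` never points opposite to `y`, because
all the superlevel sets contain the maxima of `y` and avoid its minima. -/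
theorem modConst_combination_ne_zero (y : {y : Fin m → ℝ // y ≠ 0}) {s : ℝ} (hs0 : 0 ≤ s)
    (hs1 : s ≤ 1) :
    (1 - s) • modConst (∑ A : ProperFace m, (sphereMeasure y).1 A • faceVec A.1) + s • y.1 ≠ 0 := by
  set x : Fin (m + 1) → ℝ := consZero y.1 with hx
  have hy : y.1 = modConst x := (modConst_consZero _).symm
  obtain ⟨k, -, hk⟩ := Finset.exists_max_image Finset.univ x ⟨0, Finset.mem_univ _⟩
  obtain ⟨l, -, hl⟩ := Finset.exists_min_image Finset.univ x ⟨0, Finset.mem_univ _⟩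
  have hlk : x l < x k := by
    obtain ⟨i, hi⟩ := Function.ne_iff.mp y.2
    have h1 : x i.succ ≠ x 0 := consZero_succ_ne hi
    rcases lt_or_gt_of_ne h1 with h | h
    · exact (hl _ (Finset.mem_univ _)).trans_lt (h.trans_le (hk _ (Finset.mem_univ _)))
    · exact (hl _ (Finset.mem_univ _)).trans_lt (h.trans_le (hk _ (Finset.mem_univ _)))
  have hsum := stdSimplex.sum_eq_one (sphereMeasure y).1
  have h1 : (∑ A : ProperFace m, (sphereMeasure y).1 A • faceVec A.1) k = 1 := by
    rw [← hsum, Finset.sum_apply]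
    refine Finset.sum_congr rfl fun A _ => ?_
    by_cases hA : (sphereMeasure y).1 A = 0
    · simp [hA]
    · have : k ∈ A.1 := by
        by_contra hkA
        obtain ⟨i, hi⟩ := A.2.1
        exact absurd (lt_of_sphereMeasure_ne_zero y hA i hi k hkA)
          (not_lt_of_ge (hk i (Finset.mem_univ _)))
      simp [faceVec, this]
  have h0 : (∑ A : ProperFace m, (sphereMeasure y).1 A • faceVec A.1) l = 0 := by
    rw [Finset.sum_apply]
    refine Finset.sum_eq_zero fun A _ => ?_
    by_cases hA : (sphereMeasure y).1 A = 0
    · simp [hA]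
    · have : l ∉ A.1 := by
        intro hlA
        obtain ⟨i, hi⟩ := A.2.2
        exact absurd (lt_of_sphereMeasure_ne_zero y hA l hlA i (by simpa using hi))
          (not_lt_of_ge (hl i (Finset.mem_univ _)))
      simp [faceVec, this]
  rw [hy, ← modConst_add_smul]
  refine modConst_ne_zero (i := l) (j := k) (ne_of_lt ?_)
  simp only [Pi.add_apply, Pi.smul_apply, smul_eq_mul, h1, h0]
  rcases hs1.lt_or_eq with h | rfl
  · nlinarith
  · linarith

end Sphere

/-! ### Posets which retract onto a sphere are not contractible -/

section Retract

variable {S : Type u} [PartialOrder S] {m : ℕ}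

/-- A monotone map from `S` to the faces of the boundary of the simplex gives a continuous map
from `|S|` to the complement of the origin. -/
theorem exists_map_to_punctured (J : S →o ProperFace m) :
    ∃ Φ : C(classifyingSpace S, {y : Fin m → ℝ // y ≠ 0}),
      ∀ (k : ℕ) (c : Fin (k + 1) →o S) (t : stdSimplex ℝ (Fin (k + 1))),
        (Φ (chainPoint (𝟭 S) c t)).1 = modConst (∑ i, t i • faceVec (J (c i)).1) := by
  have hne : ∀ (k : ℕ) (c : Fin (k + 1) →o S) (t : stdSimplex ℝ (Fin (k + 1))),
      modConst (∑ i, t i • faceVec (J (c i)).1) ≠ 0 := by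
    intro k c t
    obtain ⟨i, hi⟩ := (J (c 0)).2.1
    obtain ⟨j, hj⟩ := (J (c (Fin.last k))).2.2
    have h1 : (∑ l, t l • faceVec (J (c l)).1) i = 1 := by
      rw [← stdSimplex.sum_eq_one t, Finset.sum_apply]
      refine Finset.sum_congr rfl fun l _ => ?_
      have : i ∈ (J (c l)).1 := (J.monotone (c.monotone (Fin.zero_le l))) hi
      simp [faceVec, this]
    have h0 : (∑ l, t l • faceVec (J (c l)).1) j = 0 := by
      rw [Finset.sum_apply]
      refine Finset.sum_eq_zero fun l _ => ?_
      have : j ∉ (J (c l)).1 := fun h =>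
        (Finset.mem_compl.mp hj) ((J.monotone (c.monotone (Fin.le_last l))) h)
      simp [faceVec, this]
    refine modConst_ne_zero (i := i) (j := j) ?_
    rw [h1, h0]
    exact one_ne_zero
  have hcont : ∀ (k : ℕ) (c : Fin (k + 1) →o S), Continuous fun t : stdSimplex ℝ (Fin (k + 1)) =>
      modConst (∑ i, t i • faceVec (J (c i)).1) := by
    intro k c
    refine continuous_modConst.comp (continuous_finsetSum _ fun i _ => ?_)
    have h : Continuous fun t : stdSimplex ℝ (Fin (k + 1)) => t i :=
      (continuous_apply i).comp continuous_subtype_val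
    exact h.smul continuous_const
  let toHom : ∀ {k : ℕ}, ComposableArrows S k → (Fin (k + 1) →o S) :=
    fun c => ⟨c.obj, fun i j h => leOfHom (c.map (homOfLE h))⟩
  obtain ⟨f, hf⟩ := exists_toTop_desc (X := nerve S) (Z := ULift.{u} {y : Fin m → ℝ // y ≠ 0})
    (fun k c => ⟨fun t => ULift.up ⟨_, hne k (toHom c) t⟩,
      continuous_uliftUp.comp ((hcont k (toHom c)).subtype_mk _)⟩) (by
    intro n k θ c t
    refine congrArg ULift.up (Subtype.ext ?_)
    change modConst (∑ i, t i • faceVec (J (toHom c (θ i))).1) =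
      modConst (∑ i, stdSimplex.map θ t i • faceVec (J (toHom c i)).1)
    congr 1
    simp only [stdSimplex.map_coe, FunOnFinite.linearMap_apply_apply, Finset.sum_smul]
    rw [← Finset.sum_fiberwise Finset.univ (SimplexCategory.Hom.toOrderHom θ)]
    refine Finset.sum_congr rfl fun j _ => Finset.sum_congr rfl fun i hi => ?_
    rw [← (Finset.mem_filter.mp hi).2])
  refine ⟨⟨fun x => (f x).down, continuous_uliftDown.comp f.continuous⟩, fun k c t => ?_⟩
  have := hf k (c.monotone.functor ⋙ 𝟭 S) t
  exact congrArg (fun z : ULift.{u} {y : Fin m → ℝ // y ≠ 0} => z.down.1) this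

/-- A poset which retracts onto the proper nonempty subsets of a finite set, i.e. onto the
barycentric subdivision of a sphere, is not contractible. -/
theorem not_isContractible_of_retract (J : S →o ProperFace m) (s : ProperFace m →o S)
    (hJs : ∀ A, J (s A) = A) : ¬ IsContractible S := by
  intro hS
  have hS' : ContractibleSpace (classifyingSpace S) := hS
  obtain ⟨Φ, hΦ⟩ := exists_map_to_punctured J
  let ψ : {y : Fin m → ℝ // y ≠ 0} → classifyingSpace S :=
    fun y => ofChainMeasure s.monotone.functor (sphereMeasure y)
  have hψ : Continuous ψ := (continuous_ofChainMeasure _).comp continuous_sphereMeasure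
  have hΦψ : ∀ y, (Φ (ψ y)).1 =
      modConst (∑ A : ProperFace m, (sphereMeasure y).1 A • faceVec A.1) := by
    intro y
    obtain ⟨k, π, t, hw⟩ := exists_chain_rep (sphereMeasure y)
    have h1 : ψ y = chainPoint (𝟭 S) (s.comp π) t := ofChainMeasure_eq _ _ π t hw
    rw [h1, hΦ, ← hw]
    congr 1
    simp only [stdSimplex.map_coe, FunOnFinite.linearMap_apply_apply, Finset.sum_smul]
    rw [← Finset.sum_fiberwise Finset.univ π]
    refine Finset.sum_congr rfl fun j _ => Finset.sum_congr rfl fun i hi => ?_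
    rw [← (Finset.mem_filter.mp hi).2]
    simp [hJs]
  obtain ⟨p, ⟨H⟩⟩ := id_nullhomotopic (classifyingSpace S)
  let τ : (Fin m → ℝ) → unitInterval := fun y => Set.projIcc 0 1 zero_le_one (2 - ‖y‖)
  let σ : (Fin m → ℝ) → unitInterval := fun y => Set.projIcc 0 1 zero_le_one (‖y‖ - 2)
  have hτ : Continuous τ := continuous_projIcc.comp (continuous_const.sub continuous_norm)
  have hσ : Continuous σ := continuous_projIcc.comp (continuous_norm.sub continuous_const)
  have hσ0 : ∀ y, ‖y‖ ≤ 2 → σ y = 0 := fun y hy => Set.projIcc_of_le_left _ (by linarith)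
  have hσ1 : ∀ y, 3 ≤ ‖y‖ → σ y = 1 := fun y hy => Set.projIcc_of_right_le _ (by linarith)
  have hτ0 : ∀ y, 2 ≤ ‖y‖ → τ y = 0 := fun y hy => Set.projIcc_of_le_left _ (by linarith)
  have hτ1 : ∀ y, ‖y‖ ≤ 1 → τ y = 1 := fun y hy => Set.projIcc_of_right_le _ (by linarith)
  -- The contraction fills the sphere: `F` follows it for `1 ≤ ‖y‖ ≤ 2`, is constant inside the
  -- unit ball, and is moved to the identity for `2 ≤ ‖y‖ ≤ 3`.
  let F' : {y : Fin m → ℝ // y ≠ 0} → Fin m → ℝ := fun y =>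
    (1 - (σ y.1 : ℝ)) • (Φ (H (τ y.1, ψ y))).1 + (σ y.1 : ℝ) • y.1
  have hF' : Continuous F' := by
    have h1 : Continuous fun y : {y : Fin m → ℝ // y ≠ 0} => (σ y.1 : ℝ) :=
      continuous_subtype_val.comp (hσ.comp continuous_subtype_val)
    have h2 : Continuous fun y : {y : Fin m → ℝ // y ≠ 0} => (Φ (H (τ y.1, ψ y))).1 :=
      continuous_subtype_val.comp (Φ.continuous.comp
        (H.continuous.comp ((hτ.comp continuous_subtype_val).prodMk hψ)))
    exact ((continuous_const.sub h1).smul h2).add (h1.smul continuous_subtype_val)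
  let F : (Fin m → ℝ) → Fin m → ℝ := fun y => if h : y ≠ 0 then F' ⟨y, h⟩ else (Φ p).1
  have hF1 : ∀ y, ‖y‖ ≤ 1 → F y = (Φ p).1 := by
    intro y hy
    by_cases h : y ≠ 0
    · simp only [F, dif_pos h, F', hσ0 y (by linarith), hτ1 y hy, ContinuousMap.Homotopy.apply_one]
      simp
    · simp only [F, dif_neg h]
  have hF : Continuous F := by
    rw [continuous_iff_continuousAt]
    intro y
    by_cases h : y ≠ 0
    · have hopen : IsOpen {y : Fin m → ℝ | y ≠ 0} := isOpen_ne
      refine ContinuousOn.continuousAt (s := {y | y ≠ 0}) ?_ (hopen.mem_nhds h)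
      rw [continuousOn_iff_continuous_domRestrict]
      refine hF'.congr fun z => ?_
      simp only [Set.domRestrict_apply, F]
      rw [dif_pos z.2]
    · have hball : Metric.ball (0 : Fin m → ℝ) 1 ∈ nhds y := by
        rw [not_not] at h
        rw [h]
        exact Metric.ball_mem_nhds _ one_pos
      refine (continuousAt_const (y := (Φ p).1)).congr ?_
      filter_upwards [hball] with z hz
      exact (hF1 z (by simpa using (le_of_lt (by simpa using hz)))).symm
  obtain ⟨y, hy⟩ := exists_eq_zero_of_eq_self hF (R := 3) (by
    intro y hy
    have h : y ≠ 0 := by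
      rintro rfl
      simp at hy
      linarith
    simp only [F, dif_pos h, F', hσ1 y hy]
    simp)
  by_cases h : y ≠ 0
  · rcases le_total ‖y‖ 2 with h2 | h2
    · simp only [F, dif_pos h, F', hσ0 y h2] at hy
      refine (Φ (H (τ y, ψ ⟨y, h⟩))).2 ?_
      simpa using hy
    · simp only [F, dif_pos h, F', hτ0 y h2, ContinuousMap.Homotopy.apply_zero,
        ContinuousMap.id_apply, hΦψ] at hy
      exact modConst_combination_ne_zero ⟨y, h⟩ (σ y).2.1 (σ y).2.2 hy
  · simp only [F, dif_neg h] at hy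
    exact (Φ p).2 hy

end Retract

/-! ### The Frattini subgroup of a p-group -/

section PGroups

variable {p : ℕ} [Fact p.Prime] {P : Type*} [Group P] [Finite P]

/-- A maximal subgroup of a `p`-group is normal of index `p`. -/
theorem normal_and_index_of_isCoatom (hP : IsPGroup p P) {M : Subgroup P}
    (hM : IsCoatom M) : M.Normal ∧ M.index = p := by
  have hn : Group.IsNilpotent P := hP.isNilpotent
  refine ⟨Subgroup.NormalizerCondition.normal_of_coatom M
    Group.normalizerCondition_of_isNilpotent hM, ?_⟩
  obtain ⟨n, hn⟩ := IsPGroup.iff_card.mp hP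
  obtain ⟨k, hk⟩ := IsPGroup.iff_card.mp (hP.to_subgroup M)
  have hp : p.Prime := Fact.out
  have hmul := M.card_mul_index
  have hlt : k < n := by
    have h1 : Nat.card M < Nat.card P := by
      refine lt_of_le_of_ne (Subgroup.card_le_card_group M) fun h => hM.1 ?_
      exact Subgroup.eq_top_of_card_eq M h
    rw [hn, hk] at h1
    exact (Nat.pow_lt_pow_iff_right hp.one_lt).mp h1
  obtain ⟨K, hK, hMK⟩ := Sylow.exists_subgroup_card_pow_succ (p := p) (n := k) (H := M)
    (by rw [hn]; exact pow_dvd_pow _ hlt) hk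
  have hKtop : K = ⊤ := by
    refine hM.2 K (lt_of_le_of_ne hMK ?_)
    rintro rfl
    rw [hk] at hK
    have := Nat.pow_right_injective hp.two_le hK
    omega
  rw [hKtop, Subgroup.card_top] at hK
  rw [hK, hk, pow_succ] at hmul
  exact Nat.eq_of_mul_eq_mul_left (pow_pos hp.pos k) hmul

theorem isElementaryAbelian_of_frattini_eq_bot (hP : IsPGroup p P) (h : frattini P = ⊥) :
    IsElementaryAbelian P p := by
  have hmem : ∀ x : P, (∀ M : Subgroup P, IsCoatom M → x ∈ M) → x = 1 := by
    intro x hx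
    have : x ∈ frattini P := by
      simp only [frattini, Order.radical, Subgroup.mem_iInf]
      exact fun M hM => hx M hM
    rwa [h, Subgroup.mem_bot] at this
  constructor
  · intro x y
    rw [← mul_inv_eq_one]
    refine hmem _ fun M hM => ?_
    obtain ⟨hn, hi⟩ := normal_and_index_of_isCoatom hP hM
    have hc : Nat.card (P ⧸ M) = p := hi
    have := isCyclic_of_prime_card hc
    rw [← QuotientGroup.eq_one_iff]
    have h2 : (x : P ⧸ M) * y = y * x := by
      let _ := IsCyclic.commGroup (α := P ⧸ M)
      exact mul_comm (x : P ⧸ M) y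
    simp only [QuotientGroup.mk_mul, QuotientGroup.mk_inv]
    rw [h2]
    group
  · intro x
    refine hmem _ fun M hM => ?_
    obtain ⟨hn, hi⟩ := normal_and_index_of_isCoatom hP hM
    rw [← hi]
    exact M.pow_index_mem x

/-- A nontrivial normal subgroup of a `p`-group meets the center nontrivially. -/
theorem inf_center_ne_bot (hP : IsPGroup p P) {N : Subgroup P} [N.Normal] (h : N ≠ ⊥) :
    N ⊓ Subgroup.center P ≠ ⊥ := by
  have hconj : IsPGroup p (ConjAct P) := hP.of_equiv ConjAct.toConjAct
  have hdvd : p ∣ Nat.card N := by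
    obtain ⟨k, hk⟩ := IsPGroup.iff_card.mp (hP.to_subgroup N)
    rw [hk]
    refine dvd_pow_self p ?_
    rintro rfl
    rw [pow_zero] at hk
    exact h (Subgroup.eq_bot_of_card_eq N hk)
  obtain ⟨b, hb, hb1⟩ := hconj.exists_fixed_point_of_prime_dvd_card_of_fixed_point N hdvd
    (a := 1) (by intro g; simp)
  intro hbot
  have hmem : (b : P) ∈ N ⊓ Subgroup.center P := by
    refine ⟨b.2, Subgroup.mem_center_iff.mpr fun g => ?_⟩
    have := congrArg Subtype.val (hb (ConjAct.toConjAct g))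
    exact mul_inv_eq_iff_eq_mul.mp this
  rw [hbot, Subgroup.mem_bot] at hmem
  exact hb1 (Subtype.ext hmem.symm)

theorem sup_lt_top_of_le_frattini {H Z : Subgroup P} (hH : H < ⊤) (hZ : Z ≤ frattini P) :
    H ⊔ Z < ⊤ :=
  lt_top_iff_ne_top.mpr fun h => hH.ne (frattini_nongenerating
    (top_le_iff.mp (h.symm.le.trans (sup_le_sup_left hZ H))))

end PGroups

/-! ### Subgroups of elementary abelian groups -/

section Elementary

variable {p : ℕ} [Fact p.Prime] {P : Type*} [Group P]

theorem exists_linearEquiv_fin (V : Type*) [AddCommGroup V] [Module (ZMod p) V] [Finite V]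
    [Nontrivial V] : ∃ m : ℕ, Nonempty (V ≃ₗ[ZMod p] (Fin (m + 1) → ZMod p)) := by
  have hpos : 0 < Module.finrank (ZMod p) V := Module.finrank_pos
  obtain ⟨m, hm⟩ := Nat.exists_eq_add_one.mpr hpos
  exact ⟨m, ⟨(Module.finBasisOfFinrankEq (ZMod p) V hm).equivFun⟩⟩

theorem exists_addEquiv_fin (V : Type*) [AddCommGroup V] [Finite V] [Nontrivial V]
    (h : ∀ x : V, p • x = 0) : ∃ m : ℕ, Nonempty (V ≃+ (Fin (m + 1) → ZMod p)) := by
  let _ : Module (ZMod p) V := AddCommGroup.zmodModule h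
  obtain ⟨m, ⟨e⟩⟩ := exists_linearEquiv_fin (p := p) V
  exact ⟨m, ⟨e.toAddEquiv⟩⟩

/-- An elementary abelian group is a coordinate space over `ZMod p`, written multiplicatively. -/
theorem exists_coordinates [Finite P] [Nontrivial P] (h : IsElementaryAbelian P p) :
    ∃ (m : ℕ) (r : P → Fin (m + 1) → ZMod p), Function.Bijective r ∧
      ∀ x y, r (x * y) = r x + r y := by
  let i1 : AddCommGroup (Additive P) :=
    { (inferInstance : AddGroup (Additive P)) with add_comm := fun x y => h.1 x.toMul y.toMul }
  obtain ⟨m, ⟨e⟩⟩ := exists_addEquiv_fin (p := p) (Additive P) fun x => h.2 x.toMul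
  exact ⟨m, fun x => e (Additive.ofMul x), e.bijective.comp Additive.ofMul.bijective,
    fun x y => map_add e (Additive.ofMul x) (Additive.ofMul y)⟩

variable {m : ℕ} {r : P → Fin (m + 1) → ZMod p}

theorem coordinates_one (hadd : ∀ x y, r (x * y) = r x + r y) : r 1 = 0 := by
  simpa using hadd 1 1

theorem coordinates_inv (hadd : ∀ x y, r (x * y) = r x + r y) (x : P) : r x⁻¹ = - r x := by
  have := hadd x⁻¹ x
  rw [inv_mul_cancel, coordinates_one hadd] at this
  exact eq_neg_of_add_eq_zero_left this.symm

theorem coordinates_pow (hadd : ∀ x y, r (x * y) = r x + r y) (x : P) (k : ℕ) :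
    r (x ^ k) = (k : ZMod p) • r x := by
  induction k with
  | zero => simp [coordinates_one hadd]
  | succ k ih =>
    rw [pow_succ, hadd, ih, Nat.cast_succ, add_smul, one_smul]

/-- The coordinate subspace of an elementary abelian group spanned by a set of basis vectors. -/
def coordSubgroup (hadd : ∀ x y, r (x * y) = r x + r y) (A : Finset (Fin (m + 1))) :
    Subgroup P where
  carrier := {x | ∀ i ∉ A, r x i = 0}
  one_mem' := fun i _ => by rw [coordinates_one hadd]; rfl
  mul_mem' := fun {x y} hx hy i hi => by rw [hadd, Pi.add_apply, hx i hi, hy i hi, add_zero]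
  inv_mem' := fun {x} hx i hi => by rw [coordinates_inv hadd, Pi.neg_apply, hx i hi, neg_zero]

open Classical in
/-- The set of positions of the last nonzero coordinates (pivots) of the elements of a subgroup. -/
def pivots (r : P → Fin (m + 1) → ZMod p) (W : Subgroup P) : Finset (Fin (m + 1)) :=
  Finset.univ.filter fun i => ∃ x ∈ W, r x i ≠ 0 ∧ ∀ j, i < j → r x j = 0

theorem mem_pivots {W : Subgroup P} {i : Fin (m + 1)} :
    i ∈ pivots r W ↔ ∃ x ∈ W, r x i ≠ 0 ∧ ∀ j, i < j → r x j = 0 := by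
  simp [pivots]

theorem pivots_nonempty (hr : Function.Bijective r)
    (hadd : ∀ x y, r (x * y) = r x + r y) {W : Subgroup P} (hW : W ≠ ⊥) :
    (pivots r W).Nonempty := by
  obtain ⟨x, hx, hx1⟩ := W.bot_or_exists_ne_one.resolve_left hW
  have hrx : r x ≠ 0 := fun h => hx1 (hr.1 (h.trans (coordinates_one hadd).symm))
  obtain ⟨i, hi⟩ := Function.ne_iff.mp hrx
  let T := Finset.univ.filter fun i => r x i ≠ 0
  have hT : T.Nonempty := ⟨i, by simpa [T] using hi⟩
  refine ⟨T.max' hT, mem_pivots.mpr ⟨x, hx, ?_, fun j hj => ?_⟩⟩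
  · exact (Finset.mem_filter.mp (T.max'_mem hT)).2
  · by_contra h
    exact absurd (T.le_max' j (by simp [T, h])) (not_le_of_gt hj)

/-- A subgroup with all pivots is everything, by Gaussian elimination. -/
theorem compl_pivots_nonempty (hr : Function.Bijective r)
    (hadd : ∀ x y, r (x * y) = r x + r y) {W : Subgroup P} (hW : W ≠ ⊤) :
    (pivots r W)ᶜ.Nonempty := by
  by_contra hne
  have hall : ∀ i, i ∈ pivots r W := fun i => by
    by_contra h
    exact hne ⟨i, Finset.mem_compl.mpr h⟩
  have key : ∀ (n : ℕ) (x : P), (∀ j : Fin (m + 1), n ≤ j.val → r x j = 0) → x ∈ W := by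
    intro n
    induction n with
    | zero =>
      intro x hx
      have : x = 1 := hr.1 ((funext fun j => hx j (Nat.zero_le _)).trans
        (coordinates_one hadd).symm)
      rw [this]
      exact W.one_mem
    | succ n ih =>
      intro x hx
      by_cases hn : n < m + 1
      · obtain ⟨w, hw, hw0, hwj⟩ := mem_pivots.mp (hall ⟨n, hn⟩)
        let k := (r x ⟨n, hn⟩ / r w ⟨n, hn⟩).val
        have hmem : x * (w ^ k)⁻¹ ∈ W := by
          refine ih _ fun j hj => ?_
          rw [hadd, coordinates_inv hadd, coordinates_pow hadd]
          simp only [Pi.add_apply, Pi.neg_apply, Pi.smul_apply, smul_eq_mul, k, ZMod.natCast_val,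
            ZMod.cast_id', id_eq]
          rcases hj.eq_or_lt with he | hlt
          · have : j = ⟨n, hn⟩ := Fin.ext he.symm
            rw [this, div_mul_cancel₀ _ hw0, add_neg_cancel]
          · rw [hx j hlt, hwj j hlt]
            simp
        have := W.mul_mem hmem (W.pow_mem hw k)
        rwa [inv_mul_cancel_right] at this
      · exact ih x fun j hj => absurd j.2 (by omega)
  exact hW (top_le_iff.mp fun x _ => key (m + 1) x fun j hj => absurd j.2 (by omega))

theorem pivots_coordSubgroup (hr : Function.Bijective r)
    (hadd : ∀ x y, r (x * y) = r x + r y) (A : Finset (Fin (m + 1))) :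
    pivots r (coordSubgroup hadd A) = A := by
  ext i
  rw [mem_pivots]
  constructor
  · rintro ⟨x, hx, hxi, -⟩
    by_contra hi
    exact hxi (hx i hi)
  · intro hi
    obtain ⟨x, hx⟩ := hr.2 (Pi.single i 1)
    refine ⟨x, fun j hj => ?_, ?_, fun j hj => ?_⟩
    · rw [hx, Pi.single_eq_of_ne]
      rintro rfl
      exact hj hi
    · simp [hx]
    · rw [hx, Pi.single_eq_of_ne hj.ne']

end Elementary

/-- The proper nontrivial subgroups of an elementary abelian group retract, by taking pivots, onto
the coordinate subspaces, which form the barycentric subdivision of a sphere. -/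
theorem not_isContractible_posetOpen {p : ℕ} [Fact p.Prime] {P : Type u} [Group P] [Finite P]
    [Nontrivial P] (h : IsElementaryAbelian P p) : ¬ IsContractible (PosetOpen P) := by
  obtain ⟨m, r, hr, hadd⟩ := exists_coordinates h
  let J : PosetOpen P →o ProperFace m :=
    ⟨fun W => ⟨pivots r W.1, pivots_nonempty hr hadd W.2.1.ne',
      compl_pivots_nonempty hr hadd W.2.2.ne⟩, by
      intro W W' hW i hi
      obtain ⟨x, hx, hxi⟩ := mem_pivots.mp hi
      exact mem_pivots.mpr ⟨x, hW hx, hxi⟩⟩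
  let s : ProperFace m →o PosetOpen P :=
    ⟨fun A => ⟨coordSubgroup hadd A.1, by
      obtain ⟨A, ⟨i, hi⟩, ⟨j, hj⟩⟩ := A
      constructor
      · refine bot_lt_iff_ne_bot.mpr fun hbot => ?_
        obtain ⟨x, hx⟩ := hr.2 (Pi.single i 1)
        have hmem : x ∈ coordSubgroup hadd A := fun k hk => by
          rw [hx, Pi.single_eq_of_ne]
          rintro rfl
          exact hk hi
        rw [hbot, Subgroup.mem_bot] at hmem
        rw [hmem, coordinates_one hadd] at hx
        simpa using congrFun hx i
      · refine lt_top_iff_ne_top.mpr fun htop => ?_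
        obtain ⟨x, hx⟩ := hr.2 (Pi.single j 1)
        have hmem : x ∈ coordSubgroup hadd A := htop ▸ Subgroup.mem_top x
        have := hmem j (Finset.mem_compl.mp hj)
        rw [hx] at this
        simp at this⟩, fun A B hAB x hx i hi => hx i fun h => hi (hAB h)⟩
  refine not_isContractible_of_retract J s fun A => Subtype.ext ?_
  exact pivots_coordSubgroup hr hadd A.1

/-! ### Criteria for homotopy equivalence and contractibility -/

section HomotopyEquivalences

open Simplicial

variable {C D : Type u} [Category.{v} C] [Category.{v} D]

theorem classifyingMap_id : classifyingMap (𝟭 C) = ContinuousMap.id _ := by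
  refine toTop_hom_ext (X := nerve C) fun n c t => ?_
  exact toTop_map_simplexPoint (nerveMap (𝟭 C)) c t

theorem classifyingMap_comp (F : C ⥤ D) (G : D ⥤ C) :
    classifyingMap (F ⋙ G) = (classifyingMap G).comp (classifyingMap F) := by
  refine toTop_hom_ext (X := nerve C) fun n c t => ?_
  refine (toTop_map_simplexPoint (nerveMap (F ⋙ G)) c t).trans ?_
  refine Eq.trans ?_ (congrArg (SSet.toTop.map (nerveMap G))
    (toTop_map_simplexPoint (nerveMap F) c t)).symm
  exact (toTop_map_simplexPoint (nerveMap G) ((nerveMap F).app _ c) t).symm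

theorem exists_classifyingMap_const (d : D) :
    ∃ x, classifyingMap ((Functor.const C).obj d) = ContinuousMap.const _ x := by
  refine ⟨simplexPoint (X := nerve D) (n := 0) (ComposableArrows.mk₀ d) default, ?_⟩
  refine toTop_hom_ext (X := nerve C) fun n c t => ?_
  refine (toTop_map_simplexPoint (nerveMap ((Functor.const C).obj d)) c t).trans ?_
  let θ : ⦋n⦌ ⟶ ⦋0⦌ := SimplexCategory.mkHom ⟨fun _ => 0, fun _ _ _ => le_rfl⟩
  have h := simplexPoint_map (X := nerve D) θ (ComposableArrows.mk₀ d) t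
  rw [Subsingleton.elim (stdSimplex.map θ t) default] at h
  exact h

/-- A functor with an inverse up to natural transformations is a homotopy equivalence. -/
theorem isHomotopyEquivalence_of_natTrans {F : C ⥤ D} {G : D ⥤ C} (α : 𝟭 C ⟶ F ⋙ G)
    (β : G ⋙ F ⟶ 𝟭 D) : IsHomotopyEquivalence F := by
  refine ⟨⟨classifyingMap F, classifyingMap G, ?_, ?_⟩, rfl⟩
  · have := (classifyingMap_homotopic α).symm
    rwa [classifyingMap_id, classifyingMap_comp] at this
  · have := classifyingMap_homotopic β
    rwa [classifyingMap_id, classifyingMap_comp] at this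

theorem IsHomotopyEquivalence.isContractible_iff {F : C ⥤ D} (h : IsHomotopyEquivalence F) :
    IsContractible C ↔ IsContractible D := by
  obtain ⟨e, -⟩ := h
  exact ⟨fun (_ : ContractibleSpace _) => e.symm.contractibleSpace,
    fun (_ : ContractibleSpace _) => e.contractibleSpace⟩

/-- A category with a zigzag of natural transformations from the identity to a constant functor is
contractible. -/
theorem isContractible_of_natTrans {T : C ⥤ C} (c : C) (α : 𝟭 C ⟶ T)
    (β : (Functor.const C).obj c ⟶ T) : IsContractible C := by
  obtain ⟨x, hx⟩ := exists_classifyingMap_const (C := C) c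
  have h1 := classifyingMap_homotopic α
  have h2 := (classifyingMap_homotopic β).symm
  rw [classifyingMap_id] at h1
  rw [hx] at h2
  exact (contractible_iff_id_nullhomotopic _).mpr ⟨x, h1.trans h2⟩

end HomotopyEquivalences

/-! ### Contractibility of the poset of subgroups -/

section Poset

variable {P : Type u} [Group P] [Finite P]

/-- For a subgroup `Z` of the Frattini subgroup, `H ≤ HZ ≥ Z` is a contraction: the product `HZ`
is proper since the elements of the Frattini subgroup are nongenerators. -/
theorem isContractible_posetOpen_of_le_frattini {Z : Subgroup P} (hZ : Z ≠ ⊥)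
    (hZΦ : Z ≤ frattini P) (hZtop : Z < ⊤) : IsContractible (PosetOpen P) := by
  let T : PosetOpen P →o PosetOpen P :=
    ⟨fun H => ⟨H.1 ⊔ Z, lt_of_lt_of_le H.2.1 le_sup_left,
      sup_lt_top_of_le_frattini H.2.2 hZΦ⟩, fun H K h => sup_le_sup_right h Z⟩
  refine isContractible_of_natTrans (T := T.monotone.functor)
    (⟨Z, bot_lt_iff_ne_bot.mpr hZ, hZtop⟩ : PosetOpen P)
    { app := fun H => homOfLE (show H.1 ≤ H.1 ⊔ Z from le_sup_left)
      naturality := fun _ _ _ => Subsingleton.elim _ _ }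
    { app := fun H => homOfLE (show Z ≤ H.1 ⊔ Z from le_sup_right)
      naturality := fun _ _ _ => Subsingleton.elim _ _ }

end Poset

/-! ### Contractibility of the exterior quotient -/

section Exterior

variable {P : Type u} [Group P] {H K L : ExteriorOpen P}

/-- The morphism of `F̃_P^{(1,P)}` which is the class of `g`. -/
def exteriorMk (g : P) (hg : g ∈ transporter H.obj.toSubgroup K.obj.toSubgroup) : H ⟶ K :=
  ObjectProperty.homMk
    (Quotient.mk _ ⟨g, hg⟩ : ExteriorHom H.obj.toSubgroup K.obj.toSubgroup)

theorem exists_exteriorMk (f : H ⟶ K) : ∃ g, ∃ hg, f = exteriorMk g hg := by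
  obtain ⟨⟨⟨g, hg⟩⟩⟩ := f
  exact ⟨g, hg, rfl⟩

theorem exteriorMk_eq_iff {x y : P}
    {hx : x ∈ transporter H.obj.toSubgroup K.obj.toSubgroup}
    {hy : y ∈ transporter H.obj.toSubgroup K.obj.toSubgroup} :
    (exteriorMk x hx : H ⟶ K) = exteriorMk y hy ↔
      ∃ c ∈ Subgroup.centralizer (H.obj.toSubgroup : Set P), ∃ k ∈ K.obj.toSubgroup,
        y = c * x * k := by
  have h1 : (exteriorMk x hx : H ⟶ K) = exteriorMk y hy ↔
      (Quotient.mk _ ⟨x, hx⟩ : ExteriorHom H.obj.toSubgroup K.obj.toSubgroup) =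
        Quotient.mk _ ⟨y, hy⟩ :=
    ⟨fun h => congrArg InducedCategory.Hom.hom h, fun h => ObjectProperty.hom_ext _ h⟩
  rw [h1, Quotient.eq]
  exact DoubleCoset.rel_iff

/-- A representative of a morphism of `F̃_P^{(1,P)}`. -/
def exteriorRep (f : H ⟶ K) : P := (exists_exteriorMk f).choose

theorem exteriorRep_mem (f : H ⟶ K) :
    exteriorRep f ∈ transporter H.obj.toSubgroup K.obj.toSubgroup :=
  (exists_exteriorMk f).choose_spec.choose

theorem exteriorMk_exteriorRep (f : H ⟶ K) : exteriorMk (exteriorRep f) (exteriorRep_mem f) = f :=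
  (exists_exteriorMk f).choose_spec.choose_spec.symm

theorem exteriorMk_eq_id {x c k : P} {hx : x ∈ transporter H.obj.toSubgroup H.obj.toSubgroup}
    (hc : c ∈ Subgroup.centralizer (H.obj.toSubgroup : Set P)) (hk : k ∈ H.obj.toSubgroup)
    (h : 1 = c * x * k) : (exteriorMk x hx : H ⟶ H) = 𝟙 H :=
  exteriorMk_eq_iff.mpr ⟨c, hc, k, hk, h⟩

theorem exteriorMk_eq_comp {x y z c k : P}
    {hx : x ∈ transporter H.obj.toSubgroup K.obj.toSubgroup}
    {hy : y ∈ transporter K.obj.toSubgroup L.obj.toSubgroup}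
    {hz : z ∈ transporter H.obj.toSubgroup L.obj.toSubgroup}
    (hc : c ∈ Subgroup.centralizer (H.obj.toSubgroup : Set P)) (hk : k ∈ L.obj.toSubgroup)
    (h : x * y = c * z * k) :
    (exteriorMk z hz : H ⟶ L) = (exteriorMk x hx : H ⟶ K) ≫ (exteriorMk y hy : K ⟶ L) :=
  exteriorMk_eq_iff.mpr ⟨c, hc, k, hk, h⟩

theorem exists_exteriorRep_id (H : ExteriorOpen P) :
    ∃ c ∈ Subgroup.centralizer (H.obj.toSubgroup : Set P), ∃ k ∈ H.obj.toSubgroup,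
      1 = c * exteriorRep (𝟙 H) * k :=
  exteriorMk_eq_iff.mp (exteriorMk_exteriorRep (𝟙 H))

theorem exists_exteriorRep_comp (f : H ⟶ K) (g : K ⟶ L) :
    ∃ c ∈ Subgroup.centralizer (H.obj.toSubgroup : Set P), ∃ k ∈ L.obj.toSubgroup,
      exteriorRep f * exteriorRep g = c * exteriorRep (f ≫ g) * k := by
  have h := exteriorMk_exteriorRep (f ≫ g)
  conv_rhs at h => rw [← exteriorMk_exteriorRep f, ← exteriorMk_exteriorRep g]
  exact exteriorMk_eq_iff.mp h

theorem transporter_sup_center {H K Z : Subgroup P} (hZ : Z ≤ Subgroup.center P) {g : P}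
    (hg : g ∈ transporter H K) : g ∈ transporter (H ⊔ Z) (K ⊔ Z) := by
  have h1 : H ⊔ Z ≤ (K ⊔ Z).comap (MulAut.conj g⁻¹).toMonoidHom := by
    refine sup_le (fun h hh => ?_) fun z hz => ?_
    · change g⁻¹ * h * g⁻¹⁻¹ ∈ K ⊔ Z
      rw [inv_inv]
      exact (le_sup_left : K ≤ K ⊔ Z) (hg h hh)
    · change g⁻¹ * z * g⁻¹⁻¹ ∈ K ⊔ Z
      rw [inv_inv, Subgroup.mem_center_iff.mp (hZ hz) g⁻¹, inv_mul_cancel_right]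
      exact (le_sup_right : Z ≤ K ⊔ Z) hz
  intro h hh
  have : g⁻¹ * h * g⁻¹⁻¹ ∈ K ⊔ Z := h1 hh
  rwa [inv_inv] at this

theorem centralizer_sup_center {H Z : Subgroup P} (hZ : Z ≤ Subgroup.center P) :
    Subgroup.centralizer (H : Set P) ≤ Subgroup.centralizer ((H ⊔ Z : Subgroup P) : Set P) := by
  rw [Subgroup.le_centralizer_iff]
  refine sup_le ?_ (hZ.trans fun z hz => Subgroup.mem_centralizer_iff.mpr fun g _ =>
    Subgroup.mem_center_iff.mp hz g)
  rw [← Subgroup.le_centralizer_iff]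

/-- Multiplication by a central subgroup contained in the Frattini subgroup, as an endofunctor of
`F̃_P^{(1,P)}`. -/
def exteriorSup [Finite P] {Z : Subgroup P} (hZ : Z ≤ Subgroup.center P) (hZΦ : Z ≤ frattini P) :
    ExteriorOpen P ⥤ ExteriorOpen P where
  obj H := ⟨⟨H.obj.toSubgroup ⊔ Z⟩, lt_of_lt_of_le H.property.1 le_sup_left,
    sup_lt_top_of_le_frattini H.property.2 hZΦ⟩
  map f := exteriorMk (exteriorRep f) (transporter_sup_center hZ (exteriorRep_mem f))
  map_id H := by
    obtain ⟨c, hc, k, hk, h⟩ := exists_exteriorRep_id H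
    exact exteriorMk_eq_id (centralizer_sup_center hZ hc)
      (le_sup_left (a := H.obj.toSubgroup) hk) h
  map_comp {H K L} f g := by
    obtain ⟨c, hc, k, hk, h⟩ := exists_exteriorRep_comp f g
    exact exteriorMk_eq_comp (centralizer_sup_center hZ hc)
      (le_sup_left (a := L.obj.toSubgroup) hk) h

/-- Morphisms out of a central subgroup `Z` are unique in `F̃_P`, so that the inclusions
`Z ≤ HZ ≥ H` are natural in `H`. -/
theorem isContractible_exteriorOpen_of_le_frattini [Finite P] {Z : Subgroup P} (hZ : Z ≠ ⊥)
    (hZc : Z ≤ Subgroup.center P) (hZΦ : Z ≤ frattini P) (hZtop : Z < ⊤) :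
    IsContractible (ExteriorOpen P) := by
  have hle : ∀ {H K : Subgroup P}, H ≤ K → (1 : P) ∈ transporter H K := fun h x hx => by
    simpa using h hx
  refine isContractible_of_natTrans (T := exteriorSup hZc hZΦ)
    (⟨⟨Z⟩, bot_lt_iff_ne_bot.mpr hZ, hZtop⟩ : ExteriorOpen P)
    { app := fun H => exteriorMk 1 (hle le_sup_left)
      naturality := fun H K f => ?_ }
    { app := fun H => exteriorMk 1 (hle le_sup_right)
      naturality := fun H K f => ?_ }
  · have h1 : f = exteriorMk (exteriorRep f) (exteriorRep_mem f) := (exteriorMk_exteriorRep f).symm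
    refine (congrArg (· ≫ (exteriorMk 1 (hle le_sup_left) : K ⟶ (exteriorSup hZc hZΦ).obj K))
      h1).trans ?_
    exact exteriorMk_eq_comp (Subgroup.one_mem _) (Subgroup.one_mem _) (by group)
  · refine (Category.id_comp _).trans ?_
    refine exteriorMk_eq_comp (c := exteriorRep f)
      (Subgroup.mem_centralizer_iff.mpr fun z hz => ?_) (Subgroup.one_mem _) (by group)
    exact (Subgroup.mem_center_iff.mp (hZc hz) _).symm

/-- For abelian `P`, the category `F̃_P^{(1,P)}` is the poset of nonidentity proper subgroups. -/
theorem isContractible_exteriorOpen_iff_of_comm (hcomm : ∀ x y : P, x * y = y * x) :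
    IsContractible (ExteriorOpen P) ↔ IsContractible (PosetOpen P) := by
  have hsub : ∀ H K : ExteriorOpen P, ∀ f g : H ⟶ K, f = g := by
    intro H K f g
    obtain ⟨x, hx, rfl⟩ := exists_exteriorMk f
    obtain ⟨y, hy, rfl⟩ := exists_exteriorMk g
    rw [exteriorMk_eq_iff]
    exact ⟨y * x⁻¹, Subgroup.mem_centralizer_iff.mpr fun h _ => hcomm _ _, 1,
      Subgroup.one_mem _, by group⟩
  have hle : ∀ {H K : Subgroup P}, H ≤ K → (1 : P) ∈ transporter H K := fun h x hx => by
    simpa using h hx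
  have hge : ∀ {H K : ExteriorOpen P}, (H ⟶ K) → H.obj.toSubgroup ≤ K.obj.toSubgroup := by
    intro H K f x hx
    have := exteriorRep_mem f x hx
    rwa [mul_assoc, hcomm x, inv_mul_cancel_left] at this
  let F : ExteriorOpen P ⥤ PosetOpen P :=
    { obj := fun H => ⟨H.obj.toSubgroup, H.property⟩
      map := fun f => homOfLE (hge f)
      map_id := fun _ => Subsingleton.elim _ _
      map_comp := fun _ _ => Subsingleton.elim _ _ }
  let G : PosetOpen P ⥤ ExteriorOpen P :=
    { obj := fun H => ⟨⟨H.1⟩, H.2⟩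
      map := fun f => exteriorMk 1 (hle (leOfHom f))
      map_id := fun _ => hsub _ _ _ _
      map_comp := fun _ _ => hsub _ _ _ _ }
  exact (isHomotopyEquivalence_of_natTrans (F := F) (G := G)
    { app := fun H => 𝟙 H, naturality := fun _ _ _ => hsub _ _ _ _ }
    { app := fun H => 𝟙 H, naturality := fun _ _ _ => Subsingleton.elim _ _ }).isContractible_iff

end Exterior

/-! ### Passage to the Frattini quotient in the orbit category -/

section Orbit

variable {P : Type u} [Group P] {H K L : OrbitProper P}

/-- The morphism of `O_P^{[1,P)}` which is the class of `g`. -/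
def orbitMk (g : P) (hg : g ∈ transporter H.obj.toSubgroup K.obj.toSubgroup) : H ⟶ K :=
  ObjectProperty.homMk
    (Quotient.mk _ ⟨g, hg⟩ : OrbitHom H.obj.toSubgroup K.obj.toSubgroup)

theorem exists_orbitMk (f : H ⟶ K) : ∃ g, ∃ hg, f = orbitMk g hg := by
  obtain ⟨⟨⟨g, hg⟩⟩⟩ := f
  exact ⟨g, hg, rfl⟩

theorem orbitMk_eq_iff {x y : P}
    {hx : x ∈ transporter H.obj.toSubgroup K.obj.toSubgroup}
    {hy : y ∈ transporter H.obj.toSubgroup K.obj.toSubgroup} :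
    (orbitMk x hx : H ⟶ K) = orbitMk y hy ↔ x⁻¹ * y ∈ K.obj.toSubgroup := by
  have h1 : (orbitMk x hx : H ⟶ K) = orbitMk y hy ↔
      (Quotient.mk _ ⟨x, hx⟩ : OrbitHom H.obj.toSubgroup K.obj.toSubgroup) =
        Quotient.mk _ ⟨y, hy⟩ :=
    ⟨fun h => congrArg InducedCategory.Hom.hom h, fun h => ObjectProperty.hom_ext _ h⟩
  rw [h1, Quotient.eq]
  exact QuotientGroup.leftRel_apply

/-- A representative of a morphism of `O_P^{[1,P)}`. -/
def orbitRep (f : H ⟶ K) : P := (exists_orbitMk f).choose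

theorem orbitRep_mem (f : H ⟶ K) :
    orbitRep f ∈ transporter H.obj.toSubgroup K.obj.toSubgroup :=
  (exists_orbitMk f).choose_spec.choose

theorem orbitMk_orbitRep (f : H ⟶ K) : orbitMk (orbitRep f) (orbitRep_mem f) = f :=
  (exists_orbitMk f).choose_spec.choose_spec.symm

theorem orbitMk_eq_id {x : P} {hx : x ∈ transporter H.obj.toSubgroup H.obj.toSubgroup}
    (h : x ∈ H.obj.toSubgroup) : (orbitMk x hx : H ⟶ H) = 𝟙 H :=
  orbitMk_eq_iff.mpr (by simpa using h)

theorem orbitMk_eq_comp {x y z : P}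
    {hx : x ∈ transporter H.obj.toSubgroup K.obj.toSubgroup}
    {hy : y ∈ transporter K.obj.toSubgroup L.obj.toSubgroup}
    {hz : z ∈ transporter H.obj.toSubgroup L.obj.toSubgroup}
    (h : z⁻¹ * (x * y) ∈ L.obj.toSubgroup) :
    (orbitMk z hz : H ⟶ L) = (orbitMk x hx : H ⟶ K) ≫ (orbitMk y hy : K ⟶ L) :=
  orbitMk_eq_iff.mpr h

theorem orbitRep_id (H : OrbitProper P) : orbitRep (𝟙 H) ∈ H.obj.toSubgroup := by
  have h : (orbitRep (𝟙 H))⁻¹ * 1 ∈ H.obj.toSubgroup :=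
    orbitMk_eq_iff.mp (orbitMk_orbitRep (𝟙 H))
  rwa [mul_one, inv_mem_iff] at h

theorem orbitRep_comp (f : H ⟶ K) (g : K ⟶ L) :
    (orbitRep (f ≫ g))⁻¹ * (orbitRep f * orbitRep g) ∈ L.obj.toSubgroup := by
  have h := orbitMk_orbitRep (f ≫ g)
  conv_rhs at h => rw [← orbitMk_orbitRep f, ← orbitMk_orbitRep g]
  exact orbitMk_eq_iff.mp h

theorem orbitRep_orbitMk {g : P} (hg : g ∈ transporter H.obj.toSubgroup K.obj.toSubgroup) :
    g⁻¹ * (orbitRep (orbitMk g hg : H ⟶ K)) ∈ K.obj.toSubgroup :=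
  orbitMk_eq_iff.mp (orbitMk_orbitRep (orbitMk g hg : H ⟶ K)).symm

theorem orbit_comp_eq_comp {H' K' : OrbitProper P} {f : H ⟶ K} {g : H' ⟶ K'} {x y : P}
    {hx : x ∈ transporter K.obj.toSubgroup K'.obj.toSubgroup}
    {hy : y ∈ transporter H.obj.toSubgroup H'.obj.toSubgroup}
    (h : (orbitRep f * x)⁻¹ * (y * orbitRep g) ∈ K'.obj.toSubgroup) :
    f ≫ (orbitMk x hx : K ⟶ K') = (orbitMk y hy : H ⟶ H') ≫ g := by
  rw [← orbitMk_orbitRep f, ← orbitMk_orbitRep g]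
  exact orbitMk_eq_iff.mpr h

/-- The functor `H ↦ HΦ / Φ` from `O_P^{[1,P)}` to `O_{P/Φ}^{[1,P/Φ)}`. -/
def orbitFrattini (P : Type u) [Group P] [Finite P] :
    OrbitProper P ⥤ OrbitProper (P ⧸ frattini P) where
  obj H := ⟨⟨H.obj.toSubgroup.map (QuotientGroup.mk' (frattini P))⟩, bot_le, by
    have h := sup_lt_top_of_le_frattini H.property.2 (le_refl (frattini P))
    refine lt_top_iff_ne_top.mpr fun htop => h.ne ?_
    have := congrArg (Subgroup.comap (QuotientGroup.mk' (frattini P))) htop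
    rwa [Subgroup.comap_map_eq, QuotientGroup.ker_mk', Subgroup.comap_top] at this⟩
  map {H K} f := orbitMk (QuotientGroup.mk' (frattini P) (orbitRep f)) (by
    rintro _ ⟨h, hh, rfl⟩
    exact ⟨_, orbitRep_mem f h hh, by simp⟩)
  map_id H := by
    exact orbitMk_eq_id ⟨_, orbitRep_id H, rfl⟩
  map_comp f g := by
    refine orbitMk_eq_comp ?_
    rw [← map_mul, ← map_inv, ← map_mul]
    exact ⟨_, orbitRep_comp f g, rfl⟩

/-- The functor from `O_{P/Φ}^{[1,P/Φ)}` to `O_P^{[1,P)}` which takes preimages. -/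
def orbitPreimage (P : Type u) [Group P] :
    OrbitProper (P ⧸ frattini P) ⥤ OrbitProper P where
  obj H := ⟨⟨H.obj.toSubgroup.comap (QuotientGroup.mk' (frattini P))⟩, bot_le, by
    refine lt_top_iff_ne_top.mpr fun htop => H.property.2.ne ?_
    rw [← Subgroup.comap_top (QuotientGroup.mk' (frattini P))] at htop
    exact Subgroup.comap_injective (QuotientGroup.mk'_surjective _) htop⟩
  map {H K} f := orbitMk (orbitRep f).out (by
    intro h hh
    rw [Subgroup.mem_comap] at hh ⊢
    simpa using orbitRep_mem f _ hh)
  map_id H := by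
    refine orbitMk_eq_id (Subgroup.mem_comap.mpr ?_)
    simpa using orbitRep_id H
  map_comp f g := by
    refine orbitMk_eq_comp (Subgroup.mem_comap.mpr ?_)
    simpa using orbitRep_comp f g

theorem orbitRep_orbitFrattini [Finite P] (f : H ⟶ K) :
    (QuotientGroup.mk' (frattini P) (orbitRep f))⁻¹ * orbitRep ((orbitFrattini P).map f) ∈
      ((orbitFrattini P).obj K).obj.toSubgroup :=
  orbitRep_orbitMk _

theorem orbitRep_orbitPreimage {H K : OrbitProper (P ⧸ frattini P)} (f : H ⟶ K) :
    (orbitRep f)⁻¹ * QuotientGroup.mk' (frattini P) (orbitRep ((orbitPreimage P).map f)) ∈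
      K.obj.toSubgroup := by
  have h : (orbitRep f).out⁻¹ * orbitRep ((orbitPreimage P).map f) ∈
      ((orbitPreimage P).obj K).obj.toSubgroup := orbitRep_orbitMk _
  have h' : QuotientGroup.mk' (frattini P)
      ((orbitRep f).out⁻¹ * orbitRep ((orbitPreimage P).map f)) ∈ K.obj.toSubgroup := h
  rw [map_mul, map_inv] at h'
  have hout : QuotientGroup.mk' (frattini P) (orbitRep f).out = orbitRep f :=
    QuotientGroup.out_eq' _
  rwa [hout] at h'

/-- Taking preimages is right adjoint to `H ↦ HΦ / Φ`. -/
theorem homotopyEquivalent_orbitProper (P : Type u) [Group P] [Finite P] :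
    HomotopyEquivalent (OrbitProper P) (OrbitProper (P ⧸ frattini P)) := by
  refine ⟨orbitFrattini P, isHomotopyEquivalence_of_natTrans (G := orbitPreimage P)
    { app := fun H => orbitMk 1 fun h hh => ?_, naturality := fun H K f => orbit_comp_eq_comp ?_ }
    { app := fun H => orbitMk 1 fun h hh => ?_, naturality := fun H K f => orbit_comp_eq_comp ?_ }⟩
  · rw [inv_one, one_mul, mul_one]
    exact Subgroup.le_comap_map (QuotientGroup.mk' (frattini P)) H.obj.toSubgroup hh
  · have h1 := orbitRep_orbitFrattini f
    have h2 := orbitRep_orbitPreimage ((orbitFrattini P).map f)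
    have h3 := Subgroup.mul_mem _ h1 h2
    rw [mul_assoc, mul_inv_cancel_left] at h3
    change QuotientGroup.mk' (frattini P) _ ∈ ((orbitFrattini P).obj K).obj.toSubgroup
    rw [mul_one, one_mul, map_mul, map_inv]
    exact h3
  · rw [inv_one, one_mul, mul_one]
    exact Subgroup.map_comap_le (QuotientGroup.mk' (frattini P)) H.obj.toSubgroup hh
  · have h1 := Subgroup.map_comap_le (QuotientGroup.mk' (frattini P)) K.obj.toSubgroup
      (orbitRep_orbitFrattini ((orbitPreimage P).map f))
    have h2 := orbitRep_orbitPreimage f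
    have h3 := Subgroup.inv_mem _ (Subgroup.mul_mem _ h2 h1)
    rw [mul_assoc, mul_inv_cancel_left, mul_inv_rev, inv_inv] at h3
    rw [mul_one, one_mul]
    exact h3

end Orbit

/-! ### Existence of weightings and coweightings -/

section Weighting

/-- A matrix which is block triangular for `r`, and in which two indices of a diagonal block with
nonzero entry have the same rows and the same columns, has a weighting and a coweighting: the
matrix with one index from each class of equal rows and columns is invertible. -/
theorem exists_mulVec_eq_one {ι : Type u} [Fintype ι] (M : Matrix ι ι ℚ) (r : ι → ℕ)
    (hdiag : ∀ a, M a a ≠ 0) (hr : ∀ a b, M a b ≠ 0 → r a ≤ r b)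
    (hM : ∀ a b, M a b ≠ 0 → r a = r b → ∀ c, M a c = M b c ∧ M c a = M c b) :
    (∃ k : ι → ℚ, ∀ a, ∑ b, M a b * k b = 1) ∧ ∃ k : ι → ℚ, ∀ b, ∑ a, k a * M a b = 1 := by
  classical
  let s : Setoid ι :=
    { r := fun a b => ∀ c, M a c = M b c ∧ M c a = M c b
      iseqv := ⟨fun _ _ => ⟨rfl, rfl⟩, fun h c => ⟨(h c).1.symm, (h c).2.symm⟩,
        fun h h' c => ⟨(h c).1.trans (h' c).1, (h c).2.trans (h' c).2⟩⟩ }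
  let N : Matrix (Quotient s) (Quotient s) ℚ := fun x y => M x.out y.out
  have hout : ∀ a c, M (⟦a⟧ : Quotient s).out c = M a c ∧ M c (⟦a⟧ : Quotient s).out = M c a :=
    fun a => Quotient.mk_out (s := s) a
  have htri : N.BlockTriangular fun x => r x.out := fun x y hxy => by
    by_contra h
    exact absurd (hr _ _ h) (not_le.mpr hxy)
  have hdet : IsUnit N.det := by
    rw [htri.det, isUnit_iff_ne_zero, Finset.prod_ne_zero_iff]
    intro i _
    have hd : N.toSquareBlock (fun x => r x.out) i =
        Matrix.diagonal fun x => N x.1 x.1 := by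
      ext x y
      rcases eq_or_ne x y with rfl | hxy
      · simp [Matrix.toSquareBlock_def]
      · rw [Matrix.diagonal_apply_ne _ hxy, Matrix.toSquareBlock_def]
        by_contra h
        refine hxy (Subtype.ext ?_)
        rw [← x.1.out_eq, ← y.1.out_eq]
        exact Quotient.sound (s := s) (hM _ _ h (x.2.trans y.2.symm))
    rw [hd, Matrix.det_diagonal, Finset.prod_ne_zero_iff]
    exact fun x _ => hdiag _
  have hinv := Matrix.mul_nonsing_inv N hdet
  have hinv' := Matrix.nonsing_inv_mul N hdet
  refine ⟨⟨fun b => ∑ y : Quotient s, if y.out = b then N⁻¹.mulVec 1 y else 0, fun a => ?_⟩,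
    ⟨fun a => ∑ x : Quotient s, if x.out = a then Matrix.vecMul 1 N⁻¹ x else 0, fun b => ?_⟩⟩
  · have h : N.mulVec (N⁻¹.mulVec 1) = 1 := by
      rw [Matrix.mulVec_mulVec, hinv, Matrix.one_mulVec]
    have h1 := congrFun h ⟦a⟧
    rw [Matrix.mulVec, dotProduct] at h1
    simp only [Finset.mul_sum, mul_ite, mul_zero]
    rw [Finset.sum_comm]
    simp only [Finset.sum_ite_eq, Finset.mem_univ, if_true]
    refine Eq.trans (Finset.sum_congr rfl fun y _ => ?_) h1
    rw [← (hout a y.out).1]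
  · have h : Matrix.vecMul (Matrix.vecMul 1 N⁻¹) N = 1 := by
      rw [Matrix.vecMul_vecMul, hinv', Matrix.vecMul_one]
    have h1 := congrFun h ⟦b⟧
    rw [Matrix.vecMul, dotProduct] at h1
    simp only [Finset.sum_mul, ite_mul, zero_mul]
    rw [Finset.sum_comm]
    simp only [Finset.sum_ite_eq, Finset.mem_univ, if_true]
    refine Eq.trans (Finset.sum_congr rfl fun x _ => ?_) h1
    rw [← (hout b x.out).2]

variable {C : Type u} [Category.{v} C] [Finite C] [∀ a b : C, Finite (a ⟶ b)]

/-- A finite category in which a morphism between objects of the same rank forces an isomorphism,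
and morphisms do not decrease the rank, has a weighting and a coweighting. -/
theorem exists_isWeighting_and_isCoweighting (r : C → ℕ)
    (hr : ∀ {a b : C}, (a ⟶ b) → r a ≤ r b)
    (hiso : ∀ {a b : C}, (a ⟶ b) → r a = r b → Nonempty (a ≅ b)) :
    (∃ k, IsWeighting C k) ∧ ∃ k, IsCoweighting C k := by
  have : Fintype C := Fintype.ofFinite C
  have hne : ∀ a b : C, (Nat.card (a ⟶ b) : ℚ) ≠ 0 → Nonempty (a ⟶ b) := fun a b h => by
    by_contra h'
    rw [not_nonempty_iff] at h'
    exact h (by simp)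
  simp only [IsWeighting, IsCoweighting, finsum_eq_sum_of_fintype]
  refine exists_mulVec_eq_one (fun a b : C => (Nat.card (a ⟶ b) : ℚ)) r (fun a => ?_)
    (fun a b h => ?_) fun a b h hab c => ?_
  · have : Nonempty (a ⟶ a) := ⟨𝟙 a⟩
    exact_mod_cast Nat.card_pos.ne'
  · exact hr (hne a b h).some
  · obtain ⟨e⟩ := hiso (hne a b h).some hab
    exact ⟨congrArg _ (Nat.card_congr (e.homCongr (Iso.refl c))),
      congrArg _ (Nat.card_congr ((Iso.refl c).homCongr e))⟩

theorem IsWeighting.hasEulerChar {k : C → ℚ} (hk : IsWeighting C k) (r : C → ℕ)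
    (hr : ∀ {a b : C}, (a ⟶ b) → r a ≤ r b)
    (hiso : ∀ {a b : C}, (a ⟶ b) → r a = r b → Nonempty (a ≅ b)) :
    HasEulerChar C (∑ᶠ a, k a) := by
  obtain ⟨l, hl⟩ := (exists_isWeighting_and_isCoweighting r hr hiso).2
  exact ⟨inferInstance, inferInstance, ⟨k, hk, rfl⟩, l, hl, (hk.sum_eq hl).symm⟩

theorem IsCoweighting.hasEulerChar {l : C → ℚ} (hl : IsCoweighting C l) (r : C → ℕ)
    (hr : ∀ {a b : C}, (a ⟶ b) → r a ≤ r b)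
    (hiso : ∀ {a b : C}, (a ⟶ b) → r a = r b → Nonempty (a ≅ b)) :
    HasEulerChar C (∑ᶠ a, l a) := by
  obtain ⟨k, hk⟩ := (exists_isWeighting_and_isCoweighting r hr hiso).1
  exact ⟨inferInstance, inferInstance, ⟨k, hk, hk.sum_eq hl⟩, l, hl, rfl⟩

end Weighting

/-! ### Sums over the Möbius function -/

section Moebius

variable {P : Type u} [Group P] [Finite P]

open Classical in
/-- The Möbius function of the lattice of subgroups of `P`. -/
def moebius (H K : Subgroup P) : ℚ :=
  letI : Fintype (Subgroup P) := Fintype.ofFinite _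
  letI : LocallyFiniteOrder (Subgroup P) := Fintype.toLocallyFiniteOrder
  (IncidenceAlgebra.mu ℤ H K : ℤ)

theorem moebius_bot_top : moebius (⊥ : Subgroup P) ⊤ = subgroupMoebius P := rfl

theorem moebius_self (H : Subgroup P) : moebius H H = 1 := by
  classical
  let _ : Fintype (Subgroup P) := Fintype.ofFinite _
  let _ : LocallyFiniteOrder (Subgroup P) := Fintype.toLocallyFiniteOrder
  exact (congrArg _ (IncidenceAlgebra.mu_self (𝕜 := ℤ) H)).trans Int.cast_one

open Classical in
theorem finsum_mem_moebius_bot (L : Subgroup P) :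
    ∑ᶠ H ∈ Set.Iic L, moebius ⊥ H = if L = ⊥ then 1 else 0 := by
  let _ : Fintype (Subgroup P) := Fintype.ofFinite _
  let _ : LocallyFiniteOrder (Subgroup P) := Fintype.toLocallyFiniteOrder
  have h := IncidenceAlgebra.sum_Icc_mu_right (𝕜 := ℤ) (⊥ : Subgroup P) L
  have h1 : Set.Iic L = ((Finset.Icc ⊥ L : Finset (Subgroup P)) : Set (Subgroup P)) := by
    ext; simp
  rw [h1, finsum_mem_coe_finset]
  simp only [moebius]
  rw [← Int.cast_sum, h]
  by_cases hL : L = ⊥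
  · rw [if_pos hL, if_pos hL.symm, Int.cast_one]
  · rw [if_neg hL, if_neg (Ne.symm hL), Int.cast_zero]

open Classical in
theorem finsum_mem_moebius_top (L : Subgroup P) :
    ∑ᶠ H ∈ Set.Ici L, moebius H ⊤ = if L = ⊤ then 1 else 0 := by
  let _ : Fintype (Subgroup P) := Fintype.ofFinite _
  let _ : LocallyFiniteOrder (Subgroup P) := Fintype.toLocallyFiniteOrder
  have h := IncidenceAlgebra.sum_Icc_mu_left (𝕜 := ℤ) L (⊤ : Subgroup P)
  have h1 : Set.Ici L = ((Finset.Icc L ⊤ : Finset (Subgroup P)) : Set (Subgroup P)) := by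
    ext; simp
  rw [h1, finsum_mem_coe_finset]
  simp only [moebius]
  rw [← Int.cast_sum, h]
  by_cases hL : L = ⊤
  · rw [if_pos hL, if_pos hL, Int.cast_one]
  · rw [if_neg hL, if_neg hL, Int.cast_zero]

/-- Double counting of the pairs `(a, x)` with `R a x`. -/
theorem finsum_mul_card {ι : Type v} [Finite ι] {X : Type w} [Finite X] (f : ι → ℚ)
    (R : ι → X → Prop) :
    ∑ᶠ a, f a * (Nat.card {x // R a x} : ℚ) = ∑ᶠ x, ∑ᶠ a ∈ {a | R a x}, f a := by
  classical
  have : Fintype ι := Fintype.ofFinite ι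
  have : Fintype X := Fintype.ofFinite X
  simp only [finsum_eq_sum_of_fintype, Set.mem_ofPred_eq, finsum_eq_if]
  rw [Finset.sum_comm]
  refine Finset.sum_congr rfl fun a _ => ?_
  rw [Nat.card_eq_fintype_card, Fintype.card_subtype, ← Finset.sum_boole, Finset.mul_sum]
  exact Finset.sum_congr rfl fun x _ => by simp

/-- The double count of the pairs `(H, x)` with `H ≤ S x`, weighted by `μ(1, H)`: only `x` with
`S x = 1` contribute, and there are none. The terms of `H = 1` and `H = P` are moved to the right.
-/
theorem finsum_moebius_bot_mul_card {X : Type w} [Finite X] [Nontrivial P] (S : X → Subgroup P)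
    (hS : ∀ x, S x ≠ ⊥) :
    ∑ᶠ H : Set.Ioo (⊥ : Subgroup P) ⊤, moebius ⊥ H.1 * (Nat.card {x // H.1 ≤ S x} : ℚ) =
      -(Nat.card X : ℚ) - moebius (⊥ : Subgroup P) ⊤ * (Nat.card {x // S x = ⊤} : ℚ) := by
  have h0 : ∑ᶠ H : Subgroup P, moebius ⊥ H * (Nat.card {x // H ≤ S x} : ℚ) = 0 := by
    rw [finsum_mul_card]
    refine finsum_eq_zero_of_forall_eq_zero fun x => ?_
    have h := finsum_mem_moebius_bot (S x)
    rw [if_neg (hS x)] at h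
    exact h
  have huniv : (Set.univ : Set (Subgroup P)) = insert ⊥ (insert ⊤ (Set.Ioo ⊥ ⊤)) := by
    ext H
    rcases eq_bot_or_bot_lt H with h | h <;> rcases eq_top_or_lt_top H with h' | h' <;> simp_all
  rw [← finsum_mem_univ, huniv, finsum_mem_insert _ (by simp) (Set.toFinite _),
    finsum_mem_insert _ (by simp) (Set.toFinite _), moebius_self] at h0
  rw [finsum_set_coe_eq_finsum_mem (Set.Ioo (⊥ : Subgroup P) ⊤)
    (f := fun H => moebius ⊥ H * (Nat.card {x // H ≤ S x} : ℚ))]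
  simp only [bot_le, top_le_iff, Nat.card_congr (Equiv.subtypeUnivEquiv fun _ : X => trivial)]
    at h0
  linarith

/-- The double count of the pairs `(H, x)` with `S x ≤ H`, weighted by `μ(H, P)`: only `x` with
`S x = P` contribute. The term of `H = P` is moved to the right. -/
theorem finsum_moebius_top_mul_card {X : Type w} [Finite X] (S : X → Subgroup P) :
    ∑ᶠ H : Set.Ico (⊥ : Subgroup P) ⊤, moebius H.1 ⊤ * (Nat.card {x // S x ≤ H.1} : ℚ) =
      (Nat.card {x // S x = ⊤} : ℚ) - (Nat.card X : ℚ) := by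
  have h0 : ∑ᶠ H : Subgroup P, moebius H ⊤ * (Nat.card {x // S x ≤ H} : ℚ) =
      (Nat.card {x // S x = ⊤} : ℚ) := by
    rw [finsum_mul_card]
    have h : ∀ x, ∑ᶠ H ∈ {H | S x ≤ H}, moebius H ⊤ = _ := fun x => finsum_mem_moebius_top (S x)
    simp only [h]
    classical
    have : Fintype X := Fintype.ofFinite X
    rw [finsum_eq_sum_of_fintype, Finset.sum_boole, Nat.card_eq_fintype_card,
      Fintype.card_subtype]
  have huniv : (Set.univ : Set (Subgroup P)) = insert ⊤ (Set.Ico ⊥ ⊤) := by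
    ext H
    rcases eq_top_or_lt_top H with h' | h' <;> simp_all
  rw [← finsum_mem_univ, huniv, finsum_mem_insert _ (by simp) (Set.toFinite _),
    moebius_self] at h0
  rw [finsum_set_coe_eq_finsum_mem (Set.Ico (⊥ : Subgroup P) ⊤)
    (f := fun H => moebius H ⊤ * (Nat.card {x // S x ≤ H} : ℚ))]
  simp only [le_top, Nat.card_congr (Equiv.subtypeUnivEquiv fun _ : X => trivial)] at h0
  linarith

end Moebius

/-! ### Counting double cosets -/

section Count

variable {P : Type u} [Group P]

theorem mem_transporter_iff {H K : Subgroup P} {g : P} :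
    g ∈ transporter H K ↔ H ≤ K.comap (MulAut.conj g⁻¹).toMonoidHom := by
  have h : ∀ x, (MulAut.conj g⁻¹).toMonoidHom x = g⁻¹ * x * g := fun x => by simp
  simp only [SetLike.le_def, Subgroup.mem_comap, h]
  rfl

/-- The orbit counting theorem for the action of `A × B` on a union of double cosets of `A` and
`B`: the elements fixed by `(a, b)` are the `x` with `a = x b x⁻¹`. -/
theorem card_doubleCoset (A B : Subgroup P) (N : Set P)
    (hN : ∀ a ∈ A, ∀ x ∈ N, ∀ b ∈ B, a * x * b ∈ N) :
    Nat.card (Quotient ((DoubleCoset.setoid (A : Set P) (B : Set P)).comap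
        (Subtype.val : N → P))) * (Nat.card A * Nat.card B) =
      Nat.card {y : P × B // y.1 ∈ N ∧ y.1 * y.2 * y.1⁻¹ ∈ A} := by
  let _ : MulAction (A × B) N :=
    { smul := fun y x => ⟨y.1 * x * (y.2 : P)⁻¹, hN _ y.1.2 _ x.2 _ (B.inv_mem y.2.2)⟩
      one_smul := fun x => Subtype.ext (by change (1 : P) * x * (1 : P)⁻¹ = x; group)
      mul_smul := fun y z x => Subtype.ext (by
        change (y.1 * z.1 : P) * x * (y.2 * z.2 : P)⁻¹ = y.1 * (z.1 * x * (z.2 : P)⁻¹) * (y.2 : P)⁻¹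
        group) }
  have hsmul : ∀ (y : A × B) (x : N), ((y • x : N) : P) = y.1 * x * (y.2 : P)⁻¹ := fun _ _ => rfl
  have hrel : (DoubleCoset.setoid (A : Set P) (B : Set P)).comap (Subtype.val : N → P) =
      MulAction.orbitRel (A × B) N := by
    ext x y
    rw [MulAction.orbitRel_apply, MulAction.mem_orbit_iff, Setoid.comap_rel, DoubleCoset.rel_iff]
    constructor
    · rintro ⟨a, ha, b, hb, h⟩
      refine ⟨(⟨a⁻¹, A.inv_mem ha⟩, ⟨b, hb⟩), Subtype.ext ?_⟩
      rw [hsmul, h]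
      group
    · rintro ⟨⟨a, b⟩, rfl⟩
      exact ⟨a⁻¹, A.inv_mem a.2, b, b.2, by rw [hsmul]; group⟩
  rw [hrel, ← Nat.card_prod, ← Nat.card_prod,
    ← Nat.card_congr (MulAction.sigmaFixedByEquivOrbitsProdGroup (A × B) N)]
  have hfix : ∀ (y : A × B) (x : N), x ∈ MulAction.fixedBy N y ↔
      (y.1 : P) = x * y.2 * (x : P)⁻¹ := by
    intro y x
    rw [MulAction.mem_fixedBy, Subtype.ext_iff, hsmul, mul_inv_eq_iff_eq_mul, eq_mul_inv_iff_mul_eq]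
  refine Nat.card_congr
    { toFun := fun z => ⟨(z.2.1, z.1.2), z.2.1.2, by
        have := (hfix _ _).mp z.2.2
        rw [← this]
        exact z.1.1.2⟩
      invFun := fun z => ⟨(⟨_, z.2.2⟩, z.1.2), ⟨⟨z.1.1, z.2.1⟩, (hfix _ _).mpr rfl⟩⟩
      left_inv := ?_
      right_inv := fun z => rfl }
  rintro ⟨⟨⟨a, ha⟩, b⟩, ⟨x, hx⟩⟩
  obtain rfl : a = x * b * (x : P)⁻¹ := (hfix _ _).mp hx
  rfl

end Count

/-! ### Morphism sets -/

section HomSets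

variable {P : Type u} [Group P]

/-- The class of `x` counts the `k ∈ K` with `x k x⁻¹ ∈ C_P(H)`, i.e. with `x⁻¹ H x ≤ C_K(k)`. -/
theorem card_exteriorHom (H K : Subgroup P) :
    Nat.card (ExteriorHom H K) * (Nat.card (Subgroup.centralizer (H : Set P)) * Nat.card K) =
      Nat.card {y : P × K // H ≤ (K ⊓ Subgroup.centralizer {(y.2 : P)}).comap
        (MulAut.conj y.1⁻¹).toMonoidHom} := by
  refine (card_doubleCoset (Subgroup.centralizer (H : Set P)) K (transporter H K)
    fun a ha x hx b hb h hh => ?_).trans (Nat.card_congr (Equiv.subtypeEquivRight fun y => ?_))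
  · have h1 : h * a = a * h := Subgroup.mem_centralizer_iff.mp ha h hh
    have h2 : (a * x * b)⁻¹ * h * (a * x * b) = b⁻¹ * (x⁻¹ * h * x) * b := by
      calc (a * x * b)⁻¹ * h * (a * x * b) = b⁻¹ * x⁻¹ * a⁻¹ * (h * a) * x * b := by group
        _ = b⁻¹ * (x⁻¹ * h * x) * b := by rw [h1]; group
    rw [h2]
    exact K.mul_mem (K.mul_mem (K.inv_mem hb) (hx h hh)) hb
  · rw [← mem_transporter_iff]
    obtain ⟨x, k⟩ := y
    have h1 : ∀ h : P, h * (x * k * x⁻¹) = x * k * x⁻¹ * h ↔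
        k * (x⁻¹ * h * x) = x⁻¹ * h * x * (k : P) := fun h => by
      rw [← mul_left_cancel_iff (a := x⁻¹), ← mul_right_cancel_iff (a := x), eq_comm]
      have e1 : x⁻¹ * (h * (x * k * x⁻¹)) * x = x⁻¹ * h * x * (k : P) := by group
      have e2 : x⁻¹ * (x * k * x⁻¹ * h) * x = k * (x⁻¹ * h * x) := by group
      rw [e1, e2]
    constructor
    · rintro ⟨hx, hc⟩ h hh
      exact ⟨hx h hh, Subgroup.mem_centralizer_singleton_iff.mpr
        ((h1 h).mp (Subgroup.mem_centralizer_iff.mp hc h hh)).symm⟩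
    · exact fun hx => ⟨fun h hh => (hx h hh).1, Subgroup.mem_centralizer_iff.mpr fun h hh =>
        (h1 h).mpr (Subgroup.mem_centralizer_singleton_iff.mp (hx h hh).2).symm⟩

theorem card_fusionHom (H K : Subgroup P) :
    Nat.card (FusionHom H K) * Nat.card (Subgroup.centralizer (H : Set P)) =
      Nat.card {x : P // H ≤ K.comap (MulAut.conj x⁻¹).toMonoidHom} := by
  have h := card_doubleCoset (Subgroup.centralizer (H : Set P)) ⊥ (transporter H K)
    fun a ha x hx b hb h hh => by
      have h1 : h * a = a * h := Subgroup.mem_centralizer_iff.mp ha h hh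
      have h2 : (a * x)⁻¹ * h * (a * x) = x⁻¹ * h * x := by
        calc (a * x)⁻¹ * h * (a * x) = x⁻¹ * a⁻¹ * (h * a) * x := by group
          _ = x⁻¹ * h * x := by rw [h1]; group
      rw [Subgroup.mem_bot.mp hb, mul_one, h2]
      exact hx h hh
  have hs : DoubleCoset.setoid (Subgroup.centralizer (H : Set P) : Set P)
      ((⊥ : Subgroup P) : Set P) = QuotientGroup.rightRel (Subgroup.centralizer (H : Set P)) :=
    Setoid.ext fun a b => by rw [DoubleCoset.rel_bot_eq_right_group_rel]
  rw [hs, Subgroup.card_bot, mul_one] at h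
  refine h.trans (Nat.card_congr
    { toFun := fun y => ⟨y.1.1, mem_transporter_iff.mp y.2.1⟩
      invFun := fun x => ⟨(x.1, 1), mem_transporter_iff.mpr x.2, by simp⟩
      left_inv := fun y => Subtype.ext (Prod.ext rfl (Subsingleton.elim _ _))
      right_inv := fun x => rfl })

theorem card_orbitHom (H K : Subgroup P) :
    Nat.card (OrbitHom H K) * Nat.card K =
      Nat.card {x : P // H.map (MulAut.conj x⁻¹).toMonoidHom ≤ K} := by
  have h := card_doubleCoset ⊥ K (transporter H K) fun a ha x hx b hb h hh => by
      have h2 : (x * b)⁻¹ * h * (x * b) = b⁻¹ * (x⁻¹ * h * x) * b := by group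
      rw [Subgroup.mem_bot.mp ha, one_mul, h2]
      exact K.mul_mem (K.mul_mem (K.inv_mem hb) (hx h hh)) hb
  have hs : DoubleCoset.setoid ((⊥ : Subgroup P) : Set P) (K : Set P) =
      QuotientGroup.leftRel K :=
    Setoid.ext fun a b => by rw [DoubleCoset.bot_rel_eq_leftRel]
  rw [hs, Subgroup.card_bot, one_mul] at h
  refine h.trans (Nat.card_congr
    { toFun := fun y => ⟨y.1.1, Subgroup.map_le_iff_le_comap.mpr (mem_transporter_iff.mp y.2.1)⟩
      invFun := fun x => ⟨(x.1, 1),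
        mem_transporter_iff.mpr (Subgroup.map_le_iff_le_comap.mp x.2), by simp⟩
      left_inv := fun y => Subtype.ext (Prod.ext rfl ?_)
      right_inv := fun x => rfl })
  have h1 : y.1.1 * (y.1.2 : P) * y.1.1⁻¹ = 1 := y.2.2
  exact (Subtype.ext (conj_eq_one_iff.mp h1)).symm

theorem comap_conj_ne_bot {K : Subgroup P} (hK : K ≠ ⊥) (g : P) :
    K.comap (MulAut.conj g).toMonoidHom ≠ ⊥ := fun h => hK (by
  have := Subgroup.map_comap_eq_self_of_surjective
    (f := (MulAut.conj g).toMonoidHom) (MulAut.conj g).surjective K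
  rw [← this, h, Subgroup.map_bot])

theorem comap_conj_ne_top {K : Subgroup P} (hK : K ≠ ⊤) (g : P) :
    K.comap (MulAut.conj g).toMonoidHom ≠ ⊤ := fun h => hK (by
  have := Subgroup.map_comap_eq_self_of_surjective
    (f := (MulAut.conj g).toMonoidHom) (MulAut.conj g).surjective K
  rw [← this, h]
  exact Subgroup.map_top_of_surjective _ (MulAut.conj g).surjective)

theorem map_conj_ne_top {K : Subgroup P} (hK : K ≠ ⊤) (g : P) :
    K.map (MulAut.conj g).toMonoidHom ≠ ⊤ := fun h => hK (by
  have := Subgroup.comap_map_eq_self_of_injective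
    (f := (MulAut.conj g).toMonoidHom) (MulAut.conj g).injective K
  rw [← this, h, Subgroup.comap_top])

theorem card_le_of_mem_transporter [Finite P] {H K : Subgroup P} {g : P}
    (hg : g ∈ transporter H K) : Nat.card H ≤ Nat.card K :=
  Nat.card_le_card_of_injective (fun h : H => (⟨g⁻¹ * h * g, hg h h.2⟩ : K)) fun a b hab =>
    Subtype.ext (by simpa using congrArg Subtype.val hab)

theorem inv_mem_transporter [Finite P] {H K : Subgroup P} {g : P}
    (hg : g ∈ transporter H K) (h : Nat.card H = Nat.card K) : g⁻¹ ∈ transporter K H := by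
  have hinj : Function.Injective (fun h : H => (⟨g⁻¹ * h * g, hg h h.2⟩ : K)) := fun a b hab =>
    Subtype.ext (by simpa using congrArg Subtype.val hab)
  have hsurj := (Nat.bijective_iff_injective_and_card _).mpr ⟨hinj, h⟩ |>.2
  intro k hk
  obtain ⟨h, hh⟩ := hsurj ⟨k, hk⟩
  have h1 : g⁻¹ * h * g = k := congrArg Subtype.val hh
  have h2 : g⁻¹⁻¹ * k * g⁻¹ = h := by rw [← h1]; group
  rw [h2]
  exact h.2

theorem card_orbitProper_hom (H K : OrbitProper P) :
    Nat.card (H ⟶ K) = Nat.card (OrbitHom H.obj.toSubgroup K.obj.toSubgroup) :=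
  Nat.card_congr ⟨fun f => f.hom, fun f => ObjectProperty.homMk f, fun _ => rfl, fun _ => rfl⟩

instance [Finite P] (H K : OrbitProper P) : Finite (H ⟶ K) :=
  have : Finite (OrbitHom H.obj.toSubgroup K.obj.toSubgroup) := Quotient.finite _
  Finite.of_injective (fun f => (f.hom : OrbitHom H.obj.toSubgroup K.obj.toSubgroup))
    fun _ _ h => ObjectProperty.hom_ext _ h

theorem card_fusionOpen_hom (H K : FusionOpen P) :
    Nat.card (H ⟶ K) = Nat.card (FusionHom H.obj.toSubgroup K.obj.toSubgroup) :=
  Nat.card_congr ⟨fun f => f.hom, fun f => ObjectProperty.homMk f, fun _ => rfl, fun _ => rfl⟩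

instance [Finite P] (H K : FusionOpen P) : Finite (H ⟶ K) :=
  have : Finite (FusionHom H.obj.toSubgroup K.obj.toSubgroup) := Quotient.finite _
  Finite.of_injective (fun f => (f.hom : FusionHom H.obj.toSubgroup K.obj.toSubgroup))
    fun _ _ h => ObjectProperty.hom_ext _ h

theorem card_exteriorOpen_hom (H K : ExteriorOpen P) :
    Nat.card (H ⟶ K) = Nat.card (ExteriorHom H.obj.toSubgroup K.obj.toSubgroup) :=
  Nat.card_congr ⟨fun f => f.hom, fun f => ObjectProperty.homMk f, fun _ => rfl, fun _ => rfl⟩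

instance [Finite P] (H K : ExteriorOpen P) : Finite (H ⟶ K) :=
  have : Finite (ExteriorHom H.obj.toSubgroup K.obj.toSubgroup) := Quotient.finite _
  Finite.of_injective (fun f => (f.hom : ExteriorHom H.obj.toSubgroup K.obj.toSubgroup))
    fun _ _ h => ObjectProperty.hom_ext _ h

variable (P) in
/-- The objects of `O_P^{[1,P)}` are the proper subgroups of `P`. -/
def orbitProperEquiv : OrbitProper P ≃ Set.Ico (⊥ : Subgroup P) ⊤ where
  toFun H := ⟨H.obj.toSubgroup, H.property⟩
  invFun H := ⟨⟨H.1⟩, H.2⟩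

variable (P) in
/-- The objects of `F_P^{(1,P)}` are the nonidentity proper subgroups of `P`. -/
def fusionOpenEquiv : FusionOpen P ≃ Set.Ioo (⊥ : Subgroup P) ⊤ where
  toFun H := ⟨H.obj.toSubgroup, H.property⟩
  invFun H := ⟨⟨H.1⟩, H.2⟩

variable (P) in
/-- The objects of `F̃_P^{(1,P)}` are the nonidentity proper subgroups of `P`. -/
def exteriorOpenEquiv : ExteriorOpen P ≃ Set.Ioo (⊥ : Subgroup P) ⊤ where
  toFun H := ⟨H.obj.toSubgroup, H.property⟩
  invFun H := ⟨⟨H.1⟩, H.2⟩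

instance [Finite P] : Finite (OrbitProper P) := Finite.of_equiv _ (orbitProperEquiv P).symm

instance [Finite P] : Finite (FusionOpen P) := Finite.of_equiv _ (fusionOpenEquiv P).symm

instance [Finite P] : Finite (ExteriorOpen P) := Finite.of_equiv _ (exteriorOpenEquiv P).symm

theorem card_le_of_orbit_hom [Finite P] {H K : OrbitProper P} (f : H ⟶ K) :
    Nat.card H.obj.toSubgroup ≤ Nat.card K.obj.toSubgroup := by
  obtain ⟨⟨⟨g, hg⟩⟩⟩ := f
  exact card_le_of_mem_transporter hg

theorem card_le_of_fusion_hom [Finite P] {H K : FusionOpen P} (f : H ⟶ K) :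
    Nat.card H.obj.toSubgroup ≤ Nat.card K.obj.toSubgroup := by
  obtain ⟨⟨⟨g, hg⟩⟩⟩ := f
  exact card_le_of_mem_transporter hg

theorem card_le_of_exterior_hom [Finite P] {H K : ExteriorOpen P} (f : H ⟶ K) :
    Nat.card H.obj.toSubgroup ≤ Nat.card K.obj.toSubgroup := by
  obtain ⟨⟨⟨g, hg⟩⟩⟩ := f
  exact card_le_of_mem_transporter hg

theorem nonempty_orbit_iso [Finite P] {H K : OrbitProper P} (f : H ⟶ K)
    (h : Nat.card H.obj.toSubgroup = Nat.card K.obj.toSubgroup) : Nonempty (H ≅ K) := by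
  obtain ⟨⟨⟨g, hg⟩⟩⟩ := f
  exact ⟨ObjectProperty.isoMk _
    { hom := Quotient.mk _ ⟨g, hg⟩
      inv := Quotient.mk _ ⟨g⁻¹, inv_mem_transporter hg h⟩
      hom_inv_id := congrArg (Quotient.mk _) (Subtype.ext (mul_inv_cancel g))
      inv_hom_id := congrArg (Quotient.mk _) (Subtype.ext (inv_mul_cancel g)) }⟩

theorem nonempty_fusion_iso [Finite P] {H K : FusionOpen P} (f : H ⟶ K)
    (h : Nat.card H.obj.toSubgroup = Nat.card K.obj.toSubgroup) : Nonempty (H ≅ K) := by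
  obtain ⟨⟨⟨g, hg⟩⟩⟩ := f
  exact ⟨ObjectProperty.isoMk _
    { hom := Quotient.mk _ ⟨g, hg⟩
      inv := Quotient.mk _ ⟨g⁻¹, inv_mem_transporter hg h⟩
      hom_inv_id := congrArg (Quotient.mk _) (Subtype.ext (mul_inv_cancel g))
      inv_hom_id := congrArg (Quotient.mk _) (Subtype.ext (inv_mul_cancel g)) }⟩

theorem nonempty_exterior_iso [Finite P] {H K : ExteriorOpen P} (f : H ⟶ K)
    (h : Nat.card H.obj.toSubgroup = Nat.card K.obj.toSubgroup) : Nonempty (H ≅ K) := by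
  obtain ⟨⟨⟨g, hg⟩⟩⟩ := f
  exact ⟨ObjectProperty.isoMk _
    { hom := Quotient.mk _ ⟨g, hg⟩
      inv := Quotient.mk _ ⟨g⁻¹, inv_mem_transporter hg h⟩
      hom_inv_id := congrArg (Quotient.mk _) (Subtype.ext (mul_inv_cancel g))
      inv_hom_id := congrArg (Quotient.mk _) (Subtype.ext (inv_mul_cancel g)) }⟩

end HomSets

/-! ### Euler characteristics -/

section EulerChar

variable {P : Type u} [Group P] [Finite P]

/-- The coweighting is `H ↦ -μ(1, H)`. -/
theorem hasReducedEulerChar_posetOpen [Nontrivial P] :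
    HasReducedEulerChar (PosetOpen P) (subgroupMoebius P : ℚ) := by
  have hfin : ∀ a b : PosetOpen P, Finite (a ⟶ b) := fun a b => inferInstance
  have hk : IsCoweighting (PosetOpen P) fun H => -moebius ⊥ H.1 := by
    intro L
    have h := finsum_moebius_bot_mul_card (fun _ : Unit => L.1) fun _ => L.2.1.ne'
    have h1 : Nat.card {_x : Unit // L.1 = ⊤} = 0 := by
      simp [L.2.2.ne]
    rw [h1, Nat.card_unique] at h
    simp only [neg_mul]
    rw [finsum_neg_distrib]
    have h2 : ∀ H : PosetOpen P, Nat.card (H ⟶ L) = Nat.card {_x : Unit // H.1 ≤ L.1} := fun H =>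
      Nat.card_congr
        { toFun := fun f => ⟨(), leOfHom f⟩
          invFun := fun x => homOfLE x.2
          left_inv := fun _ => Subsingleton.elim _ _
          right_inv := fun _ => rfl }
    simp only [h2]
    rw [h]
    simp
  refine ⟨_, hk.hasEulerChar (fun H => Nat.card H.1)
    (fun f => Subgroup.card_le_of_le (leOfHom f)) fun f h => ⟨eqToIso ?_⟩, ?_⟩
  · exact Subtype.ext (Subgroup.eq_of_le_of_card_ge (leOfHom f) h.ge)
  · have h := finsum_moebius_bot_mul_card (fun _ : Unit => (⊤ : Subgroup P)) fun _ => top_ne_bot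
    simp only [le_top, Nat.card_congr (Equiv.subtypeUnivEquiv fun _ : Unit => trivial),
      Nat.card_unique, Nat.cast_one, mul_one] at h
    rw [finsum_neg_distrib, h, moebius_bot_top]
    simp

/-- The sum of the coweighting `H ↦ -μ(1, H) |C_P(H)| / |P|`, by the count of the pairs `(H, x)`
with `H ≤ C_P(x)`. -/
theorem finsum_moebius_mul_card_centralizer {p : ℕ} [Fact p.Prime] [Nontrivial P]
    (hP : IsPGroup p P) :
    (∑ᶠ H : Set.Ioo (⊥ : Subgroup P) ⊤, -moebius ⊥ H.1 *
        (Nat.card (Subgroup.centralizer (H.1 : Set P)) : ℚ) / Nat.card P) - 1 =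
      (subgroupMoebius P : ℚ) * ((Subgroup.center P).index : ℚ)⁻¹ := by
  have hne : ∀ x : P, Subgroup.centralizer {x} ≠ ⊥ := fun x h => by
    have := hP.center_nontrivial
    refine (Subgroup.nontrivial_iff_ne_bot _).mp this (le_bot_iff.mp (h ▸ fun z hz => ?_))
    exact Subgroup.mem_centralizer_singleton_iff.mpr (Subgroup.mem_center_iff.mp hz x).symm
  have h := finsum_moebius_bot_mul_card (fun x : P => Subgroup.centralizer {x}) hne
  have h1 : ∀ H : Subgroup P, Nat.card {x : P // H ≤ Subgroup.centralizer {x}} =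
      Nat.card (Subgroup.centralizer (H : Set P)) := fun H =>
    Nat.card_congr (Equiv.subtypeEquivRight fun x => by
      rw [Subgroup.mem_centralizer_iff]
      exact forall₂_congr fun h _ => Subgroup.mem_centralizer_singleton_iff)
  have h2 : Nat.card {x : P // Subgroup.centralizer {x} = ⊤} = Nat.card (Subgroup.center P) :=
    Nat.card_congr (Equiv.subtypeEquivRight fun x => by
      rw [Subgroup.mem_center_iff, Subgroup.eq_top_iff']
      exact forall_congr' fun h => Subgroup.mem_centralizer_singleton_iff)
  simp only [h1, h2, moebius_bot_top] at h
  have h3 : (Nat.card (Subgroup.center P) : ℚ) * (Subgroup.center P).index = Nat.card P := by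
    exact_mod_cast (Subgroup.center P).card_mul_index
  have h4 : (Nat.card P : ℚ) ≠ 0 := by exact_mod_cast Nat.card_pos.ne'
  have h5 : ((Subgroup.center P).index : ℚ) ≠ 0 := fun h0 => h4 (by rw [← h3, h0, mul_zero])
  have h6 : (Nat.card (Subgroup.center P) : ℚ) ≠ 0 := fun h0 => h4 (by rw [← h3, h0, zero_mul])
  have h7 : ∀ H : Set.Ioo (⊥ : Subgroup P) ⊤,
      -moebius ⊥ H.1 * (Nat.card (Subgroup.centralizer (H.1 : Set P)) : ℚ) / Nat.card P =
        moebius ⊥ H.1 * (Nat.card (Subgroup.centralizer (H.1 : Set P)) : ℚ) *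
          -(Nat.card P : ℚ)⁻¹ := fun H => by ring
  simp only [h7]
  rw [← finsum_mul, h, ← h3]
  field_simp
  ring

/-- The coweighting is `H ↦ -μ(1, H) |C_P(H)| / |P|`, because `|F_P(H, K)| |C_P(H)|` is the number
of `x` with `H ≤ x K x⁻¹`. -/
theorem hasReducedEulerChar_fusionOpen {p : ℕ} [Fact p.Prime] [Nontrivial P]
    (hP : IsPGroup p P) :
    HasReducedEulerChar (FusionOpen P)
      ((subgroupMoebius P : ℚ) * ((Subgroup.center P).index : ℚ)⁻¹) := by
  have h4 : (Nat.card P : ℚ) ≠ 0 := by exact_mod_cast Nat.card_pos.ne'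
  have hk : IsCoweighting (FusionOpen P) fun H => -moebius ⊥ H.obj.toSubgroup *
      (Nat.card (Subgroup.centralizer (H.obj.toSubgroup : Set P)) : ℚ) / Nat.card P := by
    intro K
    have h := finsum_moebius_bot_mul_card
      (fun x : P => K.obj.toSubgroup.comap (MulAut.conj x⁻¹).toMonoidHom)
      fun x => comap_conj_ne_bot K.property.1.ne' _
    have h1 : Nat.card {x : P // K.obj.toSubgroup.comap (MulAut.conj x⁻¹).toMonoidHom = ⊤} = 0 := by
      have : IsEmpty {x : P // K.obj.toSubgroup.comap (MulAut.conj x⁻¹).toMonoidHom = ⊤} :=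
        ⟨fun x => comap_conj_ne_top K.property.2.ne _ x.2⟩
      exact Nat.card_of_isEmpty
    simp only [h1, Nat.cast_zero, mul_zero, sub_zero, ← card_fusionHom, Nat.cast_mul] at h
    refine (finsum_eq_of_bijective _ (fusionOpenEquiv P).bijective fun H => ?_).trans
      ((finsum_mul _ (-(Nat.card P : ℚ)⁻¹)).symm.trans
        ((congrArg (· * -(Nat.card P : ℚ)⁻¹) h).trans ?_))
    · rw [card_fusionOpen_hom]
      change _ = moebius ⊥ H.obj.toSubgroup * _ * _
      simp only [fusionOpenEquiv, Equiv.coe_fn_mk]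
      ring
    · field_simp
  refine ⟨_, hk.hasEulerChar (fun H => Nat.card H.obj.toSubgroup) card_le_of_fusion_hom
    nonempty_fusion_iso, ?_⟩
  rw [← finsum_moebius_mul_card_centralizer hP, ← finsum_comp_equiv (fusionOpenEquiv P)]
  rfl

/-- The coweighting is the same as for `F_P^{(1,P)}`, because `|F̃_P(H, K)| |C_P(H)| |K|` is the
number of pairs `(x, k)` with `H ≤ x C_K(k) x⁻¹`, and `C_K(k)` contains the nontrivial center of
`K`. -/
theorem hasReducedEulerChar_exteriorOpen {p : ℕ} [Fact p.Prime] [Nontrivial P]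
    (hP : IsPGroup p P) :
    HasReducedEulerChar (ExteriorOpen P)
      ((subgroupMoebius P : ℚ) * ((Subgroup.center P).index : ℚ)⁻¹) := by
  have h4 : (Nat.card P : ℚ) ≠ 0 := by exact_mod_cast Nat.card_pos.ne'
  have hk : IsCoweighting (ExteriorOpen P) fun H => -moebius ⊥ H.obj.toSubgroup *
      (Nat.card (Subgroup.centralizer (H.obj.toSubgroup : Set P)) : ℚ) / Nat.card P := by
    intro K
    have hK : (Nat.card K.obj.toSubgroup : ℚ) ≠ 0 := by exact_mod_cast Nat.card_pos.ne'
    -- An element of the nontrivial `p`-group `K` centralizes the center of `K`.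
    have hcent : ∀ k : K.obj.toSubgroup,
        K.obj.toSubgroup ⊓ Subgroup.centralizer {(k : P)} ≠ ⊥ := fun k hk => by
      have : Nontrivial K.obj.toSubgroup :=
        (Subgroup.nontrivial_iff_ne_bot _).mpr K.property.1.ne'
      have := (hP.to_subgroup K.obj.toSubgroup).center_nontrivial
      obtain ⟨z, hz⟩ := exists_ne (1 : Subgroup.center K.obj.toSubgroup)
      have h1 : ((z : K.obj.toSubgroup) : P) ∈
          K.obj.toSubgroup ⊓ Subgroup.centralizer {(k : P)} :=
        ⟨z.1.2, Subgroup.mem_centralizer_singleton_iff.mpr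
          (congrArg Subtype.val (Subgroup.mem_center_iff.mp z.2 k)).symm⟩
      rw [hk, Subgroup.mem_bot] at h1
      exact hz (Subtype.ext (Subtype.ext h1))
    have h := finsum_moebius_bot_mul_card
      (fun y : P × K.obj.toSubgroup => (K.obj.toSubgroup ⊓ Subgroup.centralizer {(y.2 : P)}).comap
        (MulAut.conj y.1⁻¹).toMonoidHom)
      fun y => comap_conj_ne_bot (hcent y.2) _
    have h1 : Nat.card {y : P × K.obj.toSubgroup //
        (K.obj.toSubgroup ⊓ Subgroup.centralizer {(y.2 : P)}).comap
          (MulAut.conj y.1⁻¹).toMonoidHom = ⊤} = 0 := by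
      have : IsEmpty {y : P × K.obj.toSubgroup //
          (K.obj.toSubgroup ⊓ Subgroup.centralizer {(y.2 : P)}).comap
            (MulAut.conj y.1⁻¹).toMonoidHom = ⊤} :=
        ⟨fun y => comap_conj_ne_top (lt_of_le_of_lt inf_le_left K.property.2).ne _ y.2⟩
      exact Nat.card_of_isEmpty
    simp only [h1, Nat.cast_zero, mul_zero, sub_zero, ← card_exteriorHom, Nat.cast_mul,
      Nat.card_prod] at h
    refine (finsum_eq_of_bijective _ (exteriorOpenEquiv P).bijective fun H => ?_).trans
      ((finsum_mul _ (-((Nat.card P : ℚ) * Nat.card K.obj.toSubgroup)⁻¹)).symm.trans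
        ((congrArg (· * -((Nat.card P : ℚ) * Nat.card K.obj.toSubgroup)⁻¹) h).trans ?_))
    · rw [card_exteriorOpen_hom]
      simp only [exteriorOpenEquiv, Equiv.coe_fn_mk]
      field_simp
    · field_simp
  refine ⟨_, hk.hasEulerChar (fun H => Nat.card H.obj.toSubgroup) card_le_of_exterior_hom
    nonempty_exterior_iso, ?_⟩
  rw [← finsum_moebius_mul_card_centralizer hP, ← finsum_comp_equiv (exteriorOpenEquiv P)]
  rfl

/-- The Euler characteristic of `O_P^{[1,P)}` is the proportion of elements of `P` which do not
generate `P`: the weighting is `K ↦ -μ(K, P) |K| / |P|`, because `|O_P(H, K)| |K|` is the number of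
`x` with `x⁻¹ H x ≤ K`. -/
theorem hasEulerChar_orbitProper :
    HasEulerChar (OrbitProper P)
      (1 - (Nat.card {x : P // Subgroup.zpowers x = ⊤} : ℚ) / Nat.card P) := by
  have h4 : (Nat.card P : ℚ) ≠ 0 := by exact_mod_cast Nat.card_pos.ne'
  have hk : IsWeighting (OrbitProper P) fun K => -moebius K.obj.toSubgroup ⊤ *
      (Nat.card K.obj.toSubgroup : ℚ) / Nat.card P := by
    intro H
    have h := finsum_moebius_top_mul_card
      (fun x : P => H.obj.toSubgroup.map (MulAut.conj x⁻¹).toMonoidHom)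
    have h1 : Nat.card {x : P // H.obj.toSubgroup.map (MulAut.conj x⁻¹).toMonoidHom = ⊤} = 0 := by
      have : IsEmpty {x : P // H.obj.toSubgroup.map (MulAut.conj x⁻¹).toMonoidHom = ⊤} :=
        ⟨fun x => map_conj_ne_top H.property.2.ne _ x.2⟩
      exact Nat.card_of_isEmpty
    simp only [h1, Nat.cast_zero, zero_sub, ← card_orbitHom, Nat.cast_mul] at h
    refine (finsum_eq_of_bijective _ (orbitProperEquiv P).bijective fun K => ?_).trans
      ((finsum_mul _ (-(Nat.card P : ℚ)⁻¹)).symm.trans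
        ((congrArg (· * -(Nat.card P : ℚ)⁻¹) h).trans ?_))
    · rw [card_orbitProper_hom]
      simp only [orbitProperEquiv, Equiv.coe_fn_mk]
      ring
    · field_simp
  convert hk.hasEulerChar (fun H => Nat.card H.obj.toSubgroup) card_le_of_orbit_hom
    nonempty_orbit_iso using 1
  have h := finsum_moebius_top_mul_card (fun x : P => Subgroup.zpowers x)
  simp only [Subgroup.zpowers_le] at h
  refine Eq.symm ((finsum_eq_of_bijective _ (orbitProperEquiv P).bijective fun K => ?_).trans
      ((finsum_mul _ (-(Nat.card P : ℚ)⁻¹)).symm.trans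
        ((congrArg (· * -(Nat.card P : ℚ)⁻¹) h).trans ?_)))
  · simp only [orbitProperEquiv, Equiv.coe_fn_mk]
    have h5 : Nat.card {x // x ∈ K.obj.toSubgroup} = Nat.card K.obj.toSubgroup := rfl
    rw [h5]
    ring
  · field_simp
    ring

/-- A cyclic group of order `p ^ (m + 1)` has `p ^ m (p - 1)` generators. -/
theorem hasEulerChar_orbitProper_of_isCyclic {p : ℕ} [Fact p.Prime] [Nontrivial P]
    (hP : IsPGroup p P) (h : IsCyclic P) : HasEulerChar (OrbitProper P) (p : ℚ)⁻¹ := by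
  convert hasEulerChar_orbitProper (P := P) using 1
  obtain ⟨n, hn⟩ := IsPGroup.iff_card.mp hP
  have hp : p.Prime := Fact.out
  have hn0 : n ≠ 0 := by
    rintro rfl
    exact (Finite.one_lt_card (α := P)).ne' (by simpa using hn)
  obtain ⟨m, rfl⟩ := Nat.exists_eq_succ_of_ne_zero hn0
  have h1 : Nat.card {x : P // Subgroup.zpowers x = ⊤} = p ^ m * (p - 1) := by
    classical
    have : Fintype P := Fintype.ofFinite P
    have h2 := IsCyclic.card_orderOf_eq_totient (α := P) (d := Nat.card P) (by simp)
    rw [hn, Nat.totient_prime_pow_succ hp, ← hn] at h2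
    rw [← h2, Nat.card_eq_fintype_card, Fintype.card_subtype]
    congr 1
    ext x
    simp only [Finset.mem_filter, Finset.mem_univ, true_and]
    rw [← Nat.card_zpowers, Subgroup.card_eq_iff_eq_top]
  rw [h1, hn]
  have hp0 : (p : ℚ) ≠ 0 := by exact_mod_cast hp.ne_zero
  rw [Nat.succ_eq_add_one, pow_succ]
  push_cast [hp.one_le]
  field_simp
  ring

theorem hasEulerChar_orbitProper_of_not_isCyclic (h : ¬ IsCyclic P) :
    HasEulerChar (OrbitProper P) 1 := by
  convert hasEulerChar_orbitProper (P := P) using 1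
  have : IsEmpty {x : P // Subgroup.zpowers x = ⊤} :=
    ⟨fun x => h ⟨x.1, (Subgroup.eq_top_iff' _).mp x.2⟩⟩
  rw [Nat.card_of_isEmpty]
  simp

end EulerChar

end SubgroupCat

end

theorem lemma4p1 {p : ℕ} [Fact p.Prime] {P : Type*} [Group P] [Finite P] [Nontrivial P]
    (hP : IsPGroup p P) :
    (SubgroupCat.HasReducedEulerChar (SubgroupCat.PosetOpen P)
          (SubgroupCat.subgroupMoebius P : ℚ) ∧
      SubgroupCat.HasReducedEulerChar (SubgroupCat.ExteriorOpen P)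
          ((SubgroupCat.subgroupMoebius P : ℚ) * ((Subgroup.center P).index : ℚ)⁻¹) ∧
      SubgroupCat.HasReducedEulerChar (SubgroupCat.FusionOpen P)
          ((SubgroupCat.subgroupMoebius P : ℚ) * ((Subgroup.center P).index : ℚ)⁻¹) ∧
      (IsCyclic P → SubgroupCat.HasEulerChar (SubgroupCat.OrbitProper P) (p : ℚ)⁻¹) ∧
      (¬ IsCyclic P → SubgroupCat.HasEulerChar (SubgroupCat.OrbitProper P) 1)) ∧
    (¬ SubgroupCat.IsContractible (SubgroupCat.PosetOpen P) ↔
      SubgroupCat.IsElementaryAbelian P p) ∧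
    SubgroupCat.HomotopyEquivalent (SubgroupCat.OrbitProper P)
      (SubgroupCat.OrbitProper (P ⧸ frattini P)) ∧
    (¬ SubgroupCat.IsContractible (SubgroupCat.ExteriorOpen P) ↔
      SubgroupCat.IsElementaryAbelian P p) := by
  have hcentral : ¬ SubgroupCat.IsElementaryAbelian P p →
      frattini P ⊓ Subgroup.center P ≠ ⊥ := fun h =>
    SubgroupCat.inf_center_ne_bot hP fun h' =>
      h (SubgroupCat.isElementaryAbelian_of_frattini_eq_bot hP h')
  have htop : frattini P ⊓ Subgroup.center P < ⊤ := by
    have := SubgroupCat.sup_lt_top_of_le_frattini (bot_lt_top : (⊥ : Subgroup P) < ⊤)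
      (inf_le_left : frattini P ⊓ Subgroup.center P ≤ frattini P)
    rwa [bot_sup_eq] at this
  refine ⟨⟨SubgroupCat.hasReducedEulerChar_posetOpen,
    SubgroupCat.hasReducedEulerChar_exteriorOpen hP,
    SubgroupCat.hasReducedEulerChar_fusionOpen hP,
    SubgroupCat.hasEulerChar_orbitProper_of_isCyclic hP,
    SubgroupCat.hasEulerChar_orbitProper_of_not_isCyclic⟩,
    ⟨fun h => ?_, SubgroupCat.not_isContractible_posetOpen⟩,
    SubgroupCat.homotopyEquivalent_orbitProper P, ⟨fun h => ?_, fun h => ?_⟩⟩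
  · by_contra hel
    exact h (SubgroupCat.isContractible_posetOpen_of_le_frattini (hcentral hel) inf_le_left htop)
  · by_contra hel
    exact h (SubgroupCat.isContractible_exteriorOpen_of_le_frattini (hcentral hel) inf_le_right
      inf_le_left htop)
  · rw [SubgroupCat.isContractible_exteriorOpen_iff_of_comm h.1]
    exact SubgroupCat.not_isContractible_posetOpen h
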